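/- **Setting.** Let $d,k\in\mathbb N$, let $\mathcal P^2(\mathbb R^k)$ be the set of probability measures on $\mathbb R^k$ with finite second moment, with the Wasserstein distance $W_2$, and let $\mathcal C([0,1];\mathcal P^2)$ be the set of $W_2$-continuous paths $t\mapsto\nu(\cdot,t)\in\mathcal P^2(\mathbb R^k)$, with the metric $d_1(\nu_1,\nu_2)=\sup_{t\in[0,1]}W_2(\nu_1(\cdot,t),\nu_2(\cdot,t))$. *Activation function.* Let $f:\mathbb R^d\times\mathbb R^k\to\mathbb R^d$ be $\mathcal C^1$ and such that: (1) $|f(x,\theta)|\le C_1(|\theta|^2+1)(|x|+1)$ for all $x,\theta$, for some constant $C_1$; (2) there is an increasing function $C_2$ such that, whenever $|x|<r$, $|\partial_xf|\le C_2(r)(|\theta|^2+1)$ and $|\partial_\theta f|\le C_2(r)(|\theta|+1)$; (3) there is an increasing function $C_3$ such that, for every $r>0$, the differential of $f$ is Lipschitz with constant $C_3(r)$ on $\{|x|\le r,\ |\theta|\le r\}$ (for $\mathcal C^2$ functions: the second derivatives of $f$ are locally bounded); (4) (universal kernel) for all $R>0$, the functions $x\mapsto\int f(x,\theta)\,d\nu(\theta)$,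 $\nu\in\mathcal P^2(\mathbb R^k)$, approximate every continuous $\varphi:\mathbb R^d\to\mathbb R^d$ arbitrarily well, uniformly on $\{|x|<R\}$; (5) (2-homogeneity) $f(x,\lambda\theta)=\lambda^2f(x,\theta)$ for all $x\in\mathbb R^d$, $\theta\in\mathbb R^k$, $\lambda\in\mathbb R$. *Data.* Let $g,y:\mathbb R^d\to\mathbb R$ be $\mathcal C^2$ with $g,\nabla g$ Lipschitz and $\inf|\nabla g|>0$, and let $\mu$ be a compactly supported probability measure on $\mathbb R^d$. *Loss.* For $\rho\in\mathcal C([0,1];\mathcal P^2)$ and $x\in\mathbb R^d$ let $Z_\rho(\cdot;x)$ solve $\dot Z=\int f(Z,\theta)\,d\rho(\theta,t)$ on $[0,1]$, $Z(0)=x$, and let $p_\rho(\cdot;x)$ solve $\dot p^\top=-p^\top\int\partial_zf(Z_\rho(t;x),\theta)\,d\rho(\theta,t)$ on $[0,1]$, $p(1)=(g(Z_\rho(1;x))-y(x))\nabla g(Z_\rho(1;x))$. Put $$E(\rho)=\mathbb E_{x\sim\mu}\big[\tfrac12(g(Z_\rho(1;x))-y(x))^2\big],\qquad \frac{\delta E}{\delta\rho}\Big|_\rho(\theta,t)=\mathbb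 E_{x\sim\mu}\big[p_\rho(t;x)^\top f(Z_\rho(t;x),\theta)\big].$$ *Initial datum.* Let $\rho_{\rm ini}\in\mathcal C([0,1];\mathcal P^2)$ have supports $\operatorname{supp}\rho_{\rm ini}(\cdot,t)$, $t\in[0,1]$, contained in one common ball, and be *limit-admissible*: there are a stochastic process $(X_t)_{t\in[0,1]}$ with values in $\mathbb R^k$, with continuous paths, uniformly bounded, mean-square continuous and with $X_t\sim\rho_{\rm ini}(\cdot,t)$ for all $t$, and constants $C,C'>\sup_t\int|\theta|^2d\rho_{\rm ini}(\theta,t)$, such that for all $\eta>0$ and all $M>C/\eta$, i.i.d. copies $X^1,\dots,X^M$ of $X$ satisfy $\mathbb P\big(\sup_t\frac1M\sum_m|X^m_t|^2\le C'\big)\ge1-\eta$ and, for all integers $L\ge1$, $\mathbb P\big(\frac1M\sum_{l=0}^{L-1}\sum_m\int_{l/L}^{(l+1)/L}|X^m_t-X^m_{l/L}|^2dt\le C'/L^2\big)\ge1-\eta$. *Gradient flow.* Let $\rho(\theta,t,s)\in\mathcal C([0,\infty);\mathcal C([0,1];\mathcal P^2))$ (continuous in $s\ge0$ with respect to $d_1$)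 solve, for every $t\in[0,1]$ and in the sense of distributions in $\theta$, $$\partial_s\rho=\nabla_\theta\cdot\Big(\rho\,\nabla_\theta\frac{\delta E}{\delta\rho}\Big|_{\rho(\cdot,\cdot,s)}\Big),\quad s>0,\qquad \rho(\cdot,t,0)=\rho_{\rm ini}(\cdot,t).$$ **Theorem.** Suppose that $\rho(\cdot,\cdot,s)$ converges, as $s\to\infty$, to some $\rho_\infty$ in $\mathcal C([0,1];\mathcal P^2)$ (i.e. in $d_1$), and that for some $t_0\in[0,1]$: * (separation) for some $0<r_a<r_b$, the support of $\rho_{\rm ini}(\cdot,t_0)$ separates the spheres $r_a\mathbb S^{k-1}$ and $r_b\mathbb S^{k-1}$, i.e. every continuous path in $\mathbb R^k$ from one sphere to the other meets it; * (Sard-type regularity) every value taken on $\mathbb S^{k-1}$ by $h=\frac{\delta E}{\delta\rho}\big|_{\rho_\infty}(\cdot,t_0)$ is a limit of regular values of $h|_{\mathbb S^{k-1}}$, where $\alpha\in\mathbb R$ is a regular value if the (possibly empty) set $\{\theta\in\mathbb S^{k-1}:h(\theta)=\alpha\}$ is contained in an open set in which $h$ is differentiable and the differential of $h|_{\mathbb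 S^{k-1}}$ does not vanish. Then $E(\rho_\infty)=0$. -/

import Mathlib

open MeasureTheory Set Filter Topology
open scoped ENNReal NNReal

namespace ResNet

/-- Euclidean space `ℝⁿ` with its Euclidean norm. -/
abbrev Euc (n : ℕ) : Type := EuclideanSpace ℝ (Fin n)

/-! ### Probability measures with finite second moment and the Wasserstein distance -/

/-- `ν` belongs to `𝒫²(ℝᵏ)`: a probability measure with finite second moment. -/
def MemP2 {k : ℕ} (ν : Measure (Euc k)) : Prop :=
  IsProbabilityMeasure ν ∧ ∫⁻ θ, ‖θ‖ₑ ^ 2 ∂ν < ∞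

/-- `π` is a coupling of `ν₁` and `ν₂`. -/
def IsCoupling {k : ℕ} (ν₁ ν₂ : Measure (Euc k)) (π : Measure (Euc k × Euc k)) : Prop :=
  π.map Prod.fst = ν₁ ∧ π.map Prod.snd = ν₂

/-- The Wasserstein distance `W₂`, with values in `[0, ∞]`. -/
noncomputable def W2 {k : ℕ} (ν₁ ν₂ : Measure (Euc k)) : ℝ≥0∞ :=
  (⨅ (π : Measure (Euc k × Euc k)) (_ : IsCoupling ν₁ ν₂ π),
    ∫⁻ q, ‖q.1 - q.2‖ₑ ^ 2 ∂π) ^ (1 / 2 : ℝ)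

/-- `ν` belongs to `𝒞([0,1]; 𝒫²)`. A path is a function of `t : ℝ` of which only the values at
`t ∈ [0,1]` matter. -/
structure IsPath {k : ℕ} (ν : ℝ → Measure (Euc k)) : Prop where
  memP2 : ∀ t ∈ Icc (0 : ℝ) 1, MemP2 (ν t)
  continuous : ∀ t₀ ∈ Icc (0 : ℝ) 1,
    Tendsto (fun t => W2 (ν t) (ν t₀)) (𝓝[Icc (0 : ℝ) 1] t₀) (𝓝 0)

/-- The metric `d₁(ν₁, ν₂) = sup_{t ∈ [0,1]} W₂(ν₁(t), ν₂(t))` of `𝒞([0,1]; 𝒫²)`. -/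
noncomputable def d1 {k : ℕ} (ν₁ ν₂ : ℝ → Measure (Euc k)) : ℝ≥0∞ :=
  ⨆ t ∈ Icc (0 : ℝ) 1, W2 (ν₁ t) (ν₂ t)

/-! ### Assumptions on the activation function and on the data -/

/-- Standing assumptions on the activation function `f`. The second-order bound is required in its
integrated form: the differential of `f` is Lipschitz, with constant `C₃(r)`, on
`{|x| ≤ r, |θ| ≤ r}`. For a `C²` function this is the local boundedness of all second-order partial
derivatives `∂ₓⁱ ∂_θʲ f`, `i + j = 2`. -/
structure ActivationAssumption {d k : ℕ} (f : Euc d → Euc k → Euc d) : Prop where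
  contDiff : ContDiff ℝ 1 (fun q : Euc d × Euc k => f q.1 q.2)
  linear_growth : ∃ C₁ : ℝ, ∀ x θ, ‖f x θ‖ ≤ C₁ * (‖θ‖ ^ 2 + 1) * (‖x‖ + 1)
  locally_lipschitz : ∃ C₂ : ℝ → ℝ, Monotone C₂ ∧ ∀ r > 0, ∀ x θ, ‖x‖ < r →
    ‖fderiv ℝ (fun z => f z θ) x‖ ≤ C₂ r * (‖θ‖ ^ 2 + 1) ∧
    ‖fderiv ℝ (fun ϑ => f x ϑ) θ‖ ≤ C₂ r * (‖θ‖ + 1)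
  local_smoothness : ∃ C₃ : ℝ → ℝ≥0, Monotone C₃ ∧ ∀ r > 0,
    LipschitzOnWith (C₃ r) (fderiv ℝ (fun q : Euc d × Euc k => f q.1 q.2))
      {q | ‖q.1‖ ≤ r ∧ ‖q.2‖ ≤ r}
  universal_kernel : ∀ R > 0, ∀ φ : Euc d → Euc d, Continuous φ → ∀ ε > 0,
    ∃ ν : Measure (Euc k), MemP2 ν ∧ ∀ x, ‖x‖ < R → ‖φ x - ∫ θ, f x θ ∂ν‖ < ε

/-- `f` is `2`-homogeneous in `θ`. -/
def TwoHomogeneous {d k : ℕ} (f : Euc d → Euc k → Euc d) : Prop :=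
  ∀ (x : Euc d) (θ : Euc k) (c : ℝ), f x (c • θ) = c ^ 2 • f x θ

/-- Standing assumptions on the measuring function `g`, the label `y` and the law `μ` of the
data. -/
structure DataAssumption {d : ℕ} (g y : Euc d → ℝ) (μ : Measure (Euc d)) : Prop where
  contDiff_g : ContDiff ℝ 2 g
  contDiff_y : ContDiff ℝ 2 y
  probability : IsProbabilityMeasure μ
  compact_support : ∃ R > 0, μ.support ⊆ Metric.ball 0 R
  locally_bounded : ∀ R : ℝ, ∃ C : ℝ, ∀ x, ‖x‖ ≤ R → |y x| ≤ C
  lipschitz_g : ∃ K : ℝ≥0, LipschitzWith K g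
  lipschitz_gradient : ∃ K : ℝ≥0, LipschitzWith K (gradient g)
  gradient_lower_bound : ∃ c > 0, ∀ x, c ≤ ‖gradient g x‖

/-! ### Continuous mean-field ResNet, loss and first variation -/

/-- `z` solves `z'(t) = ∫ f(z(t), θ) dρ(θ, t)` on `[0,1]` with `z(0) = x`. -/
def IsState {d k : ℕ} (f : Euc d → Euc k → Euc d) (ρ : ℝ → Measure (Euc k)) (x : Euc d)
    (z : ℝ → Euc d) : Prop :=
  z 0 = x ∧ ∀ t ∈ Icc (0 : ℝ) 1,
    HasDerivWithinAt z (∫ θ, f (z t) θ ∂(ρ t)) (Icc (0 : ℝ) 1) t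

/-- `Z_ρ(t; x)`: the solution of the state equation (existing and unique on `[0,1]` when
`ρ ∈ 𝒞([0,1]; 𝒫²)` and `f` satisfies the standing assumptions). -/
noncomputable def state {d k : ℕ} (f : Euc d → Euc k → Euc d) (ρ : ℝ → Measure (Euc k))
    (x : Euc d) : ℝ → Euc d :=
  Classical.epsilon (IsState f ρ x)

/-- The loss `E(ρ) = 𝔼_{x ∼ μ} [ (g(Z_ρ(1; x)) - y(x))² / 2 ]`, as an element of `[0, ∞]`. -/
noncomputable def loss {d k : ℕ} (f : Euc d → Euc k → Euc d) (g y : Euc d → ℝ)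
    (μ : Measure (Euc d)) (ρ : ℝ → Measure (Euc k)) : ℝ≥0∞ :=
  ∫⁻ x, ENNReal.ofReal ((g (state f ρ x 1) - y x) ^ 2 / 2) ∂μ

/-- `p` solves `(pᵀ)'(t) = - p(t)ᵀ ∫ ∂_z f(Z_ρ(t; x), θ) dρ(θ, t)` on `[0,1]` with
`p(1) = (g(Z_ρ(1; x)) - y(x)) ∇g(Z_ρ(1; x))`; the row vector `pᵀ A` is read as the vector
`Aᵀ p`. -/
def IsCostate {d k : ℕ} (f : Euc d → Euc k → Euc d) (g y : Euc d → ℝ)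
    (ρ : ℝ → Measure (Euc k)) (x : Euc d) (p : ℝ → Euc d) : Prop :=
  p 1 = (g (state f ρ x 1) - y x) • gradient g (state f ρ x 1) ∧
  ∀ t ∈ Icc (0 : ℝ) 1,
    HasDerivWithinAt p
      (-∫ θ, ContinuousLinearMap.adjoint (fderiv ℝ (fun z => f z θ) (state f ρ x t)) (p t) ∂(ρ t))
      (Icc (0 : ℝ) 1) t

/-- `p_ρ(t; x)`: the solution of the (linear) costate equation. -/
noncomputable def costate {d k : ℕ} (f : Euc d → Euc k → Euc d) (g y : Euc d → ℝ)
    (ρ : ℝ → Measure (Euc k)) (x : Euc d) : ℝ → Euc d :=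
  Classical.epsilon (IsCostate f g y ρ x)

/-- The first variation
`(δE/δρ)|_ρ (θ, t) = 𝔼_{x ∼ μ} [ p_ρ(t; x)ᵀ f(Z_ρ(t; x), θ) ]`, as a function of `θ`. -/
noncomputable def firstVariation {d k : ℕ} (f : Euc d → Euc k → Euc d) (g y : Euc d → ℝ)
    (μ : Measure (Euc d)) (ρ : ℝ → Measure (Euc k)) (t : ℝ) (θ : Euc k) : ℝ :=
  ∫ x, inner ℝ (costate f g y ρ x t) (f (state f ρ x t) θ) ∂μ

/-! ### Wasserstein gradient flow -/

/-- `ρ s t` is a solution in `𝒞([0,∞); 𝒞([0,1]; 𝒫²))` of the Wasserstein gradient flow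
`∂_s ρ = ∇_θ · (ρ ∇_θ (δE/δρ)|_{ρ(s)})` with initial datum `ρini`; the equation holds in the
distributional sense in `θ`, for every `t ∈ [0,1]`. -/
structure IsWassersteinFlow {d k : ℕ} (f : Euc d → Euc k → Euc d) (g y : Euc d → ℝ)
    (μ : Measure (Euc d)) (ρini : ℝ → Measure (Euc k)) (ρ : ℝ → ℝ → Measure (Euc k)) : Prop where
  isPath : ∀ s ≥ 0, IsPath (ρ s)
  continuous : ∀ s₀ ≥ 0, Tendsto (fun s => d1 (ρ s) (ρ s₀)) (𝓝[Ici (0 : ℝ)] s₀) (𝓝 0)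
  initial : ∀ t ∈ Icc (0 : ℝ) 1, ρ 0 t = ρini t
  equation : ∀ t ∈ Icc (0 : ℝ) 1, ∀ s > 0, ∀ φ : Euc k → ℝ,
    ContDiff ℝ (⊤ : ℕ∞) φ → HasCompactSupport φ →
    HasDerivAt (fun s' => ∫ θ, φ θ ∂(ρ s' t))
      (-∫ θ, inner ℝ (gradient φ θ) (gradient (firstVariation f g y μ (ρ s) t) θ) ∂(ρ s t)) s

/-! ### Admissible initial data -/

/-- The continuous stochastic process `X` on `(Ω, P)` is a particle representation of the path
`ν`. -/
structure IsParticleRepresentation {k : ℕ} (ν : ℝ → Measure (Euc k)) {Ω : Type}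
    [MeasurableSpace Ω] (P : Measure Ω) (X : ℝ → Ω → Euc k) : Prop where
  probability : IsProbabilityMeasure P
  measurable : ∀ t ∈ Icc (0 : ℝ) 1, Measurable (X t)
  continuous_paths : ∀ ω, ContinuousOn (fun t => X t ω) (Icc (0 : ℝ) 1)
  law : ∀ t ∈ Icc (0 : ℝ) 1, P.map (X t) = ν t
  mean_square : ∀ t₀ ∈ Icc (0 : ℝ) 1,
    Tendsto (fun t => ∫⁻ ω, ‖X t ω - X t₀ ω‖ₑ ^ 2 ∂P) (𝓝[Icc (0 : ℝ) 1] t₀) (𝓝 0)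
  bounded : ∃ r > 0, ∀ t ∈ Icc (0 : ℝ) 1, ∀ ω, ‖X t ω‖ < r

/-- `ν ∈ 𝒞([0,1]; 𝒫²)` is limit-admissible: it has a particle representation such that the average
over `M` i.i.d. copies of it (realized on the product space) is, with high probability, bounded and
Lipschitz in time. -/
def LimitAdmissible {k : ℕ} (ν : ℝ → Measure (Euc k)) : Prop :=
  IsPath ν ∧
  ∃ (Ω : Type) (_ : MeasurableSpace Ω) (P : Measure Ω) (X : ℝ → Ω → Euc k),
    IsParticleRepresentation ν P X ∧
    ∃ C₃ C₄ : ℝ,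
      (⨆ t ∈ Icc (0 : ℝ) 1, ∫⁻ θ, ‖θ‖ₑ ^ 2 ∂(ν t)) < ENNReal.ofReal C₃ ∧
      (⨆ t ∈ Icc (0 : ℝ) 1, ∫⁻ θ, ‖θ‖ₑ ^ 2 ∂(ν t)) < ENNReal.ofReal C₄ ∧
      ∀ η > 0, ∀ M : ℕ, C₃ / η < M →
        ENNReal.ofReal (1 - η) ≤ Measure.pi (fun _ : Fin M => P)
          {ω | ∀ t ∈ Icc (0 : ℝ) 1, (1 / M : ℝ) * ∑ m, ‖X t (ω m)‖ ^ 2 ≤ C₄} ∧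
        ∀ L : ℕ, 0 < L →
          ENNReal.ofReal (1 - η) ≤ Measure.pi (fun _ : Fin M => P)
            {ω | (1 / M : ℝ) * ∑ l ∈ Finset.range L, ∑ m,
                (∫ t in (l / L : ℝ)..((l + 1) / L : ℝ),
                  ‖X t (ω m) - X (l / L : ℝ) (ω m)‖ ^ 2) ≤ C₄ / (L : ℝ) ^ 2}

/-! ### Separation and Sard-type regularity -/

/-- The set `C` separates the sets `A` and `B`: every continuous path from `A` to `B` meets `C`. -/
def Separates {k : ℕ} (C A B : Set (Euc k)) : Prop :=
  ∀ γ : ℝ → Euc k, ContinuousOn γ (Icc (0 : ℝ) 1) → γ 0 ∈ A → γ 1 ∈ B →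
    ∃ t ∈ Icc (0 : ℝ) 1, γ t ∈ C

/-- `α` is a regular value of the restriction of `h` to the unit sphere: the level set of `α` in the
sphere lies in an open set in which `h` is differentiable and the differential of the restriction
(the derivative along tangent vectors of the sphere) does not vanish. -/
def IsSphereRegularValue {k : ℕ} (h : Euc k → ℝ) (α : ℝ) : Prop :=
  ∃ U : Set (Euc k), IsOpen U ∧ {θ ∈ Metric.sphere (0 : Euc k) 1 | h θ = α} ⊆ U ∧
    ∀ θ ∈ U ∩ Metric.sphere (0 : Euc k) 1,
      DifferentiableAt ℝ h θ ∧ ∃ v : Euc k, inner ℝ v θ = 0 ∧ fderiv ℝ h θ v ≠ 0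

/-- Sard-type regularity of `h` on the unit sphere: every value of `h` on the sphere is a limit of
regular values. As usual, a number that is not attained on the sphere counts as a regular value;
this only matters when `h` is constant on the sphere (or `k = 1`). -/
def SardRegularOnSphere {k : ℕ} (h : Euc k → ℝ) : Prop :=
  h '' Metric.sphere (0 : Euc k) 1 ⊆ closure {α | IsSphereRegularValue h α}

end ResNet

open ResNet

/-! Suppose the limit has positive loss, and let `h` be its first variation at time `t₀`. The
contradiction comes from two opposite facts about the sign of `h`.

First, `h` takes a negative value (`exists_firstVariation_neg`). The costate solves a linear
equation, so if it vanishes at one time it vanishes at the terminal time, and the residual is zero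
because the gradient of `g` has no zeros. With positive loss the costate is therefore nonzero on a
set of positive measure. The state map at time `t₀` is injective, so minus the costate is a
continuous function of the state on the image of a large ball. By the universal kernel property some
`ν` nearly realizes this function as `z ↦ ∫ f(z, θ) dν(θ)`, and then `∫ h dν < 0`.

Second, `h ≥ 0` (`LinearFlow.nonneg_of_tendsto`). Once `t = t₀` is frozen and the solution is
regarded as given, the gradient flow is a linear transport equation with velocity `-V s`, where `V
s` is the parameter gradient of the first variation. By 2-homogeneity, `V s` is 1-homogeneous and
globally Lipschitz, and by stability of state and costate it converges to `∇h` with error `ε ‖θ‖`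
(`exists_driftGradient_bounds`). If `h` were negative somewhere, Sard-type regularity would give a
regular value `-η < 0` of `h` on the sphere that lies above another value. Put `u = -η ‖θ‖² - h`.
Regularity of `-η` makes `u` increase along `-∇h` at rate at least `κ ‖θ‖²` on the cone `{u > 0}`
(`exists_drift_lower_bound`), and for large `s` half of this rate survives for `-V s`.

The cone carries mass at every time. Each ray is reached by a trajectory, multiples of trajectories
are trajectories by homogeneity, and the separation hypothesis puts the starting point of some
positive multiple in the initial support (`exists_pos_smul_measure_ball_pos`). Mass in a growing
cone makes the integral of a bounded increasing function of `u` grow at a rate bounded below, which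
is impossible for probability measures with bounded second moments (`false_of_cone`).

Transport is used only through integrals of test functions; neither a flow map for measures nor a
uniqueness theorem for the transport equation is needed. -/

namespace ResNet

/-! ### Second moments, couplings and integrals of functions of quadratic growth. -/

/-- `ν` is a probability measure with second moment at most `M`. -/
structure MomentLE {k : ℕ} (ν : Measure (Euc k)) (M : ℝ) : Prop where
  prob : IsProbabilityMeasure ν
  integrable : Integrable (fun θ => ‖θ‖ ^ 2) ν
  le : ∫ θ, ‖θ‖ ^ 2 ∂ν ≤ M

/-- There is a coupling of `ν₁` and `ν₂` with quadratic cost at most `D ^ 2`. -/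
def Near {k : ℕ} (ν₁ ν₂ : Measure (Euc k)) (D : ℝ) : Prop :=
  ∃ π : Measure (Euc k × Euc k), IsCoupling ν₁ ν₂ π ∧
    Integrable (fun q : Euc k × Euc k => ‖q.1 - q.2‖ ^ 2) π ∧ ∫ q, ‖q.1 - q.2‖ ^ 2 ∂π ≤ D ^ 2

variable {k : ℕ}

lemma enorm_sq_eq_ofReal {E : Type*} [SeminormedAddGroup E] (v : E) :
    ‖v‖ₑ ^ 2 = ENNReal.ofReal (‖v‖ ^ 2) := by
  rw [ENNReal.ofReal_pow (norm_nonneg _), ofReal_norm]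

lemma MomentLE.nonneg {ν : Measure (Euc k)} {M : ℝ} (h : MomentLE ν M) : 0 ≤ M :=
  (integral_nonneg fun _ => by positivity).trans h.le

lemma MomentLE.mono {ν : Measure (Euc k)} {M M' : ℝ} (h : MomentLE ν M) (hM : M ≤ M') :
    MomentLE ν M' := ⟨h.prob, h.integrable, h.le.trans hM⟩

lemma MemP2.momentLE {ν : Measure (Euc k)} (h : MemP2 ν) : MomentLE ν (∫ θ, ‖θ‖ ^ 2 ∂ν) := by
  refine ⟨h.1, ⟨by fun_prop, ?_⟩, le_rfl⟩
  rw [hasFiniteIntegral_iff_norm]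
  convert h.2 using 2
  ext θ
  rw [enorm_sq_eq_ofReal, Real.norm_of_nonneg (by positivity)]

/-- Strictness means that an actual coupling beats the infimum, so existence of optimal couplings is
never needed. -/
lemma near_of_W2_lt {ν₁ ν₂ : Measure (Euc k)} {D : ℝ} (h : W2 ν₁ ν₂ < ENNReal.ofReal D) :
    Near ν₁ ν₂ D := by
  have hD : 0 < D := by
    by_contra hD
    rw [ENNReal.ofReal_of_nonpos (not_lt.1 hD)] at h
    exact not_lt_bot h
  have h2 : (⨅ (π : Measure (Euc k × Euc k)) (_ : IsCoupling ν₁ ν₂ π),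
      ∫⁻ q, ‖q.1 - q.2‖ₑ ^ 2 ∂π) < ENNReal.ofReal (D ^ 2) := by
    have := ENNReal.rpow_lt_rpow h (z := 2) (by norm_num)
    rw [W2, ← ENNReal.rpow_mul, ENNReal.ofReal_rpow_of_pos hD] at this
    norm_num at this
    simpa using this
  simp only [iInf_lt_iff] at h2
  obtain ⟨π, hπ, hlt⟩ := h2
  have hI : Integrable (fun q : Euc k × Euc k => ‖q.1 - q.2‖ ^ 2) π := by
    refine ⟨by fun_prop, ?_⟩
    rw [hasFiniteIntegral_iff_norm]
    refine lt_of_le_of_lt (le_of_eq ?_) (hlt.trans ENNReal.ofReal_lt_top)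
    congr 1
    ext q
    rw [enorm_sq_eq_ofReal, Real.norm_of_nonneg (by positivity)]
  refine ⟨π, hπ, hI, ?_⟩
  rw [integral_eq_lintegral_of_nonneg_ae (Eventually.of_forall fun _ => by positivity) hI.1]
  refine ENNReal.toReal_le_of_le_ofReal (by positivity) ?_
  simpa only [enorm_sq_eq_ofReal] using hlt.le

/-- The diagonal coupling has zero cost. With arbitrary `D`, the stability estimates can be applied
to a single path. -/
lemma near_self {ν : Measure (Euc k)} {D : ℝ} : Near ν ν D := by
  refine ⟨ν.map (fun θ => (θ, θ)), ⟨?_, ?_⟩, ?_, ?_⟩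
  · rw [Measure.map_map measurable_fst (by fun_prop)]; exact Measure.map_id
  · rw [Measure.map_map measurable_snd (by fun_prop)]; exact Measure.map_id
  · rw [integrable_map_measure (by fun_prop) (by fun_prop)]
    simp [Function.comp_def]
  · rw [integral_map (by fun_prop) (by fun_prop)]
    simp; positivity

section Coupling

variable {ν₁ ν₂ : Measure (Euc k)} {π : Measure (Euc k × Euc k)}

lemma IsCoupling.integrable_fst {F : Type*} [NormedAddCommGroup F] (hπ : IsCoupling ν₁ ν₂ π)
    {G : Euc k → F} (hG : Integrable G ν₁) : Integrable (fun q => G q.1) π := by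
  rw [← hπ.1] at hG
  exact hG.comp_measurable measurable_fst

lemma IsCoupling.integrable_snd {F : Type*} [NormedAddCommGroup F] (hπ : IsCoupling ν₁ ν₂ π)
    {G : Euc k → F} (hG : Integrable G ν₂) : Integrable (fun q => G q.2) π := by
  rw [← hπ.2] at hG
  exact hG.comp_measurable measurable_snd

lemma IsCoupling.integral_fst {F : Type*} [NormedAddCommGroup F] [NormedSpace ℝ F]
    (hπ : IsCoupling ν₁ ν₂ π) {G : Euc k → F} (hG : Integrable G ν₁) :
    ∫ q, G q.1 ∂π = ∫ θ, G θ ∂ν₁ := by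
  rw [← hπ.1] at hG ⊢
  rw [integral_map measurable_fst.aemeasurable hG.1]

lemma IsCoupling.integral_snd {F : Type*} [NormedAddCommGroup F] [NormedSpace ℝ F]
    (hπ : IsCoupling ν₁ ν₂ π) {G : Euc k → F} (hG : Integrable G ν₂) :
    ∫ q, G q.2 ∂π = ∫ θ, G θ ∂ν₂ := by
  rw [← hπ.2] at hG ⊢
  rw [integral_map measurable_snd.aemeasurable hG.1]

lemma IsCoupling.isProbabilityMeasure [IsProbabilityMeasure ν₁] (hπ : IsCoupling ν₁ ν₂ π) :
    IsProbabilityMeasure π := by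
  constructor
  have : ν₁ univ = 1 := measure_univ
  rw [← hπ.1, Measure.map_apply measurable_fst MeasurableSet.univ] at this
  simpa using this

end Coupling

lemma MomentLE.of_near {ν₁ ν₂ : Measure (Euc k)} {M D : ℝ} (h₁ : MemP2 ν₁) (h₂ : MomentLE ν₂ M)
    (h : Near ν₁ ν₂ D) : MomentLE ν₁ (2 * M + 2 * D ^ 2) := by
  obtain ⟨π, hπ, hI, hD⟩ := h
  refine ⟨h₁.1, h₁.momentLE.integrable, ?_⟩
  have i1 := hπ.integrable_fst h₁.momentLE.integrable
  have i2 := hπ.integrable_snd h₂.integrable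
  have e1 := hπ.integral_fst h₁.momentLE.integrable
  have e2 := hπ.integral_snd h₂.integrable
  rw [← e1]
  calc ∫ q, ‖q.1‖ ^ 2 ∂π ≤ ∫ q, (2 * ‖q.2‖ ^ 2 + 2 * ‖q.1 - q.2‖ ^ 2) ∂π := by
        refine integral_mono i1 ((i2.const_mul 2).add (hI.const_mul 2)) fun q => ?_
        have : ‖q.1‖ ≤ ‖q.2‖ + ‖q.1 - q.2‖ := norm_le_norm_add_norm_sub' _ _
        simp only
        nlinarith [norm_nonneg q.1, sq_nonneg (‖q.2‖ - ‖q.1 - q.2‖)]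
    _ = 2 * ∫ q, ‖q.2‖ ^ 2 ∂π + 2 * ∫ q, ‖q.1 - q.2‖ ^ 2 ∂π := by
        rw [integral_add (i2.const_mul 2) (hI.const_mul 2), integral_const_mul, integral_const_mul]
    _ ≤ 2 * M + 2 * D ^ 2 := by
        rw [e2]; linarith [h₂.le]

lemma MomentLE.integrable_of_le {F : Type*} [NormedAddCommGroup F] {ν : Measure (Euc k)} {M : ℝ}
    (h : MomentLE ν M) {G : Euc k → F} (hG : Continuous G) {A B : ℝ}
    (hle : ∀ θ, ‖G θ‖ ≤ A * ‖θ‖ ^ 2 + B) : Integrable G ν := by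
  have := h.prob
  exact Integrable.mono' ((h.integrable.const_mul A).add (integrable_const B))
    hG.aestronglyMeasurable (Eventually.of_forall hle)

lemma MomentLE.norm_integral_le {F : Type*} [NormedAddCommGroup F] [NormedSpace ℝ F]
    {ν : Measure (Euc k)} {M : ℝ} (h : MomentLE ν M) {G : Euc k → F} {A B : ℝ} (hA : 0 ≤ A)
    (hle : ∀ θ, ‖G θ‖ ≤ A * ‖θ‖ ^ 2 + B) : ‖∫ θ, G θ ∂ν‖ ≤ A * M + B := by
  have := h.prob
  have i := (h.integrable.const_mul A)
  refine (norm_integral_le_of_norm_le (i.add (integrable_const B))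
    (Eventually.of_forall hle)).trans ?_
  simp only [Pi.add_apply]
  rw [integral_add i (integrable_const B), integral_const_mul]
  simp only [integral_const, probReal_univ, smul_eq_mul, one_mul]
  gcongr
  exact h.le

/-- Functions whose local Lipschitz constant grows at most linearly. -/
def QuadLip {F : Type*} [NormedAddCommGroup F] (K : ℝ) (G : Euc k → F) : Prop :=
  ∀ θ θ', ‖G θ - G θ'‖ ≤ K * ((‖θ‖ + ‖θ'‖ + 1) * ‖θ - θ'‖)

lemma QuadLip.norm_le {F : Type*} [NormedAddCommGroup F] {K : ℝ} {G : Euc k → F} (hK : 0 ≤ K)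
    (hG : QuadLip K G) (θ : Euc k) : ‖G θ‖ ≤ (2 * K) * ‖θ‖ ^ 2 + (K + ‖G 0‖) := by
  have h := hG θ 0
  have h2 : ‖G θ‖ ≤ ‖G 0‖ + ‖G θ - G 0‖ := norm_le_norm_add_norm_sub' _ _
  simp only [norm_zero, sub_zero, add_zero] at h
  nlinarith [norm_nonneg θ, sq_nonneg (‖θ‖ - 1), mul_nonneg hK (sq_nonneg (‖θ‖ - 1))]

lemma QuadLip.continuous {F : Type*} [NormedAddCommGroup F] {K : ℝ} {G : Euc k → F}
    (hG : QuadLip K G) : Continuous G := by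
  rw [continuous_iff_continuousAt]
  intro θ
  rw [ContinuousAt, tendsto_iff_norm_sub_tendsto_zero]
  refine squeeze_zero (fun _ => norm_nonneg _) (fun θ' => hG θ' θ) ?_
  have : Continuous fun θ' : Euc k => K * ((‖θ'‖ + ‖θ‖ + 1) * ‖θ' - θ‖) := by fun_prop
  simpa using this.tendsto θ

lemma MomentLE.integrable_quadLip {F : Type*} [NormedAddCommGroup F] {ν : Measure (Euc k)}
    {M K : ℝ} (h : MomentLE ν M) {G : Euc k → F} (hK : 0 ≤ K) (hG : QuadLip K G) :
    Integrable G ν :=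
  h.integrable_of_le hG.continuous (hG.norm_le hK)

/-- Kantorovich-type estimate for functions with quadratic growth. -/
lemma norm_integral_sub_integral_le {F : Type*} [NormedAddCommGroup F] [NormedSpace ℝ F]
    {ν₁ ν₂ : Measure (Euc k)} {M D K : ℝ} (h₁ : MomentLE ν₁ M) (h₂ : MomentLE ν₂ M) (hD : 0 < D)
    (h : Near ν₁ ν₂ D) {G : Euc k → F} (hK : 0 ≤ K) (hG : QuadLip K G) :
    ‖∫ θ, G θ ∂ν₁ - ∫ θ, G θ ∂ν₂‖ ≤ K * (3 * M + 2) * D := by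
  obtain ⟨π, hπ, hI, hD'⟩ := h
  have := h₁.prob
  have := hπ.isProbabilityMeasure
  have i1 := hπ.integrable_fst h₁.integrable
  have i2 := hπ.integrable_snd h₂.integrable
  have e1 := hπ.integral_fst h₁.integrable
  have e2 := hπ.integral_snd h₂.integrable
  have g1 := h₁.integrable_quadLip hK hG
  have g2 := h₂.integrable_quadLip hK hG
  rw [← hπ.integral_fst g1, ← hπ.integral_snd g2,
    ← integral_sub (hπ.integrable_fst g1) (hπ.integrable_snd g2)]
  have iA : Integrable (fun q : Euc k × Euc k => (3 * K * D / 2) * ‖q.1‖ ^ 2) π := i1.const_mul _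
  have iB : Integrable (fun q : Euc k × Euc k => (3 * K * D / 2) * ‖q.2‖ ^ 2) π := i2.const_mul _
  have iC : Integrable (fun q : Euc k × Euc k => (K / (2 * D)) * ‖q.1 - q.2‖ ^ 2) π :=
    hI.const_mul _
  have iE : Integrable (fun _ : Euc k × Euc k => 3 * K * D / 2) π := integrable_const _
  refine (norm_integral_le_of_norm_le (((iA.add iB).add iC).add iE)
    (Eventually.of_forall fun q => ?_)).trans ?_
  · refine (hG q.1 q.2).trans ?_
    simp only [Pi.add_apply]
    have key : (‖q.1‖ + ‖q.2‖ + 1) * ‖q.1 - q.2‖ ≤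
        (3 * D / 2) * ‖q.1‖ ^ 2 + (3 * D / 2) * ‖q.2‖ ^ 2 + 1 / (2 * D) * ‖q.1 - q.2‖ ^ 2
          + 3 * D / 2 := by
      set a := ‖q.1‖; set b := ‖q.2‖; set c := ‖q.1 - q.2‖
      -- Young's inequality with weight `D`: after integration both squares contribute at order `D`.
      have h1 : (a + b + 1) * c ≤ D / 2 * (a + b + 1) ^ 2 + 1 / (2 * D) * c ^ 2 := by
        have : 0 ≤ (D * (a + b + 1) - c) ^ 2 / (2 * D) := by positivity
        have e : (D * (a + b + 1) - c) ^ 2 / (2 * D) =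
          D / 2 * (a + b + 1) ^ 2 + 1 / (2 * D) * c ^ 2 - (a + b + 1) * c := by
          field_simp; ring
        linarith
      have h2 : (a + b + 1) ^ 2 ≤ 3 * a ^ 2 + 3 * b ^ 2 + 3 := by
        nlinarith [sq_nonneg (a - b), sq_nonneg (a - 1), sq_nonneg (b - 1)]
      nlinarith
    calc K * ((‖q.1‖ + ‖q.2‖ + 1) * ‖q.1 - q.2‖) ≤ K * _ := mul_le_mul_of_nonneg_left key hK
      _ = _ := by ring
  · rw [integral_add' ((iA.add iB).add iC) iE, integral_add' (iA.add iB) iC, integral_add' iA iB,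
      integral_const_mul, integral_const_mul, integral_const_mul, e1, e2]
    simp only [integral_const, probReal_univ, smul_eq_mul, one_mul]
    have hKD : 0 ≤ 3 * K * D / 2 := by positivity
    have a1 := mul_le_mul_of_nonneg_left h₁.le hKD
    have a2 := mul_le_mul_of_nonneg_left h₂.le hKD
    have a3 := mul_le_mul_of_nonneg_left hD' (show 0 ≤ K / (2 * D) by positivity)
    have e3 : K / (2 * D) * D ^ 2 = K * D / 2 := by field_simp
    rw [e3] at a3
    linarith

lemma near_of_d1_lt {ν₁ ν₂ : ℝ → Measure (Euc k)} {D : ℝ} (h : d1 ν₁ ν₂ < ENNReal.ofReal D)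
    {t : ℝ} (ht : t ∈ Icc (0 : ℝ) 1) : Near (ν₁ t) (ν₂ t) D :=
  near_of_W2_lt (lt_of_le_of_lt (le_iSup₂ (f := fun t _ => W2 (ν₁ t) (ν₂ t)) t ht) h)

/-- Compactness of `[0,1]`: near each time the moment is controlled by the one at that time, because
nearby measures are at distance less than 1. -/
lemma IsPath.exists_momentLE {ν : ℝ → Measure (Euc k)} (h : IsPath ν) :
    ∃ M, ∀ t ∈ Icc (0 : ℝ) 1, MomentLE (ν t) M := by
  have key : ∃ M, ∀ t ∈ Icc (0 : ℝ) 1, t ∈ Icc (0 : ℝ) 1 → MomentLE (ν t) M := by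
    refine isCompact_Icc.induction_on (p := fun S => ∃ M, ∀ t ∈ S, t ∈ Icc (0 : ℝ) 1 →
      MomentLE (ν t) M) ⟨0, by simp⟩ ?_ ?_ ?_
    · rintro s t hst ⟨M, hM⟩
      exact ⟨M, fun x hx => hM x (hst hx)⟩
    · rintro s t ⟨M, hM⟩ ⟨M', hM'⟩
      refine ⟨max M M', ?_⟩
      rintro x (hx | hx) hx'
      · exact (hM x hx hx').mono (le_max_left _ _)
      · exact (hM' x hx hx').mono (le_max_right _ _)
    · intro t₀ ht₀
      have h1 : ∀ᶠ t in 𝓝[Icc (0 : ℝ) 1] t₀, W2 (ν t) (ν t₀) < ENNReal.ofReal 1 :=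
        (h.continuous t₀ ht₀).eventually (gt_mem_nhds (by simp))
      refine ⟨_, h1, 2 * (∫ θ, ‖θ‖ ^ 2 ∂(ν t₀)) + 2 * 1 ^ 2, fun t ht ht' => ?_⟩
      exact MomentLE.of_near (h.memP2 t ht') (h.memP2 t₀ ht₀).momentLE (near_of_W2_lt ht)
  obtain ⟨M, hM⟩ := key
  exact ⟨M, fun t ht => hM t ht ht⟩

lemma tendsto_integral_of_near {ι : Type*} {l : Filter ι} {F : Type*} [NormedAddCommGroup F]
    [NormedSpace ℝ F] {ν : ι → Measure (Euc k)} {ν₀ : Measure (Euc k)} {M K : ℝ}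
    (hν : ∀ᶠ i in l, MomentLE (ν i) M) (hν₀ : MomentLE ν₀ M)
    (hn : ∀ D > 0, ∀ᶠ i in l, Near (ν i) ν₀ D) {G : Euc k → F} (hK : 0 ≤ K) (hG : QuadLip K G) :
    Tendsto (fun i => ∫ θ, G θ ∂(ν i)) l (𝓝 (∫ θ, G θ ∂ν₀)) := by
  rw [Metric.tendsto_nhds]
  intro ε hε
  have hM := hν₀.nonneg
  set D := ε / (2 * (K * (3 * M + 2) + 1)) with hDdef
  have hD : 0 < D := by positivity
  filter_upwards [hν, hn D hD] with i h1 h2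
  rw [dist_eq_norm]
  refine (norm_integral_sub_integral_le h1 hν₀ hD h2 hK hG).trans_lt ?_
  have : (K * (3 * M + 2) + 1) * D = ε / 2 := by rw [hDdef]; field_simp
  nlinarith

lemma IsPath.continuousOn_integral {F : Type*} [NormedAddCommGroup F] [NormedSpace ℝ F]
    {ν : ℝ → Measure (Euc k)} (h : IsPath ν) {K : ℝ} {G : Euc k → F} (hK : 0 ≤ K)
    (hG : QuadLip K G) : ContinuousOn (fun t => ∫ θ, G θ ∂(ν t)) (Icc 0 1) := by
  intro t₀ ht₀
  obtain ⟨M, hM⟩ := h.exists_momentLE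
  refine tendsto_integral_of_near (eventually_nhdsWithin_of_forall hM) (hM t₀ ht₀)
    (fun D hD => ?_) hK hG
  filter_upwards [(h.continuous t₀ ht₀).eventually
    (gt_mem_nhds (ENNReal.ofReal_pos.2 hD))] with t ht using near_of_W2_lt ht

lemma exists_momentLE_of_near {ν₁ ν₂ : ℝ → Measure (Euc k)} (h₁ : IsPath ν₁) {M D : ℝ}
    (h₂ : ∀ t ∈ Icc (0 : ℝ) 1, MomentLE (ν₂ t) M) (h : d1 ν₁ ν₂ < ENNReal.ofReal D) :
    ∀ t ∈ Icc (0 : ℝ) 1, MomentLE (ν₁ t) (2 * M + 2 * D ^ 2) := fun t ht =>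
  MomentLE.of_near (h₁.memP2 t ht) (h₂ t ht) (near_of_d1_lt h ht)

/-- A curve of paths that is continuous on `[0, ∞)` and converges at infinity has uniformly
bounded second moments. -/
lemma exists_uniform_momentLE {ρ : ℝ → ℝ → Measure (Euc k)} (hρ : ∀ s ≥ 0, IsPath (ρ s))
    (hcont : ∀ s₀ ≥ 0, Tendsto (fun s => d1 (ρ s) (ρ s₀)) (𝓝[Ici (0 : ℝ)] s₀) (𝓝 0))
    {ρinf : ℝ → Measure (Euc k)} (hinf : IsPath ρinf)
    (hlim : Tendsto (fun s => d1 (ρ s) ρinf) atTop (𝓝 0)) :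
    ∃ M, (∀ s ≥ 0, ∀ t ∈ Icc (0 : ℝ) 1, MomentLE (ρ s t) M) ∧
      ∀ t ∈ Icc (0 : ℝ) 1, MomentLE (ρinf t) M := by
  have h01 : (0 : ℝ≥0∞) < ENNReal.ofReal 1 := by simp
  obtain ⟨M₀, hM₀⟩ := hinf.exists_momentLE
  -- Beyond `S` all paths lie within distance 1 of the limit; `[0, S]` is handled by compactness.
  obtain ⟨S, hS⟩ := eventually_atTop.1 (hlim.eventually (gt_mem_nhds h01))
  have key : ∃ M, ∀ s ∈ Icc 0 S, 0 ≤ s → ∀ t ∈ Icc (0 : ℝ) 1, MomentLE (ρ s t) M := by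
    refine isCompact_Icc.induction_on (p := fun A => ∃ M, ∀ s ∈ A, 0 ≤ s →
      ∀ t ∈ Icc (0 : ℝ) 1, MomentLE (ρ s t) M) ⟨0, by simp⟩ ?_ ?_ ?_
    · rintro s t hst ⟨M, hM⟩
      exact ⟨M, fun x hx => hM x (hst hx)⟩
    · rintro s t ⟨M, hM⟩ ⟨M', hM'⟩
      refine ⟨max M M', ?_⟩
      rintro x (hx | hx) hx' t ht
      · exact (hM x hx hx' t ht).mono (le_max_left _ _)
      · exact (hM' x hx hx' t ht).mono (le_max_right _ _)
    · intro s₀ hs₀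
      obtain ⟨M, hM⟩ := (hρ s₀ hs₀.1).exists_momentLE
      have h1 : ∀ᶠ s in 𝓝[Icc (0 : ℝ) S] s₀, d1 (ρ s) (ρ s₀) < ENNReal.ofReal 1 :=
        ((hcont s₀ hs₀.1).eventually (gt_mem_nhds h01)).filter_mono
          (nhdsWithin_mono _ Icc_subset_Ici_self)
      exact ⟨_, h1, _, fun s hs hs' => exists_momentLE_of_near (hρ s hs') hM hs⟩
  obtain ⟨M₁, hM₁⟩ := key
  have hM₀' : 0 ≤ M₀ := (hM₀ 0 (by simp)).nonneg
  refine ⟨max M₁ (2 * M₀ + 2 * 1 ^ 2), fun s hs t ht => ?_, fun t ht => ?_⟩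
  · rcases le_total s S with h | h
    · exact (hM₁ s ⟨hs, h⟩ hs t ht).mono (le_max_left _ _)
    · exact (exists_momentLE_of_near (hρ s hs) hM₀ (hS s h) t ht).mono (le_max_right _ _)
  · exact (hM₀ t ht).mono (le_trans (by linarith) (le_max_right _ _))

end ResNet

/-! ### Grönwall estimates and global solvability of ordinary differential equations. -/

namespace ResNet

section ODE

variable {E : Type*} [NormedAddCommGroup E] [NormedSpace ℝ E]

/-- Assuming `K ≥ 1` allows `ε / K` to be replaced by `ε`, which gives a form without division. -/
lemma gronwallBound_le {δ K ε x : ℝ} (hK : 1 ≤ K) (hε : 0 ≤ ε) (hx : 0 ≤ x) :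
    gronwallBound δ K ε x ≤ (δ + ε) * Real.exp (K * x) := by
  rw [gronwallBound_of_K_ne_0 (by positivity)]
  have h1 : ε / K ≤ ε := div_le_self hε hK
  have h2 : 1 ≤ Real.exp (K * x) := Real.one_le_exp (by positivity)
  nlinarith [mul_nonneg (sub_nonneg.2 h1) (sub_nonneg.2 h2)]

/-- Grönwall estimate forward in time. -/
lemma norm_le_of_norm_deriv_le_forward {w w' : ℝ → E} {a b K ε : ℝ} (hK : 1 ≤ K) (hε : 0 ≤ ε)
    (hw : ∀ t ∈ Icc a b, HasDerivWithinAt w (w' t) (Icc a b) t)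
    (bound : ∀ t ∈ Icc a b, ‖w' t‖ ≤ K * ‖w t‖ + ε) {t₀ t : ℝ} (ht₀ : t₀ ∈ Icc a b)
    (ht : t ∈ Icc a b) (h : t₀ ≤ t) : ‖w t‖ ≤ (‖w t₀‖ + ε) * Real.exp (K * (b - a)) := by
  have hsub : Icc t₀ t ⊆ Icc a b := Icc_subset_Icc ht₀.1 ht.2
  have h1 := norm_le_gronwallBound_of_norm_deriv_right_le (f := w) (f' := w') (δ := ‖w t₀‖)
    (K := K) (ε := ε) (a := t₀) (b := t)
    (fun x hx => (hw x (hsub hx)).continuousWithinAt.mono hsub)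
    (fun x hx => (hw x (hsub (Ico_subset_Icc_self hx))).mono_of_mem_nhdsWithin
      (Icc_mem_nhdsGE_of_mem ⟨ht₀.1.trans hx.1, hx.2.trans_le ht.2⟩))
    le_rfl (fun x hx => bound x (hsub (Ico_subset_Icc_self hx))) t ⟨h, le_rfl⟩
  refine h1.trans ((gronwallBound_le hK hε (sub_nonneg.2 h)).trans ?_)
  gcongr
  · exact ht.2
  · exact ht₀.1

/-- Grönwall estimate in both time directions. -/
lemma norm_le_of_norm_deriv_le {w w' : ℝ → E} {a b K ε : ℝ} (hK : 1 ≤ K) (hε : 0 ≤ ε)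
    (hw : ∀ t ∈ Icc a b, HasDerivWithinAt w (w' t) (Icc a b) t)
    (bound : ∀ t ∈ Icc a b, ‖w' t‖ ≤ K * ‖w t‖ + ε) {t₀ t : ℝ} (ht₀ : t₀ ∈ Icc a b)
    (ht : t ∈ Icc a b) : ‖w t‖ ≤ (‖w t₀‖ + ε) * Real.exp (K * (b - a)) := by
  rcases le_total t₀ t with h | h
  · exact norm_le_of_norm_deriv_le_forward hK hε hw bound ht₀ ht h
  -- Time reversal reduces the backward estimate to the forward one.
  · have hneg : MapsTo (fun x : ℝ => -x) (Icc (-b) (-a)) (Icc a b) := fun x hx =>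
      ⟨by linarith [hx.2], by linarith [hx.1]⟩
    have := norm_le_of_norm_deriv_le_forward (w := fun x => w (-x)) (w' := fun x => -w' (-x))
      (a := -b) (b := -a) hK hε
      (fun x hx => by
        have := (hw (-x) (hneg hx)).scomp x (hasDerivAt_neg x).hasDerivWithinAt hneg
        simpa [Function.comp_def] using this)
      (fun x hx => by simpa using bound (-x) (hneg hx))
      (t₀ := -t₀) (t := -t) ⟨by linarith [ht₀.2], by linarith [ht₀.1]⟩
      ⟨by linarith [ht.2], by linarith [ht.1]⟩ (by linarith)
    simp only [neg_neg] at this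
    convert this using 3
    ring

/-- The radial retraction onto the closed ball of radius `R`. -/
noncomputable def radialRetract (R : ℝ) (x : E) : E := (R / max R ‖x‖) • x

lemma radialRetract_of_norm_le {R : ℝ} (hR : 0 < R) {x : E} (hx : ‖x‖ ≤ R) :
    radialRetract R x = x := by
  rw [radialRetract, max_eq_left hx, div_self hR.ne', one_smul]

lemma norm_radialRetract_le {R : ℝ} (hR : 0 < R) (x : E) : ‖radialRetract R x‖ ≤ R := by
  have h : 0 < max R ‖x‖ := lt_max_of_lt_left hR
  rw [radialRetract, norm_smul, Real.norm_of_nonneg (by positivity), div_mul_eq_mul_div,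
    div_le_iff₀ h]
  exact mul_le_mul_of_nonneg_left (le_max_right _ _) hR.le

lemma norm_radialRetract_le_norm {R : ℝ} (hR : 0 < R) (x : E) : ‖radialRetract R x‖ ≤ ‖x‖ := by
  have h : 0 < max R ‖x‖ := lt_max_of_lt_left hR
  rw [radialRetract, norm_smul, Real.norm_of_nonneg (by positivity)]
  exact mul_le_of_le_one_left (norm_nonneg _) (div_le_one_of_le₀ (le_max_left _ _) h.le)

/-- In a general normed space the retraction is 2-Lipschitz: one contribution comes from the
vectors, the other from the scaling factors. -/
lemma norm_radialRetract_sub_le {R : ℝ} (hR : 0 < R) (x y : E) :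
    ‖radialRetract R x - radialRetract R y‖ ≤ 2 * ‖x - y‖ := by
  set a := max R ‖x‖ with ha
  set b := max R ‖y‖ with hb
  have ha0 : 0 < a := lt_max_of_lt_left hR
  have hb0 : 0 < b := lt_max_of_lt_left hR
  have hab : |b - a| ≤ ‖x - y‖ := by
    rw [ha, hb, abs_sub_comm, max_comm R, max_comm R]
    exact (abs_max_sub_max_le_abs _ _ _).trans (abs_norm_sub_norm_le x y)
  have e : radialRetract R x - radialRetract R y = (R / a) • (x - y) + (R / a - R / b) • y := by
    simp only [radialRetract, ← ha, ← hb]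
    module
  have h1 : ‖(R / a) • (x - y)‖ ≤ ‖x - y‖ := by
    rw [norm_smul, Real.norm_of_nonneg (by positivity)]
    exact mul_le_of_le_one_left (norm_nonneg _) (div_le_one_of_le₀ (le_max_left _ _) ha0.le)
  have h2 : ‖(R / a - R / b) • y‖ ≤ ‖x - y‖ := by
    have e2 : R / a - R / b = (R / a) * ((b - a) / b) := by field_simp
    rw [norm_smul, e2, Real.norm_eq_abs, abs_mul, abs_of_nonneg (show 0 ≤ R / a by positivity),
      abs_div, abs_of_pos hb0]
    have h3 : R / a ≤ 1 := div_le_one_of_le₀ (le_max_left _ _) ha0.le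
    calc R / a * (|b - a| / b) * ‖y‖ ≤ 1 * (|b - a| / b) * b := by
          gcongr
          exact le_max_right _ _
      _ = |b - a| := by field_simp
      _ ≤ _ := hab
  rw [e]
  linarith [norm_add_le ((R / a) • (x - y)) ((R / a - R / b) • y)]

/-- Global existence for an ordinary differential equation whose right-hand side is locally
Lipschitz in space, continuous in time and of linear growth. -/
lemma exists_ode_solution [CompleteSpace E] {F : ℝ → E → E} {a b C : ℝ}
    (hgrowth : ∀ t ∈ Icc a b, ∀ x, ‖F t x‖ ≤ C * (‖x‖ + 1))
    (hlip : ∀ R > 0, ∃ K : ℝ, ∀ t ∈ Icc a b, ∀ x y, ‖x‖ ≤ R → ‖y‖ ≤ R →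
      ‖F t x - F t y‖ ≤ K * ‖x - y‖)
    (hcont : ∀ x, ContinuousOn (fun t => F t x) (Icc a b)) {t₀ : ℝ} (ht₀ : t₀ ∈ Icc a b) (x₀ : E) :
    ∃ z : ℝ → E, z t₀ = x₀ ∧ ∀ t ∈ Icc a b, HasDerivWithinAt z (F t (z t)) (Icc a b) t := by
  set C' := max C 1
  have hC' : 1 ≤ C' := le_max_right _ _
  have hgr : ∀ t ∈ Icc a b, ∀ x, ‖F t x‖ ≤ C' * (‖x‖ + 1) := fun t ht x =>
    (hgrowth t ht x).trans (mul_le_mul_of_nonneg_right (le_max_left _ _) (by positivity))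
  -- This is the a priori Grönwall bound. The field truncated at radius `R` is globally Lipschitz
  -- and has the same linear growth, so its solution never leaves the ball in which truncation
  -- changes nothing.
  set R := (‖x₀‖ + C') * Real.exp (C' * (b - a))
  have hR : 0 < R := by positivity
  obtain ⟨K, hK⟩ := hlip R hR
  have hab : 0 ≤ b - a := sub_nonneg.2 (ht₀.1.trans ht₀.2)
  have hpl : IsPicardLindelof (fun t x => F t (radialRetract R x)) (⟨t₀, ht₀⟩ : Icc a b) x₀
      (C' * (R + 1) * (b - a)).toNNReal 0 (C' * (R + 1)).toNNReal (|K| * 2).toNNReal := by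
    refine ⟨fun t ht => ?_, fun x _ => hcont _, fun t ht x _ => ?_, ?_⟩
    · refine LipschitzOnWith.of_dist_le_mul fun x _ y _ => ?_
      rw [dist_eq_norm, dist_eq_norm, Real.coe_toNNReal _ (by positivity)]
      calc _ ≤ K * ‖radialRetract R x - radialRetract R y‖ :=
            hK t ht _ _ (norm_radialRetract_le hR x) (norm_radialRetract_le hR y)
        _ ≤ |K| * (2 * ‖x - y‖) := by
            gcongr
            · exact le_abs_self K
            · exact norm_radialRetract_sub_le hR x y
        _ = _ := by ring
    · rw [Real.coe_toNNReal _ (by positivity)]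
      refine (hgr t ht _).trans ?_
      gcongr
      exact norm_radialRetract_le hR x
    · rw [Real.coe_toNNReal _ (by positivity), Real.coe_toNNReal _ (by positivity)]
      simp only [NNReal.coe_zero, sub_zero]
      gcongr
      exact max_le (by linarith [ht₀.1]) (by linarith [ht₀.2])
  obtain ⟨z, hz0, hz⟩ := hpl.exists_eq_forall_mem_Icc_hasDerivWithinAt₀
  refine ⟨z, hz0, fun t ht => ?_⟩
  have hle : ‖z t‖ ≤ R := by
    have := norm_le_of_norm_deriv_le hC' (zero_le_one.trans hC') hz (fun t ht => ?_) ht₀ ht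
    · rwa [show z t₀ = x₀ from hz0] at this
    · refine (hgr t ht _).trans ?_
      have := norm_radialRetract_le_norm hR (z t)
      nlinarith
  have := hz t ht
  rwa [radialRetract_of_norm_le hR hle] at this

end ODE

end ResNet

/-! ### Global Lipschitz estimates from homogeneity in the parameter. -/

namespace ResNet

lemma _root_.ContDiff.exists_norm_sub_le {E₁ E₂ F : Type*} [NormedAddCommGroup E₁]
    [NormedSpace ℝ E₁] [NormedAddCommGroup E₂] [NormedSpace ℝ E₂] [FiniteDimensional ℝ E₁]
    [FiniteDimensional ℝ E₂] [NormedAddCommGroup F] [NormedSpace ℝ F] {G : E₁ × E₂ → F}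
    (hG : ContDiff ℝ 1 G) (r₁ r₂ : ℝ) :
    ∃ L ≥ 0, ∀ x x' θ θ', ‖x‖ ≤ r₁ → ‖x'‖ ≤ r₁ → ‖θ‖ ≤ r₂ → ‖θ'‖ ≤ r₂ →
      ‖G (x, θ) - G (x', θ')‖ ≤ L * (‖x - x'‖ + ‖θ - θ'‖) := by
  have hc : IsCompact (Metric.closedBall (0 : E₁) r₁ ×ˢ Metric.closedBall (0 : E₂) r₂) :=
    (isCompact_closedBall _ _).prod (isCompact_closedBall _ _)
  obtain ⟨K, hK⟩ := (hG.locallyLipschitz.locallyLipschitzOn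
    (s := Metric.closedBall (0 : E₁) r₁ ×ˢ
      Metric.closedBall (0 : E₂) r₂)).exists_lipschitzOnWith_of_compact hc
  refine ⟨K, K.2, fun x x' θ θ' h1 h2 h3 h4 => ?_⟩
  have := hK.dist_le_mul (x, θ) (by simp [h1, h3]) (x', θ') (by simp [h2, h4])
  rw [dist_eq_norm, dist_eq_norm] at this
  refine this.trans (mul_le_mul_of_nonneg_left ?_ K.2)
  rw [Prod.norm_def]
  exact max_le_add_of_nonneg (norm_nonneg _) (norm_nonneg _)

variable {d k : ℕ} {F : Type*} [NormedAddCommGroup F]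

/-- The Lipschitz estimate satisfied by functions that are locally Lipschitz and `2`-homogeneous
in the second variable. -/
structure HomTwoLip (r L : ℝ) (G : Euc d → Euc k → F) : Prop where
  nonneg : 0 ≤ L
  zero : ∀ x, G x 0 = 0
  sub_le : ∀ x x' θ θ', ‖x‖ ≤ r → ‖x'‖ ≤ r →
    ‖G x θ - G x' θ'‖ ≤ L * ((‖θ‖ + ‖θ'‖) ^ 2 * ‖x - x'‖ + (‖θ‖ + ‖θ'‖) * ‖θ - θ'‖)

/-- The Lipschitz estimate satisfied by functions that are locally Lipschitz and `1`-homogeneous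
in the second variable. -/
structure HomOneLip (r L : ℝ) (G : Euc d → Euc k → F) : Prop where
  nonneg : 0 ≤ L
  zero : ∀ x, G x 0 = 0
  sub_le : ∀ x x' θ θ', ‖x‖ ≤ r → ‖x'‖ ≤ r →
    ‖G x θ - G x' θ'‖ ≤ L * ((‖θ‖ + ‖θ'‖) * ‖x - x'‖ + ‖θ - θ'‖)

section Homogeneous

variable [NormedSpace ℝ F] {G : Euc d → Euc k → F} {r L : ℝ}

/-- Dividing both parameters by `s = ‖θ‖ + ‖θ'‖` brings them into the unit ball; multiplying back by
`s²` turns the local estimate into a global one with the right weights. The next lemma is the same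
with `s` in place of `s²`. -/
lemma homTwoLip_of_homogeneous (hG : ∀ x θ (c : ℝ), G x (c • θ) = c ^ 2 • G x θ) (hL : 0 ≤ L)
    (h : ∀ x x' θ θ', ‖x‖ ≤ r → ‖x'‖ ≤ r → ‖θ‖ ≤ 1 → ‖θ'‖ ≤ 1 →
      ‖G x θ - G x' θ'‖ ≤ L * (‖x - x'‖ + ‖θ - θ'‖)) : HomTwoLip r L G := by
  have h0 : ∀ x, G x 0 = 0 := fun x => by simpa using hG x 0 0
  refine ⟨hL, h0, fun x x' θ θ' hx hx' => ?_⟩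
  set s := ‖θ‖ + ‖θ'‖ with hs
  rcases (show 0 ≤ s by positivity).eq_or_lt with h1 | h1
  · have e1 : θ = 0 := norm_le_zero_iff.1 (by linarith [norm_nonneg θ'])
    have e2 : θ' = 0 := norm_le_zero_iff.1 (by linarith [norm_nonneg θ])
    rw [e1, e2, h0, h0, sub_self, norm_zero]
    positivity
  · have hn : ∀ v : Euc k, ‖v‖ ≤ s → ‖s⁻¹ • v‖ ≤ 1 := fun v hv => by
      rw [norm_smul, Real.norm_of_nonneg (by positivity), ← div_eq_inv_mul]
      exact div_le_one_of_le₀ hv h1.le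
    have e : ∀ v : Euc k, v = s • (s⁻¹ • v) := fun v => by rw [smul_inv_smul₀ h1.ne']
    have := h x x' (s⁻¹ • θ) (s⁻¹ • θ') hx hx' (hn _ (by linarith [norm_nonneg θ']))
      (hn _ (by linarith [norm_nonneg θ]))
    rw [← smul_sub, norm_smul, Real.norm_of_nonneg (by positivity)] at this
    calc ‖G x θ - G x' θ'‖ = s ^ 2 * ‖G x (s⁻¹ • θ) - G x' (s⁻¹ • θ')‖ := by
          conv_lhs => rw [e θ, e θ', hG x (s⁻¹ • θ), hG x' (s⁻¹ • θ'), ← smul_sub, norm_smul,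
            Real.norm_of_nonneg (by positivity)]
      _ ≤ s ^ 2 * (L * (‖x - x'‖ + s⁻¹ * ‖θ - θ'‖)) := by gcongr
      _ = _ := by field_simp

lemma homOneLip_of_homogeneous (hG : ∀ x θ (c : ℝ), G x (c • θ) = c • G x θ) (hL : 0 ≤ L)
    (h : ∀ x x' θ θ', ‖x‖ ≤ r → ‖x'‖ ≤ r → ‖θ‖ ≤ 1 → ‖θ'‖ ≤ 1 →
      ‖G x θ - G x' θ'‖ ≤ L * (‖x - x'‖ + ‖θ - θ'‖)) : HomOneLip r L G := by
  have h0 : ∀ x, G x 0 = 0 := fun x => by simpa using hG x 0 0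
  refine ⟨hL, h0, fun x x' θ θ' hx hx' => ?_⟩
  set s := ‖θ‖ + ‖θ'‖ with hs
  rcases (show 0 ≤ s by positivity).eq_or_lt with h1 | h1
  · have e1 : θ = 0 := norm_le_zero_iff.1 (by linarith [norm_nonneg θ'])
    have e2 : θ' = 0 := norm_le_zero_iff.1 (by linarith [norm_nonneg θ])
    rw [e1, e2, h0, h0, sub_self, norm_zero]
    positivity
  · have hn : ∀ v : Euc k, ‖v‖ ≤ s → ‖s⁻¹ • v‖ ≤ 1 := fun v hv => by
      rw [norm_smul, Real.norm_of_nonneg (by positivity), ← div_eq_inv_mul]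
      exact div_le_one_of_le₀ hv h1.le
    have e : ∀ v : Euc k, v = s • (s⁻¹ • v) := fun v => by rw [smul_inv_smul₀ h1.ne']
    have := h x x' (s⁻¹ • θ) (s⁻¹ • θ') hx hx' (hn _ (by linarith [norm_nonneg θ']))
      (hn _ (by linarith [norm_nonneg θ]))
    rw [← smul_sub, norm_smul, Real.norm_of_nonneg (by positivity)] at this
    calc ‖G x θ - G x' θ'‖ = s * ‖G x (s⁻¹ • θ) - G x' (s⁻¹ • θ')‖ := by
          conv_lhs => rw [e θ, e θ', hG x (s⁻¹ • θ), hG x' (s⁻¹ • θ'), ← smul_sub, norm_smul,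
            Real.norm_of_nonneg (by positivity)]
      _ ≤ s * (L * (‖x - x'‖ + s⁻¹ * ‖θ - θ'‖)) := by gcongr
      _ = _ := by field_simp

end Homogeneous

namespace HomTwoLip

variable {G : Euc d → Euc k → F} {r L M D : ℝ}

lemma norm_le (h : HomTwoLip r L G) {x : Euc d} (hx : ‖x‖ ≤ r) (θ : Euc k) :
    ‖G x θ‖ ≤ L * ‖θ‖ ^ 2 := by
  have := h.sub_le x x θ 0 hx hx
  simpa [h.zero, pow_two] using this

lemma quadLip (h : HomTwoLip r L G) {x : Euc d} (hx : ‖x‖ ≤ r) : QuadLip L (G x) := by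
  intro θ θ'
  refine (h.sub_le x x θ θ' hx hx).trans (mul_le_mul_of_nonneg_left ?_ h.nonneg)
  rw [sub_self, norm_zero, mul_zero, zero_add]
  exact mul_le_mul_of_nonneg_right (by linarith) (norm_nonneg _)

lemma integrable (h : HomTwoLip r L G) {x : Euc d} (hx : ‖x‖ ≤ r) {ν : Measure (Euc k)}
    (hν : MomentLE ν M) : Integrable (G x) ν :=
  hν.integrable_quadLip h.nonneg (h.quadLip hx)

variable [NormedSpace ℝ F]

lemma norm_integral_le (h : HomTwoLip r L G) {x : Euc d} (hx : ‖x‖ ≤ r) {ν : Measure (Euc k)}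
    (hν : MomentLE ν M) : ‖∫ θ, G x θ ∂ν‖ ≤ L * M := by
  simpa using hν.norm_integral_le (B := 0) h.nonneg (by simpa using h.norm_le hx)

lemma norm_integral_sub_le (h : HomTwoLip r L G) {x x' : Euc d} (hx : ‖x‖ ≤ r) (hx' : ‖x'‖ ≤ r)
    {ν : Measure (Euc k)} (hν : MomentLE ν M) :
    ‖∫ θ, G x θ ∂ν - ∫ θ, G x' θ ∂ν‖ ≤ 4 * L * M * ‖x - x'‖ := by
  rw [← integral_sub (h.integrable hx hν) (h.integrable hx' hν)]
  have hL := h.nonneg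
  have := hν.norm_integral_le (G := fun θ => G x θ - G x' θ) (A := 4 * L * ‖x - x'‖) (B := 0)
    (by positivity) (fun θ => ?_)
  · linarith
  · refine (h.sub_le x x' θ θ hx hx').trans (le_of_eq ?_)
    rw [sub_self, norm_zero]; ring

lemma norm_integral_sub_le_of_near (h : HomTwoLip r L G) {x : Euc d} (hx : ‖x‖ ≤ r)
    {ν ν' : Measure (Euc k)} (hν : MomentLE ν M) (hν' : MomentLE ν' M) (hD : 0 < D)
    (hn : Near ν ν' D) :
    ‖∫ θ, G x θ ∂ν - ∫ θ, G x θ ∂ν'‖ ≤ L * (3 * M + 2) * D :=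
  norm_integral_sub_integral_le hν hν' hD hn h.nonneg (h.quadLip hx)

end HomTwoLip

section Activation

variable {f : Euc d → Euc k → Euc d}

/-- The partial derivative `∂ₓ f`. -/
noncomputable def partialX (f : Euc d → Euc k → Euc d) (x : Euc d) (θ : Euc k) :
    Euc d →L[ℝ] Euc d := fderiv ℝ (fun z => f z θ) x

/-- The partial derivative `∂_θ f`. -/
noncomputable def partialTheta (f : Euc d → Euc k → Euc d) (x : Euc d) (θ : Euc k) :
    Euc k →L[ℝ] Euc d := fderiv ℝ (fun ϑ => f x ϑ) θ

lemma ActivationAssumption.hasFDerivAt (hf : ActivationAssumption f) (q : Euc d × Euc k) :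
    HasFDerivAt (fun q : Euc d × Euc k => f q.1 q.2)
      (fderiv ℝ (fun q : Euc d × Euc k => f q.1 q.2) q) q :=
  (hf.contDiff.differentiable one_ne_zero q).hasFDerivAt

lemma ActivationAssumption.hasFDerivAt_left (hf : ActivationAssumption f) (x : Euc d)
    (θ : Euc k) : HasFDerivAt (fun z => f z θ) ((fderiv ℝ (fun q : Euc d × Euc k => f q.1 q.2)
      (x, θ)).comp (ContinuousLinearMap.inl ℝ (Euc d) (Euc k))) x :=
  HasFDerivAt.comp x (f := fun z => (z, θ)) (hf.hasFDerivAt (x, θ)) (hasFDerivAt_prodMk_left x θ)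

lemma ActivationAssumption.hasFDerivAt_right (hf : ActivationAssumption f) (x : Euc d)
    (θ : Euc k) : HasFDerivAt (fun ϑ => f x ϑ) ((fderiv ℝ (fun q : Euc d × Euc k => f q.1 q.2)
      (x, θ)).comp (ContinuousLinearMap.inr ℝ (Euc d) (Euc k))) θ :=
  HasFDerivAt.comp θ (f := fun ϑ => (x, ϑ)) (hf.hasFDerivAt (x, θ)) (hasFDerivAt_prodMk_right x θ)

lemma ActivationAssumption.hasFDerivAt_partialTheta (hf : ActivationAssumption f) (x : Euc d)
    (θ : Euc k) : HasFDerivAt (fun ϑ => f x ϑ) (partialTheta f x θ) θ :=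
  (hf.hasFDerivAt_right x θ).differentiableAt.hasFDerivAt

lemma partialX_smul (hhom : TwoHomogeneous f) (x : Euc d) (θ : Euc k) (c : ℝ) :
    partialX f x (c • θ) = c ^ 2 • partialX f x θ := by
  have : (fun z => f z (c • θ)) = (c ^ 2) • fun z => f z θ := by
    ext1 z; rw [hhom]; rfl
  rw [partialX, this, partialX, fderiv_const_smul_field]
  rfl

lemma partialTheta_smul (hhom : TwoHomogeneous f) (x : Euc d) (θ : Euc k) (c : ℝ) :
    partialTheta f x (c • θ) = c • partialTheta f x θ := by
  have key : ∀ (θ : Euc k) (c : ℝ), c ≠ 0 →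
      partialTheta f x (c • θ) = c • partialTheta f x θ := fun θ c hc => by
    have h1 : (fun ϑ => f x (c • ϑ)) = (c ^ 2) • fun ϑ => f x ϑ := by
      ext1 ϑ; rw [hhom]; rfl
    have h2 : c • partialTheta f x (c • θ) = c ^ 2 • partialTheta f x θ := by
      rw [partialTheta, ← fderiv_comp_smul (f := fun ϑ => f x ϑ), h1, fderiv_const_smul_field]
      rfl
    rw [pow_two, mul_smul] at h2
    exact smul_right_injective _ hc h2
  rcases eq_or_ne c 0 with rfl | hc
  -- For `c = 0` the claim is that the derivative vanishes at the origin; this follows from the case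
  -- `c = 2` applied to `2 • 0 = 0`.
  · rw [zero_smul]
    ext1 v
    have h1 : partialTheta f x ((2 : ℝ) • (0 : Euc k)) v = (2 : ℝ) • (partialTheta f x 0 v) :=
      DFunLike.congr_fun (key 0 2 two_ne_zero) v
    have h2 : ((0 : ℝ) • partialTheta f x θ) v = (0 : ℝ) • (partialTheta f x θ v) := rfl
    rw [smul_zero, two_smul] at h1
    rw [h2, zero_smul]
    exact left_eq_add.1 h1
  · exact key θ c hc

/-- On every ball, `f`, `∂ₓ f` and `∂_θ f` satisfy the Lipschitz estimates dictated by their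
homogeneity. -/
lemma ActivationAssumption.exists_homLip (hf : ActivationAssumption f) (hhom : TwoHomogeneous f)
    {r : ℝ} (hr : 0 < r) : ∃ L, HomTwoLip r L f ∧ HomTwoLip r L (partialX f) ∧
      HomOneLip r L (partialTheta f) := by
  obtain ⟨L₁, hL₁, h₁⟩ := hf.contDiff.exists_norm_sub_le r 1
  obtain ⟨C₃, -, h₃⟩ := hf.local_smoothness
  -- Radius `max r 1` covers `‖x‖ ≤ r` and the unit ball of parameters, which is all that
  -- homogeneity requires. The partial derivatives inherit the Lipschitz constant because both
  -- inclusions into the product have norm at most 1.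
  have h₂ := h₃ (max r 1) (lt_max_of_lt_left hr)
  set L₂ : ℝ := ((C₃ (max r 1) : ℝ≥0) : ℝ)
  have hL₂ : 0 ≤ L₂ := (C₃ (max r 1)).2
  have hdiff : ∀ x x' θ θ', ‖x‖ ≤ r → ‖x'‖ ≤ r → ‖θ‖ ≤ 1 → ‖θ'‖ ≤ 1 →
      ‖fderiv ℝ (fun q : Euc d × Euc k => f q.1 q.2) (x, θ) -
        fderiv ℝ (fun q : Euc d × Euc k => f q.1 q.2) (x', θ')‖ ≤
        L₂ * (‖x - x'‖ + ‖θ - θ'‖) := fun x x' θ θ' a b c e => by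
    have := h₂.dist_le_mul (x, θ) ⟨le_max_of_le_left a, le_max_of_le_right c⟩ (x', θ')
      ⟨le_max_of_le_left b, le_max_of_le_right e⟩
    rw [dist_eq_norm, dist_eq_norm] at this
    refine this.trans (mul_le_mul_of_nonneg_left ?_ hL₂)
    rw [Prod.norm_def]
    exact max_le_add_of_nonneg (norm_nonneg _) (norm_nonneg _)
  refine ⟨max L₁ L₂, homTwoLip_of_homogeneous hhom (le_max_of_le_left hL₁) ?_,
    homTwoLip_of_homogeneous (partialX_smul hhom) (le_max_of_le_left hL₁) ?_,
    homOneLip_of_homogeneous (partialTheta_smul hhom) (le_max_of_le_left hL₁) ?_⟩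
  · intro x x' θ θ' a b c e
    exact (h₁ x x' θ θ' a b c e).trans
      (mul_le_mul_of_nonneg_right (le_max_left _ _) (by positivity))
  · intro x x' θ θ' a b c e
    rw [partialX, partialX, (hf.hasFDerivAt_left x θ).fderiv, (hf.hasFDerivAt_left x' θ').fderiv,
      ← ContinuousLinearMap.sub_comp]
    refine (ContinuousLinearMap.opNorm_comp_le _ _).trans ?_
    refine (mul_le_of_le_one_right (norm_nonneg _)
      (ContinuousLinearMap.norm_inl_le_one ℝ _ _)).trans ((hdiff x x' θ θ' a b c e).trans ?_)
    exact mul_le_mul_of_nonneg_right (le_max_right _ _) (by positivity)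
  · intro x x' θ θ' a b c e
    rw [partialTheta, partialTheta, (hf.hasFDerivAt_right x θ).fderiv,
      (hf.hasFDerivAt_right x' θ').fderiv, ← ContinuousLinearMap.sub_comp]
    refine (ContinuousLinearMap.opNorm_comp_le _ _).trans ?_
    refine (mul_le_of_le_one_right (norm_nonneg _)
      (ContinuousLinearMap.norm_inr_le_one ℝ _ _)).trans ((hdiff x x' θ θ' a b c e).trans ?_)
    exact mul_le_mul_of_nonneg_right (le_max_right _ _) (by positivity)

lemma HomTwoLip.adjoint_apply {r L : ℝ} {A : Euc d → Euc k → Euc d →L[ℝ] Euc d}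
    (h : HomTwoLip r L A) (p : Euc d) :
    HomTwoLip r (L * ‖p‖) (fun x θ => ContinuousLinearMap.adjoint (A x θ) p) := by
  refine ⟨mul_nonneg h.nonneg (norm_nonneg _), fun x => by simp [h.zero], ?_⟩
  intro x x' θ θ' hx hx'
  rw [← _root_.sub_apply, ← map_sub]
  refine (ContinuousLinearMap.le_opNorm _ _).trans ?_
  rw [LinearIsometryEquiv.norm_map]
  refine (mul_le_mul_of_nonneg_right (h.sub_le x x' θ θ' hx hx') (norm_nonneg p)).trans
    (le_of_eq (by ring))

end Activation

end ResNet

/-! ### State and costate: existence, bounds and stability. -/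

namespace ResNet

variable {d k : ℕ} {f : Euc d → Euc k → Euc d} {g y : Euc d → ℝ} {μ : Measure (Euc d)}

/-- `ρ ∈ 𝒞([0,1]; 𝒫²)` with all second moments at most `M`. -/
structure PathLE (ρ : ℝ → Measure (Euc k)) (M : ℝ) : Prop where
  isPath : IsPath ρ
  moment : ∀ t ∈ Icc (0 : ℝ) 1, MomentLE (ρ t) M

lemma PathLE.nonneg {ρ : ℝ → Measure (Euc k)} {M : ℝ} (h : PathLE ρ M) : 0 ≤ M :=
  (h.moment 0 (by simp)).nonneg

lemma IsPath.exists_pathLE {ρ : ℝ → Measure (Euc k)} (h : IsPath ρ) : ∃ M, PathLE ρ M :=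
  h.exists_momentLE.imp fun _ hM => ⟨h, hM⟩

lemma ActivationAssumption.exists_field_growth (hf : ActivationAssumption f) (M : ℝ) :
    ∃ C ≥ 1, ∀ ν, MomentLE ν M → ∀ z, ‖∫ θ, f z θ ∂ν‖ ≤ C * ‖z‖ + C := by
  obtain ⟨C₁, hC₁⟩ := hf.linear_growth
  rcases lt_or_ge M 0 with hM | hM
  · exact ⟨1, le_rfl, fun ν hν => absurd hν.nonneg (not_le.2 hM)⟩
  refine ⟨|C₁| * (M + 1) + 1, by nlinarith [abs_nonneg C₁, mul_nonneg (abs_nonneg C₁) hM],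
    fun ν hν z => ?_⟩
  refine (hν.norm_integral_le (A := |C₁| * (‖z‖ + 1)) (B := |C₁| * (‖z‖ + 1)) (by positivity)
    fun θ => ?_).trans ?_
  · refine (hC₁ z θ).trans ?_
    have : C₁ * (‖θ‖ ^ 2 + 1) * (‖z‖ + 1) ≤ |C₁| * (‖θ‖ ^ 2 + 1) * (‖z‖ + 1) := by
      gcongr; exact le_abs_self C₁
    linarith
  · nlinarith [norm_nonneg z]

/-- The averaged field has linear growth by the growth assumption on `f`, is locally Lipschitz in
space by homogeneity and the moment bound, and is continuous in time by continuity of the path. -/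
lemma exists_state_through (hf : ActivationAssumption f) (hhom : TwoHomogeneous f)
    {ρ : ℝ → Measure (Euc k)} (hρ : IsPath ρ) {t₀ : ℝ} (ht₀ : t₀ ∈ Icc (0 : ℝ) 1) (x₀ : Euc d) :
    ∃ z : ℝ → Euc d, z t₀ = x₀ ∧ ∀ t ∈ Icc (0 : ℝ) 1,
      HasDerivWithinAt z (∫ θ, f (z t) θ ∂(ρ t)) (Icc (0 : ℝ) 1) t := by
  obtain ⟨M, hM⟩ := hρ.exists_pathLE
  obtain ⟨C, -, hC⟩ := hf.exists_field_growth (k := k) M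
  refine exists_ode_solution (F := fun t z => ∫ θ, f z θ ∂(ρ t)) (C := C)
    (fun t ht x => (hC _ (hM.moment t ht) x).trans (by linarith)) (fun R hR => ?_) (fun x => ?_)
    ht₀ x₀
  · obtain ⟨L, hL, -, -⟩ := hf.exists_homLip hhom hR
    exact ⟨4 * L * M, fun t ht x y hx hy => hL.norm_integral_sub_le hx hy (hM.moment t ht)⟩
  · obtain ⟨L, hL, -, -⟩ := hf.exists_homLip hhom (show 0 < ‖x‖ + 1 by positivity)
    exact hρ.continuousOn_integral hL.nonneg (hL.quadLip (by linarith))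

lemma isState_state (hf : ActivationAssumption f) (hhom : TwoHomogeneous f)
    {ρ : ℝ → Measure (Euc k)} (hρ : IsPath ρ) (x : Euc d) : IsState f ρ x (state f ρ x) :=
  Classical.epsilon_spec (exists_state_through hf hhom hρ (t₀ := 0) (by simp) x)

/-- The radius depends only on the bound for the data and on the moment bound, hence serves all
times of the gradient flow and its limit at once. -/
lemma exists_norm_state_le (hf : ActivationAssumption f) (hhom : TwoHomogeneous f) (R M : ℝ) :
    ∃ r > 0, ∀ ρ, PathLE ρ M → ∀ x, ‖x‖ ≤ R → ∀ t ∈ Icc (0 : ℝ) 1, ‖state f ρ x t‖ ≤ r := by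
  obtain ⟨C, hC1, hC⟩ := hf.exists_field_growth (k := k) M
  refine ⟨(|R| + C) * Real.exp (C * (1 - 0)), by positivity, fun ρ hρ x hx t ht => ?_⟩
  obtain ⟨h0, hz⟩ := isState_state hf hhom hρ.isPath x
  refine (norm_le_of_norm_deriv_le hC1 (by positivity) hz
    (fun t ht => hC _ (hρ.moment t ht) _) (t₀ := 0) (by simp) ht).trans ?_
  rw [h0]
  gcongr
  exact hx.trans (le_abs_self R)

lemma state_continuousOn (hf : ActivationAssumption f) (hhom : TwoHomogeneous f)
    {ρ : ℝ → Measure (Euc k)} (hρ : IsPath ρ) (x : Euc d) :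
    ContinuousOn (state f ρ x) (Icc 0 1) :=
  fun t ht => ((isState_state hf hhom hρ x).2 t ht).continuousWithinAt

/-- The vector field of the costate equation, up to sign. -/
noncomputable def cofield (f : Euc d → Euc k → Euc d) (ν : Measure (Euc k)) (z p : Euc d) :
    Euc d := ∫ θ, ContinuousLinearMap.adjoint (partialX f z θ) p ∂ν

section Cofield

variable {r L M : ℝ} {ν ν' : Measure (Euc k)} {z z' : Euc d}

lemma norm_cofield_le (hL : HomTwoLip r L (partialX f)) (hν : MomentLE ν M) (hz : ‖z‖ ≤ r)
    (p : Euc d) : ‖cofield f ν z p‖ ≤ L * M * ‖p‖ :=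
  ((hL.adjoint_apply p).norm_integral_le hz hν).trans (le_of_eq (by ring))

lemma cofield_sub (hL : HomTwoLip r L (partialX f)) (hν : MomentLE ν M) (hz : ‖z‖ ≤ r)
    (p p' : Euc d) : cofield f ν z p - cofield f ν z p' = cofield f ν z (p - p') := by
  rw [cofield, cofield, cofield, ← integral_sub ((hL.adjoint_apply p).integrable hz hν)
    ((hL.adjoint_apply p').integrable hz hν)]
  simp only [map_sub]

lemma norm_cofield_sub_le (hL : HomTwoLip r L (partialX f)) (hν : MomentLE ν M) (hz : ‖z‖ ≤ r)
    (p p' : Euc d) : ‖cofield f ν z p - cofield f ν z p'‖ ≤ L * M * ‖p - p'‖ := by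
  rw [cofield_sub hL hν hz]
  exact norm_cofield_le hL hν hz _

lemma norm_cofield_sub_cofield_le (hL : HomTwoLip r L (partialX f)) (hν : MomentLE ν M)
    (hν' : MomentLE ν' M) (hz : ‖z‖ ≤ r) (hz' : ‖z'‖ ≤ r) {D : ℝ} (hD : 0 < D)
    (hn : Near ν ν' D) (p : Euc d) :
    ‖cofield f ν z p - cofield f ν' z' p‖ ≤
      4 * (L * ‖p‖) * M * ‖z - z'‖ + L * ‖p‖ * (3 * M + 2) * D := by
  have h1 := (hL.adjoint_apply p).norm_integral_sub_le hz hz' hν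
  have h2 := (hL.adjoint_apply p).norm_integral_sub_le_of_near hz' hν hν' hD hn
  exact (norm_sub_le_norm_sub_add_norm_sub _ (cofield f ν z' p) _).trans (add_le_add h1 h2)

end Cofield

/-- The terminal condition of the costate equation. -/
noncomputable def terminalCostate (g y : Euc d → ℝ) (x z : Euc d) : Euc d :=
  (g z - y x) • gradient g z

lemma exists_costate (hf : ActivationAssumption f) (hhom : TwoHomogeneous f)
    {ρ : ℝ → Measure (Euc k)} (hρ : IsPath ρ) (x : Euc d) : ∃ p, IsCostate f g y ρ x p := by
  obtain ⟨M, hM⟩ := hρ.exists_pathLE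
  have hM0 := hM.nonneg
  obtain ⟨r, hr0, hr⟩ := exists_norm_state_le hf hhom ‖x‖ M
  obtain ⟨L, -, hL, -⟩ := hf.exists_homLip hhom hr0
  have hL0 := hL.nonneg
  have hz : ∀ t ∈ Icc (0 : ℝ) 1, ‖state f ρ x t‖ ≤ r := fun t ht => hr ρ hM x le_rfl t ht
  refine exists_ode_solution (F := fun t p => -cofield f (ρ t) (state f ρ x t) p) (C := L * M)
    (fun t ht p => ?_) (fun R _ => ⟨L * M, fun t ht p p' _ _ => ?_⟩) (fun p => ?_) (t₀ := 1)
    (by simp) _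
  · rw [norm_neg]
    refine (norm_cofield_le hL (hM.moment t ht) (hz t ht) p).trans ?_
    gcongr
    linarith
  · rw [← neg_sub', norm_neg]
    exact norm_cofield_sub_le hL (hM.moment t ht) (hz t ht) p p'
  -- Continuity in time: the state is first moved to its value at `t₁` under the measure `ρ t`, and
  -- then the measure is moved.
  · refine ContinuousOn.neg fun t₁ ht₁ => ?_
    rw [ContinuousWithinAt, tendsto_iff_norm_sub_tendsto_zero]
    have hA := hρ.continuousOn_integral (hL.adjoint_apply p).nonneg
      ((hL.adjoint_apply p).quadLip (hz t₁ ht₁)) t₁ ht₁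
    have hB := state_continuousOn hf hhom hρ x t₁ ht₁
    rw [ContinuousWithinAt, tendsto_iff_norm_sub_tendsto_zero] at hA hB
    refine squeeze_zero' (Eventually.of_forall fun _ => norm_nonneg _)
      (g := fun t => 4 * (L * ‖p‖) * M * ‖state f ρ x t - state f ρ x t₁‖ +
        ‖cofield f (ρ t) (state f ρ x t₁) p - cofield f (ρ t₁) (state f ρ x t₁) p‖)
      (eventually_nhdsWithin_of_forall fun t ht => ?_) ?_
    · refine (norm_sub_le_norm_sub_add_norm_sub _ (cofield f (ρ t) (state f ρ x t₁) p) _).trans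
        (add_le_add ?_ le_rfl)
      exact (hL.adjoint_apply p).norm_integral_sub_le (hz t ht) (hz t₁ ht₁) (hM.moment t ht)
    · simpa [cofield] using (hB.const_mul (4 * (L * ‖p‖) * M)).add hA

lemma isCostate_costate (hf : ActivationAssumption f) (hhom : TwoHomogeneous f)
    {ρ : ℝ → Measure (Euc k)} (hρ : IsPath ρ) (x : Euc d) :
    IsCostate f g y ρ x (costate f g y ρ x) :=
  Classical.epsilon_spec (exists_costate hf hhom hρ x)

lemma contDiff_gradient {n : WithTop ℕ∞} (hg : ContDiff ℝ (n + 1) g) :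
    ContDiff ℝ n (gradient g) :=
  (InnerProductSpace.toDual ℝ (Euc d)).symm.contDiff.comp (hg.fderiv_right le_rfl)

/-- Second-order smoothness of `g` is used here: it makes the terminal condition Lipschitz on
bounded sets. -/
lemma contDiff_terminalCostate (hdata : DataAssumption g y μ) :
    ContDiff ℝ 1 (fun q : Euc d × Euc d => terminalCostate g y q.1 q.2) := by
  have h1 : ContDiff ℝ 1 g := hdata.contDiff_g.of_le one_le_two
  have h2 : ContDiff ℝ 1 y := hdata.contDiff_y.of_le one_le_two
  have h3 : ContDiff ℝ 1 (gradient g) := contDiff_gradient (n := 1) (by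
    rw [one_add_one_eq_two]; exact hdata.contDiff_g)
  exact ((h1.comp contDiff_snd).sub (h2.comp contDiff_fst)).smul (h3.comp contDiff_snd)

/-- Bounds and stability estimates for the state and the costate, on bounded sets of initial data
and of paths. -/
structure TrajectoryBounds (f : Euc d → Euc k → Euc d) (g y : Euc d → ℝ) (R M C : ℝ) : Prop where
  pos : 0 < C
  norm_state_le : ∀ ρ, PathLE ρ M → ∀ x, ‖x‖ ≤ R → ∀ t ∈ Icc (0 : ℝ) 1, ‖state f ρ x t‖ ≤ C
  norm_costate_le : ∀ ρ, PathLE ρ M → ∀ x, ‖x‖ ≤ R → ∀ t ∈ Icc (0 : ℝ) 1,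
    ‖costate f g y ρ x t‖ ≤ C
  state_sub_le : ∀ ρ ρ', PathLE ρ M → PathLE ρ' M → ∀ D > 0,
    (∀ t ∈ Icc (0 : ℝ) 1, Near (ρ t) (ρ' t) D) → ∀ x x', ‖x‖ ≤ R → ‖x'‖ ≤ R →
    ∀ t ∈ Icc (0 : ℝ) 1, ‖state f ρ x t - state f ρ' x' t‖ ≤ C * (‖x - x'‖ + D)
  costate_sub_le : ∀ ρ ρ', PathLE ρ M → PathLE ρ' M → ∀ D > 0,
    (∀ t ∈ Icc (0 : ℝ) 1, Near (ρ t) (ρ' t) D) → ∀ x x', ‖x‖ ≤ R → ‖x'‖ ≤ R →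
    ∀ t ∈ Icc (0 : ℝ) 1, ‖costate f g y ρ x t - costate f g y ρ' x' t‖ ≤ C * (‖x - x'‖ + D)

/-- Grönwall for the difference of two states; replacing one measure by the other acts as a forcing
term of order `D`. -/
lemma exists_state_sub_le (hf : ActivationAssumption f) (hhom : TwoHomogeneous f) (R : ℝ) {M : ℝ}
    (hM : 0 ≤ M) : ∃ C ≥ 0, ∀ ρ ρ', PathLE ρ M → PathLE ρ' M → ∀ D > 0,
    (∀ t ∈ Icc (0 : ℝ) 1, Near (ρ t) (ρ' t) D) → ∀ x x', ‖x‖ ≤ R → ‖x'‖ ≤ R →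
    ∀ t ∈ Icc (0 : ℝ) 1, ‖state f ρ x t - state f ρ' x' t‖ ≤ C * (‖x - x'‖ + D) := by
  obtain ⟨r, hr0, hr⟩ := exists_norm_state_le hf hhom R M
  obtain ⟨L, hL, -, -⟩ := hf.exists_homLip hhom hr0
  have hL0 := hL.nonneg
  set e := L * (3 * M + 2)
  set K := 4 * L * M + 1
  have hK : 1 ≤ K := by simp only [K]; nlinarith [mul_nonneg hL0 hM]
  refine ⟨(e + 1) * Real.exp (K * (1 - 0)), by positivity, ?_⟩
  intro ρ ρ' hρ hρ' D hD hn x x' hx hx' t ht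
  obtain ⟨h0, hz⟩ := isState_state hf hhom hρ.isPath x
  obtain ⟨h0', hz'⟩ := isState_state hf hhom hρ'.isPath x'
  have := norm_le_of_norm_deriv_le (w := fun t => state f ρ x t - state f ρ' x' t) hK
    (ε := e * D) (by positivity) (fun t ht => (hz t ht).sub (hz' t ht)) (fun t ht => ?_)
    (t₀ := 0) (by simp) ht
  · rw [h0, h0'] at this
    refine this.trans ?_
    rw [mul_assoc (e + 1), mul_comm (Real.exp _), ← mul_assoc]
    gcongr
    have : 0 ≤ e * ‖x - x'‖ := by positivity
    nlinarith
  · have a1 := hL.norm_integral_sub_le (hr ρ hρ x hx t ht) (hr ρ' hρ' x' hx' t ht)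
      (hρ.moment t ht)
    have a2 := hL.norm_integral_sub_le_of_near (hr ρ' hρ' x' hx' t ht) (hρ.moment t ht)
      (hρ'.moment t ht) hD (hn t ht)
    refine (norm_sub_le_norm_sub_add_norm_sub _ (∫ θ, f (state f ρ' x' t) θ ∂(ρ t)) _).trans ?_
    refine (add_le_add a1 a2).trans (add_le_add ?_ le_rfl)
    exact mul_le_mul_of_nonneg_right (by simp [K]) (norm_nonneg _)

/-- The costate equation is linear and starts from a terminal value that is bounded on the compact
set of possible data and final states. -/
lemma exists_norm_costate_le (hf : ActivationAssumption f) (hhom : TwoHomogeneous f)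
    (hdata : DataAssumption g y μ) (R : ℝ) {M : ℝ} (hM : 0 ≤ M) :
    ∃ C ≥ 0, ∀ ρ, PathLE ρ M → ∀ x, ‖x‖ ≤ R → ∀ t ∈ Icc (0 : ℝ) 1,
      ‖costate f g y ρ x t‖ ≤ C := by
  obtain ⟨r, hr0, hr⟩ := exists_norm_state_le hf hhom R M
  obtain ⟨L, -, hL, -⟩ := hf.exists_homLip hhom hr0
  have hL0 := hL.nonneg
  obtain ⟨P, hP⟩ := ((isCompact_closedBall (0 : Euc d) R).prod
    (isCompact_closedBall (0 : Euc d) r)).exists_bound_of_continuousOn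
    (contDiff_terminalCostate hdata).continuous.continuousOn
  refine ⟨(|P| + 0) * Real.exp ((L * M + 1) * (1 - 0)), by positivity, ?_⟩
  intro ρ hρ x hx t ht
  obtain ⟨h1, hp⟩ := isCostate_costate (g := g) (y := y) hf hhom hρ.isPath x
  refine (norm_le_of_norm_deriv_le (K := L * M + 1) (ε := 0) (by nlinarith [mul_nonneg hL0 hM])
    le_rfl hp (fun t ht => ?_) (t₀ := 1) (by simp) ht).trans ?_
  · rw [norm_neg]
    refine (norm_cofield_le hL (hρ.moment t ht) (hr ρ hρ x hx t ht) _).trans ?_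
    linarith [norm_nonneg (costate f g y ρ x t)]
  · rw [h1]
    gcongr
    have := hP (x, state f ρ x 1) ⟨by simpa using hx, by simpa using hr ρ hρ x hx 1 (by simp)⟩
    exact this.trans (le_abs_self P)

lemma exists_trajectoryBounds (hf : ActivationAssumption f) (hhom : TwoHomogeneous f)
    (hdata : DataAssumption g y μ) (R : ℝ) {M : ℝ} (hM : 0 ≤ M) :
    ∃ C, TrajectoryBounds f g y R M C := by
  obtain ⟨r, hr0, hr⟩ := exists_norm_state_le hf hhom R M
  obtain ⟨L, -, hL, -⟩ := hf.exists_homLip hhom hr0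
  obtain ⟨A, hA0, hA⟩ := exists_state_sub_le hf hhom R hM
  obtain ⟨B, hB0, hB⟩ := exists_norm_costate_le hf hhom hdata R hM
  obtain ⟨Q, hQ0, hQ⟩ := (contDiff_terminalCostate hdata).exists_norm_sub_le R r
  have hL0 := hL.nonneg
  -- The difference of two costates solves a linear equation with forcing at most `e * S`: the first
  -- summand comes from the change of state, the second from the change of measure, both with
  -- costates bounded by `B`.
  set e := 4 * (L * B) * M * A + L * B * (3 * M + 2)
  set K := L * M + 1
  have hK : 1 ≤ K := by simp only [K]; nlinarith [mul_nonneg hL0 hM]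
  set C' := (Q * (1 + A) + e) * Real.exp (K * (1 - 0))
  have hC' : 0 ≤ C' := by positivity
  refine ⟨r + A + B + C', by positivity, fun ρ hρ x hx t ht => ?_, fun ρ hρ x hx t ht => ?_,
    fun ρ ρ' hρ hρ' D hD hn x x' hx hx' t ht => ?_,
    fun ρ ρ' hρ hρ' D hD hn x x' hx hx' t ht => ?_⟩
  · linarith [hr ρ hρ x hx t ht]
  · linarith [hB ρ hρ x hx t ht]
  · refine (hA ρ ρ' hρ hρ' D hD hn x x' hx hx' t ht).trans ?_
    gcongr
    linarith
  · obtain ⟨h1, hp⟩ := isCostate_costate (g := g) (y := y) hf hhom hρ.isPath x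
    obtain ⟨h1', hp'⟩ := isCostate_costate (g := g) (y := y) hf hhom hρ'.isPath x'
    have hs := hA ρ ρ' hρ hρ' D hD hn x x' hx hx'
    set S := ‖x - x'‖ + D
    have hDS : D ≤ S := by simp [S]
    have hxS : ‖x - x'‖ ≤ S := by simp [S, hD.le]
    have hS : 0 ≤ S := hD.le.trans hDS
    have h := norm_le_of_norm_deriv_le
      (w := fun t => costate f g y ρ x t - costate f g y ρ' x' t) hK
      (ε := e * S) (by positivity) (fun t ht => (hp t ht).sub (hp' t ht)) (fun t ht => ?_)
      (t₀ := 1) (by simp) ht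
    · have hq : ‖costate f g y ρ x 1 - costate f g y ρ' x' 1‖ ≤ Q * (1 + A) * S := by
        rw [h1, h1']
        have := hQ x x' (state f ρ x 1) (state f ρ' x' 1) hx hx' (hr ρ hρ x hx 1 (by simp))
          (hr ρ' hρ' x' hx' 1 (by simp))
        refine this.trans ?_
        rw [mul_assoc]
        gcongr
        linarith [hs 1 (by simp)]
      refine h.trans ?_
      calc _ ≤ (Q * (1 + A) * S + e * S) * Real.exp (K * (1 - 0)) := by gcongr
        _ = C' * S := by simp only [C']; ring
        _ ≤ _ := by gcongr; linarith
    · have hz := hr ρ hρ x hx t ht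
      have hz' := hr ρ' hρ' x' hx' t ht
      have a1 := norm_cofield_sub_le hL (hρ.moment t ht) hz (costate f g y ρ x t)
        (costate f g y ρ' x' t)
      have a2 := norm_cofield_sub_cofield_le hL (hρ.moment t ht) (hρ'.moment t ht) hz hz' hD
        (hn t ht) (costate f g y ρ' x' t)
      rw [← neg_sub', norm_neg]
      refine (norm_sub_le_norm_sub_add_norm_sub _
        (cofield f (ρ t) (state f ρ x t) (costate f g y ρ' x' t)) _).trans ?_
      refine (add_le_add a1 a2).trans (add_le_add ?_ ?_)
      · exact mul_le_mul_of_nonneg_right (by simp [K]) (norm_nonneg _)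
      · have hb := hB ρ' hρ' x' hx' t ht
        have hst := hs t ht
        calc _ ≤ 4 * (L * B) * M * (A * S) + L * B * (3 * M + 2) * S := by gcongr
          _ = e * S := by simp only [e]; ring

end ResNet

/-! ### The parameter gradient of the first variation. -/

namespace ResNet

variable {d k : ℕ} {f : Euc d → Euc k → Euc d} {g y : Euc d → ℝ} {μ : Measure (Euc d)}
  {ρ : ℝ → Measure (Euc k)} {t : ℝ}

/-- The constant does not depend on `D`, so `D` may tend to zero. This is the form delivered by the
stability estimates when both paths coincide. -/
lemma continuous_of_forall_norm_sub_le {E F : Type*} [SeminormedAddCommGroup E]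
    [SeminormedAddCommGroup F] {G : E → F}
    (h : ∀ R, ∃ C, ∀ D > 0, ∀ x x', ‖x‖ ≤ R → ‖x'‖ ≤ R → ‖G x - G x'‖ ≤ C * (‖x - x'‖ + D)) :
    Continuous G := by
  rw [continuous_iff_continuousAt]
  intro x₀
  obtain ⟨C, hC⟩ := h (‖x₀‖ + 1)
  rw [ContinuousAt, tendsto_iff_norm_sub_tendsto_zero]
  have hlim : Tendsto (fun x => C * ‖x - x₀‖) (𝓝 x₀) (𝓝 0) := by
    have : Continuous fun x => C * ‖x - x₀‖ := by fun_prop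
    simpa using this.tendsto x₀
  refine squeeze_zero' (Eventually.of_forall fun _ => norm_nonneg _) ?_ hlim
  filter_upwards [Metric.ball_mem_nhds x₀ one_pos] with x hx
  have hx' : ‖x‖ ≤ ‖x₀‖ + 1 := by
    have := norm_le_norm_add_norm_sub' x x₀
    rw [Metric.mem_ball, dist_eq_norm] at hx
    linarith
  have hlim2 : Tendsto (fun D : ℝ => C * (‖x - x₀‖ + D)) (𝓝[>] 0) (𝓝 (C * ‖x - x₀‖)) := by
    have : Continuous fun D : ℝ => C * (‖x - x₀‖ + D) := by fun_prop
    simpa using (this.tendsto 0).mono_left nhdsWithin_le_nhds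
  exact ge_of_tendsto hlim2 (eventually_nhdsWithin_of_forall fun D hD =>
    hC D hD x x₀ hx' (by linarith))

lemma continuous_state (hf : ActivationAssumption f) (hhom : TwoHomogeneous f)
    (hρ : IsPath ρ) (ht : t ∈ Icc (0 : ℝ) 1) : Continuous fun x => state f ρ x t := by
  obtain ⟨M, hM⟩ := hρ.exists_pathLE
  refine continuous_of_forall_norm_sub_le fun R => ?_
  obtain ⟨C, -, hC⟩ := exists_state_sub_le hf hhom R hM.nonneg
  exact ⟨C, fun D hD x x' hx hx' => hC ρ ρ hM hM D hD (fun _ _ => near_self) x x' hx hx' t ht⟩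

lemma continuous_costate (hf : ActivationAssumption f) (hhom : TwoHomogeneous f)
    (hdata : DataAssumption g y μ) (hρ : IsPath ρ) (ht : t ∈ Icc (0 : ℝ) 1) :
    Continuous fun x => costate f g y ρ x t := by
  obtain ⟨M, hM⟩ := hρ.exists_pathLE
  refine continuous_of_forall_norm_sub_le fun R => ?_
  obtain ⟨C, hC⟩ := exists_trajectoryBounds hf hhom hdata R hM.nonneg
  exact ⟨C, fun D hD x x' hx hx' =>
    hC.costate_sub_le ρ ρ hM hM D hD (fun _ _ => near_self) x x' hx hx' t ht⟩

lemma ActivationAssumption.continuous_partialTheta (hf : ActivationAssumption f) :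
    Continuous fun q : Euc d × Euc k => partialTheta f q.1 q.2 := by
  have : (fun q : Euc d × Euc k => partialTheta f q.1 q.2) = fun q =>
      (fderiv ℝ (fun q : Euc d × Euc k => f q.1 q.2) q).comp
        (ContinuousLinearMap.inr ℝ (Euc d) (Euc k)) := by
    ext1 q
    exact (hf.hasFDerivAt_right q.1 q.2).fderiv
  rw [this]
  exact (hf.contDiff.continuous_fderiv one_ne_zero).clm_comp continuous_const

/-- The gradient of the first variation in the parameter variable. -/
noncomputable def driftGradient (f : Euc d → Euc k → Euc d) (g y : Euc d → ℝ)
    (μ : Measure (Euc d)) (ρ : ℝ → Measure (Euc k)) (t : ℝ) (θ : Euc k) : Euc k :=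
  ∫ x, ContinuousLinearMap.adjoint (partialTheta f (state f ρ x t) θ) (costate f g y ρ x t) ∂μ

lemma firstVariation_smul (hhom : TwoHomogeneous f) (c : ℝ) (θ : Euc k) :
    firstVariation f g y μ ρ t (c • θ) = c ^ 2 * firstVariation f g y μ ρ t θ := by
  rw [firstVariation, firstVariation, ← integral_const_mul]
  congr 1
  ext x
  rw [hhom, real_inner_smul_right]

lemma driftGradient_smul (hhom : TwoHomogeneous f) (c : ℝ) (θ : Euc k) :
    driftGradient f g y μ ρ t (c • θ) = c • driftGradient f g y μ ρ t θ := by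
  rw [driftGradient, driftGradient, ← integral_smul]
  congr 1
  ext1 x
  rw [partialTheta_smul hhom, map_smulₛₗ]
  rfl

lemma DataAssumption.exists_ae_norm_le (hdata : DataAssumption g y μ) :
    ∃ R > 0, ∀ᵐ x ∂μ, ‖x‖ ≤ R := by
  obtain ⟨R, hR0, hR⟩ := hdata.compact_support
  refine ⟨R, hR0, ?_⟩
  filter_upwards [Measure.support_mem_ae (μ := μ)] with x hx
  exact (mem_ball_zero_iff.1 (hR hx)).le

lemma norm_integral_le_of_ae_le {α E : Type*} [MeasurableSpace α] [NormedAddCommGroup E]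
    [NormedSpace ℝ E] {μ : Measure α} [IsProbabilityMeasure μ] {G : α → E} {C : ℝ}
    (h : ∀ᵐ x ∂μ, ‖G x‖ ≤ C) : ‖∫ x, G x ∂μ‖ ≤ C := by
  simpa using norm_integral_le_of_norm_le_const h

section Gradient

lemma continuous_driftGradient_integrand (hf : ActivationAssumption f) (hhom : TwoHomogeneous f)
    (hdata : DataAssumption g y μ) (hρ : IsPath ρ) (ht : t ∈ Icc (0 : ℝ) 1) (θ : Euc k) :
    Continuous fun x => ContinuousLinearMap.adjoint (partialTheta f (state f ρ x t) θ)
      (costate f g y ρ x t) := by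
  have h1 : Continuous fun x => partialTheta f (state f ρ x t) θ :=
    hf.continuous_partialTheta.comp ((continuous_state hf hhom hρ ht).prodMk continuous_const)
  have h2 := continuous_costate (g := g) (y := y) hf hhom hdata hρ ht
  exact ((ContinuousLinearMap.adjoint (𝕜 := ℝ) (E := Euc k) (F := Euc d)).continuous.comp
    h1).clm_apply h2

/-- Uniform properties of the first variation and its gradient, for paths with second moments
at most `M`. -/
lemma exists_driftGradient_bounds (hf : ActivationAssumption f) (hhom : TwoHomogeneous f)
    (hdata : DataAssumption g y μ) {M : ℝ} (hM : 0 ≤ M) :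
    ∃ Λ > 0, (∀ ρ, PathLE ρ M → ∀ t ∈ Icc (0 : ℝ) 1,
        (∀ θ : Euc k, HasGradientAt (firstVariation f g y μ ρ t) (driftGradient f g y μ ρ t θ) θ) ∧
        ∀ θ θ' : Euc k, ‖driftGradient f g y μ ρ t θ - driftGradient f g y μ ρ t θ'‖ ≤
          Λ * ‖θ - θ'‖) ∧
      ∀ ρ ρ', PathLE ρ M → PathLE ρ' M → ∀ D > 0, (∀ t ∈ Icc (0 : ℝ) 1, Near (ρ t) (ρ' t) D) →
        ∀ t ∈ Icc (0 : ℝ) 1, ∀ θ : Euc k,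
          ‖driftGradient f g y μ ρ t θ - driftGradient f g y μ ρ' t θ‖ ≤ Λ * D * ‖θ‖ := by
  have := hdata.probability
  obtain ⟨R, hR0, hR⟩ := hdata.exists_ae_norm_le
  obtain ⟨C, hC⟩ := exists_trajectoryBounds (k := k) hf hhom hdata R hM
  have hC0 := hC.pos
  obtain ⟨L, hLf, -, hL⟩ := hf.exists_homLip hhom hC0
  have hL0 := hL.nonneg
  have hTle : ∀ x, ‖x‖ ≤ C → ∀ θ, ‖partialTheta f x θ‖ ≤ L * ‖θ‖ := fun x hx θ => by
    simpa [hL.zero] using hL.sub_le x x θ 0 hx hx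
  have hint : ∀ ρ, PathLE ρ M → ∀ t ∈ Icc (0 : ℝ) 1, ∀ θ : Euc k,
      Integrable (fun x => ContinuousLinearMap.adjoint (partialTheta f (state f ρ x t) θ)
        (costate f g y ρ x t)) μ := fun ρ hρ t ht θ => by
    refine Integrable.of_bound (continuous_driftGradient_integrand hf hhom hdata hρ.isPath ht
      θ).aestronglyMeasurable (L * ‖θ‖ * C) ?_
    filter_upwards [hR] with x hx
    refine (ContinuousLinearMap.le_opNorm _ _).trans ?_
    rw [LinearIsometryEquiv.norm_map]
    gcongr
    · exact hTle _ (hC.norm_state_le ρ hρ x hx t ht) θ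
    · exact hC.norm_costate_le ρ hρ x hx t ht
  refine ⟨L * C + L * 2 * C * C + 1, by positivity, fun ρ hρ t ht => ⟨fun θ => ?_, fun θ θ' => ?_⟩,
    fun ρ ρ' hρ hρ' D hD hn t ht θ => ?_⟩
  · have hZ := continuous_state hf hhom hρ.isPath ht
    have hp := continuous_costate (g := g) (y := y) hf hhom hdata hρ.isPath ht
    have hFc : ∀ ϑ : Euc k, Continuous fun x =>
        inner ℝ (costate f g y ρ x t) (f (state f ρ x t) ϑ) := fun ϑ =>
      hp.inner (hf.contDiff.continuous.comp (hZ.prodMk continuous_const))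
    have hF'c : Continuous fun x => (innerSL ℝ (costate f g y ρ x t)).comp
        (partialTheta f (state f ρ x t) θ) :=
      ((innerSL ℝ).continuous.comp hp).clm_comp
        (hf.continuous_partialTheta.comp (hZ.prodMk continuous_const))
    -- Differentiation under the integral; the dominating constant is available because `μ`-almost
    -- every `x` lies in a fixed ball, where state and costate are bounded.
    have key := hasFDerivAt_integral_of_dominated_of_fderiv_le (μ := μ) (𝕜 := ℝ) (x₀ := θ)
      (F := fun ϑ x => inner ℝ (costate f g y ρ x t) (f (state f ρ x t) ϑ))
      (F' := fun ϑ x => (innerSL ℝ (costate f g y ρ x t)).comp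
        (partialTheta f (state f ρ x t) ϑ))
      (s := Metric.ball θ 1) (bound := fun _ => C * (L * (‖θ‖ + 1)))
      (Metric.ball_mem_nhds θ one_pos)
      (Eventually.of_forall fun ϑ => (hFc ϑ).aestronglyMeasurable)
      (by
        refine Integrable.of_bound (hFc θ).aestronglyMeasurable (C * (L * ‖θ‖ ^ 2)) ?_
        filter_upwards [hR] with x hx
        refine (norm_inner_le_norm _ _).trans ?_
        gcongr
        · exact hC.norm_costate_le ρ hρ x hx t ht
        · exact hLf.norm_le (hC.norm_state_le ρ hρ x hx t ht) θ)
      hF'c.aestronglyMeasurable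
      (by
        filter_upwards [hR] with x hx ϑ hϑ
        refine (ContinuousLinearMap.opNorm_comp_le _ _).trans ?_
        rw [innerSL_apply_norm]
        have hϑ' : ‖ϑ‖ ≤ ‖θ‖ + 1 := by
          have := norm_le_norm_add_norm_sub' ϑ θ
          rw [Metric.mem_ball, dist_eq_norm] at hϑ
          linarith
        gcongr
        · exact hC.norm_costate_le ρ hρ x hx t ht
        · refine (hTle _ (hC.norm_state_le ρ hρ x hx t ht) ϑ).trans ?_
          gcongr)
      (integrable_const _)
      (Eventually.of_forall fun x ϑ _ =>
        (innerSL ℝ (costate f g y ρ x t)).hasFDerivAt.comp ϑ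
          (hf.hasFDerivAt_partialTheta (state f ρ x t) ϑ))
    rw [hasGradientAt_iff_hasFDerivAt]
    refine key.congr_fderiv (ContinuousLinearMap.ext fun v => ?_)
    rw [ContinuousLinearMap.integral_apply]
    · rw [InnerProductSpace.toDual_apply_apply, real_inner_comm, driftGradient,
        ← integral_inner (hint ρ hρ t ht θ)]
      congr 1
      ext x
      rw [real_inner_comm, ContinuousLinearMap.adjoint_inner_left]
      rfl
    · refine Integrable.of_bound hF'c.aestronglyMeasurable (C * (L * ‖θ‖)) ?_
      filter_upwards [hR] with x hx
      refine (ContinuousLinearMap.opNorm_comp_le _ _).trans ?_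
      rw [innerSL_apply_norm]
      gcongr
      · exact hC.norm_costate_le ρ hρ x hx t ht
      · exact hTle _ (hC.norm_state_le ρ hρ x hx t ht) θ
  · rw [driftGradient, driftGradient, ← integral_sub (hint ρ hρ t ht θ) (hint ρ hρ t ht θ')]
    refine norm_integral_le_of_ae_le ?_
    filter_upwards [hR] with x hx
    rw [← _root_.sub_apply, ← map_sub]
    refine (ContinuousLinearMap.le_opNorm _ _).trans ?_
    rw [LinearIsometryEquiv.norm_map]
    have hz := hC.norm_state_le ρ hρ x hx t ht
    have h1 := hL.sub_le _ _ θ θ' hz hz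
    rw [sub_self, norm_zero, mul_zero, zero_add] at h1
    calc _ ≤ L * ‖θ - θ'‖ * C := mul_le_mul h1 (hC.norm_costate_le ρ hρ x hx t ht)
            (norm_nonneg _) (by positivity)
      _ = L * C * ‖θ - θ'‖ := by ring
      _ ≤ _ := by
        refine mul_le_mul_of_nonneg_right ?_ (norm_nonneg _)
        have : 0 ≤ L * 2 * C * C := by positivity
        linarith
  · rw [driftGradient, driftGradient, ← integral_sub (hint ρ hρ t ht θ) (hint ρ' hρ' t ht θ)]
    refine norm_integral_le_of_ae_le ?_
    filter_upwards [hR] with x hx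
    have hz := hC.norm_state_le ρ hρ x hx t ht
    have hz' := hC.norm_state_le ρ' hρ' x hx t ht
    have hp := hC.norm_costate_le ρ hρ x hx t ht
    have hs := hC.state_sub_le ρ ρ' hρ hρ' D hD hn x x hx hx t ht
    have hcs := hC.costate_sub_le ρ ρ' hρ hρ' D hD hn x x hx hx t ht
    rw [sub_self, norm_zero, zero_add] at hs hcs
    have h1 := hL.sub_le _ _ θ θ hz hz'
    rw [sub_self, norm_zero, add_zero] at h1
    -- The change of path acts separately through the state in the derivative of `f` and through the
    -- costate; each contributes at order `D ‖θ‖`.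
    have e : ContinuousLinearMap.adjoint (partialTheta f (state f ρ x t) θ)
        (costate f g y ρ x t) - ContinuousLinearMap.adjoint (partialTheta f (state f ρ' x t) θ)
        (costate f g y ρ' x t) =
        ContinuousLinearMap.adjoint (partialTheta f (state f ρ x t) θ -
          partialTheta f (state f ρ' x t) θ) (costate f g y ρ x t) +
        ContinuousLinearMap.adjoint (partialTheta f (state f ρ' x t) θ)
          (costate f g y ρ x t - costate f g y ρ' x t) := by
      rw [map_sub, map_sub, _root_.sub_apply]
      abel
    rw [e]
    refine (norm_add_le _ _).trans ?_
    calc _ ≤ L * ((‖θ‖ + ‖θ‖) * (C * D)) * C + L * ‖θ‖ * (C * D) := by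
          refine add_le_add ((ContinuousLinearMap.le_opNorm _ _).trans ?_)
            ((ContinuousLinearMap.le_opNorm _ _).trans ?_)
          · rw [LinearIsometryEquiv.norm_map]
            refine mul_le_mul (h1.trans ?_) hp (norm_nonneg _) (by positivity)
            gcongr
          · rw [LinearIsometryEquiv.norm_map]
            exact mul_le_mul (hTle _ hz' θ) hcs (norm_nonneg _) (by positivity)
      _ = (L * C + L * 2 * C * C) * D * ‖θ‖ := by ring
      _ ≤ _ := by
        exact mul_le_mul_of_nonneg_right (mul_le_mul_of_nonneg_right (by linarith) hD.le)
          (norm_nonneg _)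

end Gradient

end ResNet

/-! ### Positive loss forces a negative value of the first variation. -/

namespace ResNet

variable {d k : ℕ} {f : Euc d → Euc k → Euc d} {g y : Euc d → ℝ} {μ : Measure (Euc d)}
  {ρ : ℝ → Measure (Euc k)} {t : ℝ}

/-- Backward uniqueness: Grönwall from time `t` to time `0` for the difference of two states. -/
lemma state_injective (hf : ActivationAssumption f) (hhom : TwoHomogeneous f) (hρ : IsPath ρ)
    (ht : t ∈ Icc (0 : ℝ) 1) : Function.Injective fun x => state f ρ x t := by
  intro x x' hxx
  obtain ⟨M, hM⟩ := hρ.exists_pathLE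
  obtain ⟨r, hr0, hr⟩ := exists_norm_state_le hf hhom (max ‖x‖ ‖x'‖) M
  obtain ⟨L, hL, -, -⟩ := hf.exists_homLip hhom hr0
  obtain ⟨h0, hz⟩ := isState_state hf hhom hρ x
  obtain ⟨h0', hz'⟩ := isState_state hf hhom hρ x'
  have hLM := mul_nonneg hL.nonneg hM.nonneg
  have := norm_le_of_norm_deriv_le (w := fun t => state f ρ x t - state f ρ x' t)
    (K := 4 * L * M + 1) (ε := 0) (by nlinarith) le_rfl
    (fun t ht => (hz t ht).sub (hz' t ht)) (fun t ht => ?_) ht (t := 0) (by simp)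
  · simp only [h0, h0'] at this
    rw [show state f ρ x t = state f ρ x' t from hxx, sub_self, norm_zero, add_zero, zero_mul]
      at this
    exact sub_eq_zero.1 (norm_le_zero_iff.1 this)
  · refine (hL.norm_integral_sub_le (hr ρ hM x (le_max_left _ _) t ht)
      (hr ρ hM x' (le_max_right _ _) t ht) (hM.moment t ht)).trans ?_
    rw [add_zero]
    exact mul_le_mul_of_nonneg_right (by linarith) (norm_nonneg _)

/-- A solution of a linear equation that vanishes at one time vanishes at time `1`; there it is the
residual times a gradient that is never zero. -/
lemma residual_eq_zero_of_costate_eq_zero (hf : ActivationAssumption f) (hhom : TwoHomogeneous f)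
    (hdata : DataAssumption g y μ) (hρ : IsPath ρ) (ht : t ∈ Icc (0 : ℝ) 1) {x : Euc d}
    (hx : costate f g y ρ x t = 0) : g (state f ρ x 1) - y x = 0 := by
  obtain ⟨M, hM⟩ := hρ.exists_pathLE
  obtain ⟨r, hr0, hr⟩ := exists_norm_state_le hf hhom ‖x‖ M
  obtain ⟨L, -, hL, -⟩ := hf.exists_homLip hhom hr0
  have hLM := mul_nonneg hL.nonneg hM.nonneg
  obtain ⟨h1, hp⟩ := isCostate_costate (g := g) (y := y) hf hhom hρ x
  have := norm_le_of_norm_deriv_le (K := L * M + 1) (ε := 0) (by linarith) le_rfl hp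
    (fun t ht => ?_) ht (t := 1) (by simp)
  · rw [hx, norm_zero, add_zero, zero_mul, norm_le_zero_iff, h1, smul_eq_zero] at this
    refine this.resolve_right fun h => ?_
    obtain ⟨c, hc, hcg⟩ := hdata.gradient_lower_bound
    have := hcg (state f ρ x 1)
    rw [h, norm_zero] at this
    linarith
  · rw [norm_neg]
    refine (norm_cofield_le hL (hM.moment t ht) (hr ρ hM x le_rfl t ht) _).trans ?_
    linarith [norm_nonneg (costate f g y ρ x t)]

lemma integral_sq_costate_pos (hf : ActivationAssumption f) (hhom : TwoHomogeneous f)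
    (hdata : DataAssumption g y μ) (hρ : IsPath ρ) (ht : t ∈ Icc (0 : ℝ) 1)
    (hint : Integrable (fun x => ‖costate f g y ρ x t‖ ^ 2) μ) (hloss : loss f g y μ ρ ≠ 0) :
    0 < ∫ x, ‖costate f g y ρ x t‖ ^ 2 ∂μ := by
  refine lt_of_le_of_ne (integral_nonneg fun _ => by positivity) fun h => hloss ?_
  have h0 := (integral_eq_zero_iff_of_nonneg (fun _ => by positivity) hint).1 h.symm
  rw [loss]
  refine lintegral_eq_zero_of_ae_eq_zero ?_
  filter_upwards [h0] with x hx
  have hx' : costate f g y ρ x t = 0 := by simpa using hx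
  simp [residual_eq_zero_of_costate_eq_zero hf hhom hdata hρ ht hx']

/-- If the loss does not vanish, the first variation takes a negative value. -/
lemma exists_firstVariation_neg (hf : ActivationAssumption f) (hhom : TwoHomogeneous f)
    (hdata : DataAssumption g y μ) (hρ : IsPath ρ) (ht : t ∈ Icc (0 : ℝ) 1)
    (hloss : loss f g y μ ρ ≠ 0) : ∃ θ : Euc k, firstVariation f g y μ ρ t θ < 0 := by
  have := hdata.probability
  obtain ⟨R, hR0, hR⟩ := hdata.exists_ae_norm_le
  obtain ⟨M, hM⟩ := hρ.exists_pathLE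
  obtain ⟨C, hC⟩ := exists_trajectoryBounds (k := k) hf hhom hdata R hM.nonneg
  have hC0 := hC.pos
  obtain ⟨L, hL, -, -⟩ := hf.exists_homLip hhom hC0
  have hL0 := hL.nonneg
  have hZc := continuous_state hf hhom hρ ht
  have hpc := continuous_costate (g := g) (y := y) hf hhom hdata hρ ht
  have hZ : ∀ x, ‖x‖ ≤ R → ‖state f ρ x t‖ ≤ C := fun x hx => hC.norm_state_le ρ hM x hx t ht
  have hp : ∀ x, ‖x‖ ≤ R → ‖costate f g y ρ x t‖ ≤ C := fun x hx =>
    hC.norm_costate_le ρ hM x hx t ht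
  have hpint : Integrable (fun x => ‖costate f g y ρ x t‖ ^ 2) μ := by
    refine Integrable.of_bound (hpc.norm.pow 2).aestronglyMeasurable (C ^ 2) ?_
    filter_upwards [hR] with x hx
    rw [Real.norm_of_nonneg (by positivity)]
    exact pow_le_pow_left₀ (norm_nonneg _) (hp x hx) 2
  have hpos := integral_sq_costate_pos hf hhom hdata hρ ht hpint hloss
  set I := ∫ x, ‖costate f g y ρ x t‖ ^ 2 ∂μ
  -- A continuous injection on a compact ball is a closed embedding, so minus the costate, read as a
  -- function of the state, extends by Tietze's theorem to a continuous `φ` on the whole space.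
  have hemb : IsClosedEmbedding fun x : Metric.closedBall (0 : Euc d) R =>
      state f ρ (x : Euc d) t := by
    have : CompactSpace (Metric.closedBall (0 : Euc d) R) :=
      isCompact_iff_compactSpace.1 (isCompact_closedBall _ _)
    exact (hZc.comp continuous_subtype_val).isClosedEmbedding
      ((state_injective hf hhom hρ ht).comp Subtype.val_injective)
  obtain ⟨φ, hφ⟩ := ContinuousMap.exists_extension' hemb
    (⟨fun x => -costate f g y ρ (x : Euc d) t, (hpc.comp continuous_subtype_val).neg⟩ :
      C(Metric.closedBall (0 : Euc d) R, Euc d))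
  have hφ' : ∀ x, ‖x‖ ≤ R → φ (state f ρ x t) = -costate f g y ρ x t := fun x hx =>
    congrFun hφ ⟨x, by simpa using hx⟩
  -- The costate is at most `C`, so a uniform error `I / (2 * C)` changes the averaged inner product
  -- by at most `I / 2`. Radius `C + 1` makes the strict bound on the states automatic.
  obtain ⟨ν, hν, hνφ⟩ := hf.universal_kernel (C + 1) (by positivity) φ φ.continuous
    (I / (2 * C)) (by positivity)
  have hνM := hν.momentLE
  have := hν.1
  have hcont : Continuous (Function.uncurry fun (θ : Euc k) (x : Euc d) =>
      (inner ℝ (costate f g y ρ x t) (f (state f ρ x t) θ) : ℝ)) :=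
    (hpc.comp continuous_snd).inner
      (hf.contDiff.continuous.comp ((hZc.comp continuous_snd).prodMk continuous_fst))
  have hI : Integrable (Function.uncurry fun (θ : Euc k) (x : Euc d) =>
      (inner ℝ (costate f g y ρ x t) (f (state f ρ x t) θ) : ℝ)) (ν.prod μ) := by
    refine Integrable.mono' ((hνM.integrable.comp_fst μ).const_mul (C * L))
      hcont.aestronglyMeasurable ?_
    filter_upwards [Measure.quasiMeasurePreserving_snd.ae hR] with q hq
    refine (norm_inner_le_norm _ _).trans ?_
    rw [mul_assoc]
    exact mul_le_mul (hp _ hq) (hL.norm_le (hZ _ hq) _) (norm_nonneg _) hC0.le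
  have hinner : ∀ᵐ x ∂μ, ∫ θ, inner ℝ (costate f g y ρ x t) (f (state f ρ x t) θ) ∂ν =
      inner ℝ (costate f g y ρ x t) (∫ θ, f (state f ρ x t) θ ∂ν) := by
    filter_upwards [hR] with x hx
    exact integral_inner (hL.integrable (hZ x hx) hνM) _
  -- After Fubini, the exact target `φ` would give `-I`; the approximation costs at most half of it.
  -- A negative average then produces a negative value.
  have hle : ∫ θ, firstVariation f g y μ ρ t θ ∂ν ≤ -I + I / 2 := by
    simp only [firstVariation]
    rw [integral_integral_swap hI, integral_congr_ae hinner]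
    have e : -I + I / 2 = ∫ x, (-(‖costate f g y ρ x t‖ ^ 2) + I / 2) ∂μ := by
      rw [integral_add (f := fun x => -(‖costate f g y ρ x t‖ ^ 2)) hpint.neg
        (integrable_const _), integral_neg]
      simp [I]
    rw [e]
    refine integral_mono_ae (hI.integral_prod_right.congr hinner)
      (hpint.neg.add (integrable_const _)) ?_
    filter_upwards [hR] with x hx
    have h1 := hνφ (state f ρ x t) (by linarith [hZ x hx])
    have h2 : inner ℝ (costate f g y ρ x t) (∫ θ, f (state f ρ x t) θ ∂ν) =
        -(‖costate f g y ρ x t‖ ^ 2) - inner ℝ (costate f g y ρ x t)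
          (φ (state f ρ x t) - ∫ θ, f (state f ρ x t) θ ∂ν) := by
      rw [inner_sub_right, hφ' x hx, inner_neg_right, real_inner_self_eq_norm_sq]
      ring
    have h3 := abs_real_inner_le_norm (costate f g y ρ x t)
      (φ (state f ρ x t) - ∫ θ, f (state f ρ x t) θ ∂ν)
    have h4 := mul_le_mul (hp x hx) h1.le (norm_nonneg _) hC0.le
    have h5 : C * (I / (2 * C)) = I / 2 := by field_simp
    rw [h2]
    linarith [neg_abs_le (inner ℝ (costate f g y ρ x t)
      (φ (state f ρ x t) - ∫ θ, f (state f ρ x t) θ ∂ν) : ℝ)]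
  by_contra! hcon
  have := integral_nonneg (μ := ν) (f := firstVariation f g y μ ρ t) hcon
  linarith

end ResNet

/-! ### Linear transport tested against time-dependent and `C¹` functions. -/

namespace ResNet

variable {k : ℕ}

/-- A curve of measures transported by the time-dependent field `-V`, where `V` is Lipschitz and
homogeneous of degree `1`. -/
structure LinearFlow (V : ℝ → Euc k → Euc k) (ν : ℝ → Measure (Euc k)) (M Λ : ℝ) : Prop where
  moment : ∀ s ≥ 0, MomentLE (ν s) M
  near : ∀ s₀ ≥ 0, ∀ D > 0, ∀ᶠ s in 𝓝[Ici (0 : ℝ)] s₀, Near (ν s) (ν s₀) D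
  pos : 0 < Λ
  lipschitz : ∀ s ≥ 0, ∀ θ θ', ‖V s θ - V s θ'‖ ≤ Λ * ‖θ - θ'‖
  homogeneous : ∀ s (c : ℝ) θ, V s (c • θ) = c • V s θ
  continuous : ∀ s₀ ≥ 0, ∀ D > 0, ∀ᶠ s in 𝓝[Ici (0 : ℝ)] s₀, ∀ θ, ‖V s θ - V s₀ θ‖ ≤ D * ‖θ‖
  equation : ∀ s > 0, ∀ φ : Euc k → ℝ, ContDiff ℝ (⊤ : ℕ∞) φ → HasCompactSupport φ →
    HasDerivAt (fun s' => ∫ θ, φ θ ∂(ν s')) (-∫ θ, fderiv ℝ φ θ (V s θ) ∂(ν s)) s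

lemma inner_gradient_left (φ : Euc k → ℝ) (θ v : Euc k) :
    inner ℝ (gradient φ θ) v = fderiv ℝ φ θ v := by
  rw [gradient, InnerProductSpace.toDual_symm_apply]

/-- Uniformity in `θ` comes from compactness of the ball outside which all the functions vanish. -/
lemma eventually_forall_abs_sub_le {H : ℝ → Euc k → ℝ} (hc : Continuous (Function.uncurry H))
    {I : Set ℝ} {R : ℝ} (hs : ∀ s ∈ I, ∀ θ, R < ‖θ‖ → H s θ = 0) {s₀ : ℝ} (hs₀ : s₀ ∈ I) {ε : ℝ}
    (hε : 0 < ε) : ∀ᶠ s in 𝓝[I] s₀, ∀ θ, |H s θ - H s₀ θ| ≤ ε := by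
  have key : ∀ᶠ s in 𝓝 s₀, ∀ θ ∈ Metric.closedBall (0 : Euc k) R, |H s θ - H s₀ θ| ≤ ε := by
    refine (isCompact_closedBall (0 : Euc k) R).eventually_forall_of_forall_eventually
      (P := fun s θ => |H s θ - H s₀ θ| ≤ ε) fun θ _ => ?_
    have hcont : Continuous fun z : ℝ × Euc k => |H z.1 z.2 - H s₀ z.2| :=
      (hc.sub (hc.comp (continuous_const.prodMk continuous_snd))).abs
    have := hcont.tendsto (s₀, θ)
    simp only [sub_self, abs_zero] at this
    exact (this.eventually (gt_mem_nhds hε)).mono fun _ h => le_of_lt h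
  filter_upwards [nhdsWithin_le_nhds key, self_mem_nhdsWithin] with s h1 h2 θ
  rcases le_or_gt ‖θ‖ R with h | h
  · exact h1 θ (by simpa using h)
  · rw [hs s h2 θ h, hs s₀ hs₀ θ h, sub_self, abs_zero]
    exact hε.le

lemma hasCompactSupport_of_norm_gt {F : Type*} [Zero F] {φ : Euc k → F} {R : ℝ}
    (h : ∀ θ, R < ‖θ‖ → φ θ = 0) : HasCompactSupport φ :=
  HasCompactSupport.intro (isCompact_closedBall (0 : Euc k) R) fun θ hθ => h θ (by
    simpa using hθ)

lemma MomentLE.integrable_of_hasCompactSupport {ν : Measure (Euc k)} {M : ℝ} (h : MomentLE ν M)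
    {φ : Euc k → ℝ} (hc : Continuous φ) (hs : HasCompactSupport φ) : Integrable φ ν := by
  have := h.prob
  exact hc.integrable_of_hasCompactSupport hs

namespace LinearFlow

variable {V : ℝ → Euc k → Euc k} {ν : ℝ → Measure (Euc k)} {M Λ : ℝ}

lemma zero (h : LinearFlow V ν M Λ) (s : ℝ) : V s 0 = 0 := by
  simpa using h.homogeneous s 0 0

lemma norm_le (h : LinearFlow V ν M Λ) {s : ℝ} (hs : 0 ≤ s) (θ : Euc k) :
    ‖V s θ‖ ≤ Λ * ‖θ‖ := by
  simpa [h.zero] using h.lipschitz s hs θ 0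

lemma continuous_right (h : LinearFlow V ν M Λ) {s : ℝ} (hs : 0 ≤ s) : Continuous (V s) :=
  (LipschitzWith.of_dist_le_mul (K := Λ.toNNReal) fun θ θ' => by
    rw [dist_eq_norm, dist_eq_norm, Real.coe_toNNReal _ h.pos.le]
    exact h.lipschitz s hs θ θ').continuous

lemma tendsto_integral (h : LinearFlow V ν M Λ) {G : Euc k → ℝ} {K : ℝ≥0}
    (hG : LipschitzWith K G) {s₀ : ℝ} (hs₀ : 0 ≤ s₀) :
    Tendsto (fun s => ∫ θ, G θ ∂(ν s)) (𝓝[Ici 0] s₀) (𝓝 (∫ θ, G θ ∂(ν s₀))) := by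
  refine tendsto_integral_of_near (eventually_nhdsWithin_of_forall h.moment) (h.moment s₀ hs₀)
    (h.near s₀ hs₀) K.2 fun θ θ' => ?_
  have h1 := hG.dist_le_mul θ θ'
  rw [dist_eq_norm, dist_eq_norm] at h1
  refine h1.trans (mul_le_mul_of_nonneg_left ?_ K.2)
  nlinarith [norm_nonneg θ, norm_nonneg θ', norm_nonneg (θ - θ'),
    mul_nonneg (norm_nonneg θ) (norm_nonneg (θ - θ')),
    mul_nonneg (norm_nonneg θ') (norm_nonneg (θ - θ'))]

lemma tendsto_integral_of_contDiff (h : LinearFlow V ν M Λ) {G : Euc k → ℝ} (hG : ContDiff ℝ 1 G)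
    (hs : HasCompactSupport G) {s₀ : ℝ} (hs₀ : 0 ≤ s₀) :
    Tendsto (fun s => ∫ θ, G θ ∂(ν s)) (𝓝[Ici 0] s₀) (𝓝 (∫ θ, G θ ∂(ν s₀))) := by
  obtain ⟨K, hK⟩ := ContDiff.lipschitzWith_of_hasCompactSupport hs hG one_ne_zero
  exact h.tendsto_integral hK hs₀

lemma integrable_fderiv_apply (h : LinearFlow V ν M Λ) {φ : Euc k → ℝ} (hφ : ContDiff ℝ 1 φ)
    (hs : HasCompactSupport φ) {s : ℝ} (hs0 : 0 ≤ s) :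
    Integrable (fun θ => fderiv ℝ φ θ (V s θ)) (ν s) := by
  have hc : Continuous fun θ => fderiv ℝ φ θ (V s θ) :=
    (hφ.continuous_fderiv one_ne_zero).clm_apply (h.continuous_right hs0)
  refine (h.moment s hs0).integrable_of_hasCompactSupport hc ?_
  refine (hs.fderiv ℝ).mono fun θ hθ => ?_
  contrapose! hθ
  simp only [Function.mem_support, not_not] at hθ ⊢
  rw [hθ]; rfl

section TimeDependent

variable {ψ ψ' : ℝ → Euc k → ℝ} {a b R : ℝ}

lemma integral_timeDependent_continuousOn (h : LinearFlow V ν M Λ) (ha : 0 ≤ a)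
    (hψ : Continuous (Function.uncurry ψ))
    (hsupp : ∀ s ∈ Icc a b, ∀ θ, R < ‖θ‖ → ψ s θ = 0)
    (hsmooth : ∀ s ∈ Icc a b, ContDiff ℝ (⊤ : ℕ∞) (ψ s)) :
    ContinuousOn (fun s => ∫ θ, ψ s θ ∂(ν s)) (Icc a b) := by
  intro s₀ hs₀
  have hsub : Icc a b ⊆ Ici 0 := fun s hs => ha.trans hs.1
  have hcs : ∀ s ∈ Icc a b, HasCompactSupport (ψ s) := fun s hs =>
    hasCompactSupport_of_norm_gt (hsupp s hs)
  have h2 := (h.tendsto_integral_of_contDiff ((hsmooth s₀ hs₀).of_le (mod_cast le_top))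
    (hcs s₀ hs₀) (hsub hs₀)).mono_left (nhdsWithin_mono _ hsub)
  rw [ContinuousWithinAt, Metric.tendsto_nhds]
  intro ε hε
  filter_upwards [eventually_forall_abs_sub_le hψ hsupp hs₀ (half_pos hε), self_mem_nhdsWithin,
    Metric.tendsto_nhds.1 h2 _ (half_pos hε)] with s h3 hs h4
  have hm := h.moment s (hsub hs)
  have := hm.prob
  have i1 := hm.integrable_of_hasCompactSupport (hsmooth s hs).continuous (hcs s hs)
  have i2 := hm.integrable_of_hasCompactSupport (hsmooth s₀ hs₀).continuous (hcs s₀ hs₀)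
  have h5 : ‖∫ θ, ψ s θ ∂(ν s) - ∫ θ, ψ s₀ θ ∂(ν s)‖ ≤ ε / 2 := by
    rw [← integral_sub i1 i2]
    exact norm_integral_le_of_ae_le (Eventually.of_forall h3)
  rw [← dist_eq_norm] at h5
  linarith [dist_triangle (∫ θ, ψ s θ ∂(ν s)) (∫ θ, ψ s₀ θ ∂(ν s)) (∫ θ, ψ s₀ θ ∂(ν s₀))]

/-- The time dependence is split into the variation of the test function, integrated against the
moving measure, and the variation of the measure against the frozen test function, which is the
transport equation. -/
lemma hasDerivAt_integral_timeDependent (h : LinearFlow V ν M Λ) (ha : 0 ≤ a)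
    (hψ' : Continuous (Function.uncurry ψ'))
    (hsupp : ∀ s ∈ Icc a b, ∀ θ, R < ‖θ‖ → ψ s θ = 0)
    (hsupp' : ∀ s ∈ Icc a b, ∀ θ, R < ‖θ‖ → ψ' s θ = 0)
    (hsmooth : ∀ s ∈ Icc a b, ContDiff ℝ (⊤ : ℕ∞) (ψ s))
    (hsmooth' : ∀ s ∈ Icc a b, ContDiff ℝ 1 (ψ' s))
    (hderiv : ∀ s ∈ Ioo a b, ∀ θ, HasDerivAt (fun s => ψ s θ) (ψ' s θ) s) {s₀ : ℝ}
    (hs₀ : s₀ ∈ Ioo a b) :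
    HasDerivAt (fun s => ∫ θ, ψ s θ ∂(ν s))
      (∫ θ, ψ' s₀ θ ∂(ν s₀) - ∫ θ, fderiv ℝ (ψ s₀) θ (V s₀ θ) ∂(ν s₀)) s₀ := by
  have hs₀' := Ioo_subset_Icc_self hs₀
  have hs₀pos : 0 < s₀ := ha.trans_lt hs₀.1
  have hcs : ∀ s ∈ Icc a b, HasCompactSupport (ψ s) := fun s hs =>
    hasCompactSupport_of_norm_gt (hsupp s hs)
  have hcs' : HasCompactSupport (ψ' s₀) := hasCompactSupport_of_norm_gt (hsupp' s₀ hs₀')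
  have hint : ∀ s ∈ Icc a b, ∀ s' ∈ Icc a b, Integrable (ψ s) (ν s') := fun s hs s' hs' =>
    (h.moment s' (ha.trans hs'.1)).integrable_of_hasCompactSupport (hsmooth s hs).continuous
      (hcs s hs)
  have hint' : ∀ s' ∈ Icc a b, Integrable (ψ' s₀) (ν s') := fun s' hs' =>
    (h.moment s' (ha.trans hs'.1)).integrable_of_hasCompactSupport
      (hsmooth' s₀ hs₀').continuous hcs'
  have hD2 := h.equation s₀ hs₀pos (ψ s₀) (hsmooth s₀ hs₀') (hcs s₀ hs₀')
  -- The mean value inequality, uniform in `θ`, replaces the difference by `(s - s₀) ψ' s₀`; weak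
  -- continuity of `ν` then allows the measure to be frozen at `s₀`.
  have hD1 : HasDerivAt (fun s => ∫ θ, (ψ s θ - ψ s₀ θ) ∂(ν s)) (∫ θ, ψ' s₀ θ ∂(ν s₀)) s₀ := by
    rw [hasDerivAt_iff_isLittleO, Asymptotics.isLittleO_iff]
    intro c hc
    have hIoo : Ioo a b ∈ 𝓝 s₀ := Ioo_mem_nhds hs₀.1 hs₀.2
    have hw : ∀ᶠ s in 𝓝 s₀, |∫ θ, ψ' s₀ θ ∂(ν s) - ∫ θ, ψ' s₀ θ ∂(ν s₀)| ≤ c / 2 := by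
      have h1 := h.tendsto_integral_of_contDiff (hsmooth' s₀ hs₀') hcs' hs₀pos.le
      rw [nhdsWithin_eq_nhds.2 (Ici_mem_nhds hs₀pos)] at h1
      filter_upwards [Metric.tendsto_nhds.1 h1 _ (half_pos hc)] with s hs
      rw [Real.dist_eq] at hs
      exact hs.le
    have hu : ∀ᶠ s in 𝓝 s₀, ∀ θ, |ψ' s θ - ψ' s₀ θ| ≤ c / 2 := by
      have h1 := eventually_forall_abs_sub_le hψ' hsupp' hs₀' (half_pos hc)
      rwa [nhdsWithin_eq_nhds.2 (Icc_mem_nhds hs₀.1 hs₀.2)] at h1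
    obtain ⟨δ, hδ, hball⟩ := Metric.eventually_nhds_iff_ball.1 (hu.and hIoo)
    filter_upwards [hw, Metric.ball_mem_nhds s₀ hδ] with s h1 h2
    have hsI := Ioo_subset_Icc_self (hball s h2).2
    have := (h.moment s (ha.trans hsI.1)).prob
    have hmv : ∀ θ, ‖ψ s θ - ψ s₀ θ - (s - s₀) * ψ' s₀ θ‖ ≤ c / 2 * ‖s - s₀‖ := fun θ => by
      have := Convex.norm_image_sub_le_of_norm_hasDerivWithin_le
        (f := fun s => ψ s θ - s * ψ' s₀ θ) (f' := fun s => ψ' s θ - 1 * ψ' s₀ θ)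
        (s := Metric.ball s₀ δ) (C := c / 2)
        (fun x hx => ((hderiv x (hball x hx).2 θ).sub
          ((hasDerivAt_id x).mul_const (ψ' s₀ θ))).hasDerivWithinAt)
        (fun x hx => by simpa using (hball x hx).1 θ) (convex_ball s₀ δ)
        (Metric.mem_ball_self hδ) h2
      have e : ψ s θ - ψ s₀ θ - (s - s₀) * ψ' s₀ θ =
          ψ s θ - s * ψ' s₀ θ - (ψ s₀ θ - s₀ * ψ' s₀ θ) := by ring
      rw [e]
      exact this
    have e : (∫ θ, (ψ s θ - ψ s₀ θ) ∂(ν s)) - (∫ θ, (ψ s₀ θ - ψ s₀ θ) ∂(ν s₀)) -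
        (s - s₀) • ∫ θ, ψ' s₀ θ ∂(ν s₀) =
        (∫ θ, (ψ s θ - ψ s₀ θ - (s - s₀) * ψ' s₀ θ) ∂(ν s)) +
        (s - s₀) * (∫ θ, ψ' s₀ θ ∂(ν s) - ∫ θ, ψ' s₀ θ ∂(ν s₀)) := by
      rw [integral_sub (f := fun θ => ψ s θ - ψ s₀ θ)
        ((hint s hsI s hsI).sub (hint s₀ hs₀' s hsI)) ((hint' s hsI).const_mul _),
        integral_const_mul]
      simp only [sub_self, integral_zero, smul_eq_mul]
      ring
    rw [e]
    refine (norm_add_le _ _).trans ?_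
    have b1 := norm_integral_le_of_ae_le (μ := ν s) (Eventually.of_forall hmv)
    have b2 : ‖(s - s₀) * (∫ θ, ψ' s₀ θ ∂(ν s) - ∫ θ, ψ' s₀ θ ∂(ν s₀))‖ ≤
        ‖s - s₀‖ * (c / 2) := by
      rw [norm_mul]
      exact mul_le_mul_of_nonneg_left h1 (norm_nonneg _)
    linarith
  have hsum := hD1.add hD2
  rw [← sub_eq_add_neg] at hsum
  refine hsum.congr_of_eventuallyEq ?_
  filter_upwards [Ioo_mem_nhds hs₀.1 hs₀.2] with s hs
  have hsI := Ioo_subset_Icc_self hs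
  simp only [Pi.add_apply]
  rw [integral_sub (hint s hsI s hsI) (hint s₀ hs₀' s hsI)]
  ring

/-- Integrals of a subsolution of the transport equation are nondecreasing in time. -/
lemma integral_le_integral_of_subsolution (h : LinearFlow V ν M Λ) (ha : 0 ≤ a) (hab : a ≤ b)
    (hψ : Continuous (Function.uncurry ψ)) (hψ' : Continuous (Function.uncurry ψ'))
    (hsupp : ∀ s ∈ Icc a b, ∀ θ, R < ‖θ‖ → ψ s θ = 0)
    (hsupp' : ∀ s ∈ Icc a b, ∀ θ, R < ‖θ‖ → ψ' s θ = 0)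
    (hsmooth : ∀ s ∈ Icc a b, ContDiff ℝ (⊤ : ℕ∞) (ψ s))
    (hsmooth' : ∀ s ∈ Icc a b, ContDiff ℝ 1 (ψ' s))
    (hderiv : ∀ s ∈ Ioo a b, ∀ θ, HasDerivAt (fun s => ψ s θ) (ψ' s θ) s)
    (hsub : ∀ s ∈ Ioo a b, ∀ θ, fderiv ℝ (ψ s) θ (V s θ) ≤ ψ' s θ) :
    ∫ θ, ψ a θ ∂(ν a) ≤ ∫ θ, ψ b θ ∂(ν b) := by
  have hd := fun s (hs : s ∈ Ioo a b) => h.hasDerivAt_integral_timeDependent ha hψ' hsupp hsupp'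
    hsmooth hsmooth' hderiv hs
  refine monotoneOn_of_deriv_nonneg (convex_Icc a b)
    (h.integral_timeDependent_continuousOn ha hψ hsupp hsmooth) ?_ ?_ (left_mem_Icc.2 hab)
    (right_mem_Icc.2 hab) hab
  · rw [interior_Icc]
    exact fun s hs => (hd s hs).differentiableAt.differentiableWithinAt
  · rw [interior_Icc]
    intro s hs
    have hsI := Ioo_subset_Icc_self hs
    have hs0 : 0 ≤ s := ha.trans hsI.1
    rw [(hd s hs).deriv, sub_nonneg]
    refine integral_mono (h.integrable_fderiv_apply ((hsmooth s hsI).of_le (mod_cast le_top))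
      (hasCompactSupport_of_norm_gt (hsupp s hsI)) hs0) ?_ (hsub s hs)
    exact (h.moment s hs0).integrable_of_hasCompactSupport (hsmooth' s hsI).continuous
      (hasCompactSupport_of_norm_gt (hsupp' s hsI))

end TimeDependent

end LinearFlow

/-- Mollification: `C¹` functions with compact support are limits of smooth ones, together with
their derivatives. -/
lemma exists_smooth_approx {ψ : Euc k → ℝ} (hψ : ContDiff ℝ 1 ψ) (hs : HasCompactSupport ψ)
    {ε : ℝ} (hε : 0 < ε) : ∃ φ : Euc k → ℝ, ContDiff ℝ (⊤ : ℕ∞) φ ∧ HasCompactSupport φ ∧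
      (∀ θ, |φ θ - ψ θ| ≤ ε) ∧ ∀ θ, ‖fderiv ℝ φ θ - fderiv ℝ ψ θ‖ ≤ ε := by
  have u1 := hs.uniformContinuous_of_continuous hψ.continuous
  have u2 := (hs.fderiv ℝ).uniformContinuous_of_continuous (hψ.continuous_fderiv one_ne_zero)
  obtain ⟨δ₁, hδ₁, h1⟩ := Metric.uniformContinuous_iff.1 u1 ε hε
  obtain ⟨δ₂, hδ₂, h2⟩ := Metric.uniformContinuous_iff.1 u2 ε hε
  have hδ : 0 < min δ₁ δ₂ := lt_min hδ₁ hδ₂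
  let χ : ContDiffBump (0 : Euc k) := ⟨min δ₁ δ₂ / 2, min δ₁ δ₂, half_pos hδ, half_lt_self hδ⟩
  have hχ : χ.rOut = min δ₁ δ₂ := rfl
  refine ⟨convolution (χ.normed volume) ψ (ContinuousLinearMap.lsmul ℝ ℝ) volume, ?_, ?_, ?_, ?_⟩
  · exact χ.hasCompactSupport_normed.contDiff_convolution_left _ χ.contDiff_normed
      hψ.continuous.locallyIntegrable
  · exact HasCompactSupport.convolution _ χ.hasCompactSupport_normed hs
  · intro θ
    rw [← Real.dist_eq]
    refine χ.dist_normed_convolution_le hψ.continuous.aestronglyMeasurable fun x hx => (h1 ?_).le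
    rw [hχ] at hx
    exact lt_of_lt_of_le hx (min_le_left _ _)
  · intro θ
    have hd := hs.hasFDerivAt_convolution_right (ContinuousLinearMap.lsmul ℝ ℝ)
      (χ.continuous_normed (μ := volume)).locallyIntegrable hψ θ (μ := volume)
    rw [hd.fderiv]
    have e : convolution (χ.normed volume) (fderiv ℝ ψ)
        ((ContinuousLinearMap.lsmul ℝ ℝ).precompR (Euc k)) volume =
        convolution (χ.normed volume) (fderiv ℝ ψ) (ContinuousLinearMap.lsmul ℝ ℝ) volume := rfl
    rw [e, ← dist_eq_norm]
    refine χ.dist_normed_convolution_le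
      (hψ.continuous_fderiv one_ne_zero).aestronglyMeasurable fun x hx => (h2 ?_).le
    rw [hχ] at hx
    exact lt_of_lt_of_le hx (min_le_right _ _)

namespace LinearFlow

variable {V : ℝ → Euc k → Euc k} {ν : ℝ → Measure (Euc k)} {M Λ : ℝ}

/-- Growth of the integral of a `C¹` test function along the flow. -/
lemma mul_sub_le_integral_sub (h : LinearFlow V ν M Λ) {ψ : Euc k → ℝ} (hψ : ContDiff ℝ 1 ψ)
    (hs : HasCompactSupport ψ) {a b c : ℝ} (ha : 0 ≤ a) (hab : a ≤ b)
    (hc : ∀ s ∈ Ioo a b, c ≤ -∫ θ, fderiv ℝ ψ θ (V s θ) ∂(ν s)) :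
    c * (b - a) ≤ ∫ θ, ψ θ ∂(ν b) - ∫ θ, ψ θ ∂(ν a) := by
  have hM := (h.moment 0 le_rfl).nonneg
  have hΛ := h.pos
  -- The equation is known only for smooth test functions. Mollification costs `ε` at each endpoint
  -- and `ε Λ (M + 1)` per unit time, since the field grows at most linearly.
  have key : ∀ ε > 0, c * (b - a) - ε * (Λ * (M + 1) * (b - a) + 2) ≤
      ∫ θ, ψ θ ∂(ν b) - ∫ θ, ψ θ ∂(ν a) := by
    intro ε hε
    obtain ⟨φ, hφ, hφs, hφ1, hφ2⟩ := exists_smooth_approx hψ hs hε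
    have hφ' : ContDiff ℝ 1 φ := hφ.of_le (mod_cast le_top)
    have hcl : ∀ s ≥ 0, |∫ θ, φ θ ∂(ν s) - ∫ θ, ψ θ ∂(ν s)| ≤ ε := fun s hs0 => by
      have hm := h.moment s hs0
      have := hm.prob
      rw [← integral_sub (hm.integrable_of_hasCompactSupport hφ.continuous hφs)
        (hm.integrable_of_hasCompactSupport hψ.continuous hs)]
      exact norm_integral_le_of_ae_le (G := fun θ => φ θ - ψ θ) (Eventually.of_forall hφ1)
    have hcont : ContinuousOn (fun s => ∫ θ, φ θ ∂(ν s)) (Icc a b) := fun s hs' =>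
      (h.tendsto_integral_of_contDiff hφ' hφs (ha.trans hs'.1)).mono_left
        (nhdsWithin_mono _ fun x hx => ha.trans hx.1)
    have hder := fun s (hs' : s ∈ Ioo a b) => h.equation s (ha.trans_lt hs'.1) φ hφ hφs
    have hmv := (convex_Icc a b).mul_sub_le_image_sub_of_le_deriv hcont
      (C := c - ε * (Λ * (M + 1))) (by
        rw [interior_Icc]
        exact fun s hs' => (hder s hs').differentiableAt.differentiableWithinAt) (by
        rw [interior_Icc]
        intro s hs'
        have hs0 : 0 ≤ s := ha.trans hs'.1.le
        have i1 := h.integrable_fderiv_apply hφ' hφs hs0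
        have i2 := h.integrable_fderiv_apply hψ hs hs0
        rw [(hder s hs').deriv]
        have hd : ‖∫ θ, fderiv ℝ φ θ (V s θ) ∂(ν s) - ∫ θ, fderiv ℝ ψ θ (V s θ) ∂(ν s)‖ ≤
            ε * Λ * M + ε * Λ := by
          rw [← integral_sub i1 i2]
          refine (h.moment s hs0).norm_integral_le (by positivity) fun θ => ?_
          rw [← _root_.sub_apply]
          refine (ContinuousLinearMap.le_opNorm _ _).trans ?_
          calc _ ≤ ε * (Λ * ‖θ‖) := mul_le_mul (hφ2 θ) (h.norm_le hs0 θ) (norm_nonneg _) hε.le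
            _ ≤ ε * (Λ * (‖θ‖ ^ 2 + 1)) := by
              gcongr
              nlinarith [sq_nonneg (‖θ‖ - 1), norm_nonneg θ]
            _ = _ := by ring
        have := hc s hs'
        rw [Real.norm_eq_abs, abs_le] at hd
        linarith [hd.2]) a (left_mem_Icc.2 hab) b (right_mem_Icc.2 hab) hab
    have c1 := abs_le.1 (hcl a ha)
    have c2 := abs_le.1 (hcl b (ha.trans hab))
    linarith [c1.1, c2.2]
  have hlim : Tendsto (fun ε : ℝ => c * (b - a) - ε * (Λ * (M + 1) * (b - a) + 2)) (𝓝[>] 0)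
      (𝓝 (c * (b - a))) := by
    have : Continuous fun ε : ℝ => c * (b - a) - ε * (Λ * (M + 1) * (b - a) + 2) := by fun_prop
    simpa using (this.tendsto 0).mono_left nhdsWithin_le_nhds
  exact le_of_tendsto hlim (eventually_nhdsWithin_of_forall key)

end LinearFlow

end ResNet

/-! ### Persistence of mass along trajectories, and the separation hypothesis. -/

namespace ResNet

variable {k : ℕ} {V : ℝ → Euc k → Euc k} {ν : ℝ → Measure (Euc k)} {M Λ S : ℝ}

lemma deriv_smoothTransition_of_nonpos {x : ℝ} (hx : x ≤ 0) : deriv Real.smoothTransition x = 0 :=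
  IsLocalMin.deriv_eq_zero (Eventually.of_forall fun z => by
    rw [Real.smoothTransition.zero_of_nonpos hx]
    exact Real.smoothTransition.nonneg z)

lemma hasDerivAt_smoothTransition (x : ℝ) :
    HasDerivAt Real.smoothTransition (deriv Real.smoothTransition x) x :=
  ((Real.smoothTransition.contDiff (n := 1)).differentiable (by simp) x).hasDerivAt

lemma contDiff_deriv_smoothTransition : ContDiff ℝ 1 (deriv Real.smoothTransition) := by
  have h : ContDiff ℝ (1 + 1) Real.smoothTransition := by
    rw [one_add_one_eq_two]; exact Real.smoothTransition.contDiff (n := 2)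
  exact (contDiff_succ_iff_deriv.1 h).2.2

lemma hasFDerivAt_norm_sub_sq (a θ : Euc k) :
    HasFDerivAt (fun θ => ‖θ - a‖ ^ 2) ((2 : ℝ) • innerSL ℝ (θ - a)) θ := by
  refine ((hasFDerivAt_id θ).sub_const a).norm_sq.congr_fderiv (ContinuousLinearMap.ext fun v => ?_)
  simp [two_smul]

namespace LinearFlow

lemma continuousOn_comp (h : LinearFlow V ν M Λ) {γ : ℝ → Euc k}
    (hγ : ContinuousOn γ (Icc 0 S)) : ContinuousOn (fun s => V s (γ s)) (Icc 0 S) := by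
  intro s₀ hs₀
  have hΛ := h.pos
  rw [ContinuousWithinAt, Metric.tendsto_nhds]
  intro ε hε
  have h1 := (h.continuous s₀ hs₀.1 (ε / (2 * (‖γ s₀‖ + 1))) (by positivity)).filter_mono
    (nhdsWithin_mono s₀ (fun x (hx : x ∈ Icc 0 S) => hx.1))
  have h2 := Metric.tendsto_nhds.1 (hγ s₀ hs₀) (ε / (2 * Λ)) (by positivity)
  filter_upwards [h1, h2, self_mem_nhdsWithin] with s h1 h2 hs
  rw [dist_eq_norm] at h2 ⊢
  have a1 := h.lipschitz s hs.1 (γ s) (γ s₀)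
  have a2 := h1 (γ s₀)
  have a3 : Λ * ‖γ s - γ s₀‖ < ε / 2 := by
    calc _ < Λ * (ε / (2 * Λ)) := mul_lt_mul_of_pos_left h2 hΛ
      _ = ε / 2 := by field_simp
  have a4 : ε / (2 * (‖γ s₀‖ + 1)) * ‖γ s₀‖ ≤ ε / 2 := by
    rw [div_mul_eq_mul_div, div_le_iff₀ (by positivity)]
    nlinarith [norm_nonneg (γ s₀)]
  linarith [norm_sub_le_norm_sub_add_norm_sub (V s (γ s)) (V s (γ s₀)) (V s₀ (γ s₀))]

/-- Trajectories of the flow with prescribed final position. -/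
lemma exists_trajectory (h : LinearFlow V ν M Λ) (hS : 0 ≤ S) (θ : Euc k) :
    ∃ γ : ℝ → Euc k, γ S = θ ∧
      ∀ s ∈ Icc 0 S, HasDerivWithinAt γ (-V s (γ s)) (Icc 0 S) s := by
  have hΛ := h.pos
  refine exists_ode_solution (F := fun s θ => -V s θ) (C := Λ) (fun s hs x => ?_)
    (fun R _ => ⟨Λ, fun s hs x y _ _ => ?_⟩)
    (fun x => (h.continuousOn_comp continuousOn_const).neg) (right_mem_Icc.2 hS) θ
  · rw [norm_neg]
    refine (h.norm_le hs.1 x).trans ?_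
    gcongr
    linarith
  · rw [← neg_sub', norm_neg]
    exact h.lipschitz s hs.1 x y

/-- Mass near a point of the support is transported along the trajectory of that point. -/
lemma measure_ball_pos (h : LinearFlow V ν M Λ) (hS : 0 ≤ S) {γ : ℝ → Euc k}
    (hγ : ∀ s ∈ Icc 0 S, HasDerivWithinAt γ (-V s (γ s)) (Icc 0 S) s)
    (hγ0 : γ 0 ∈ (ν 0).support) {r : ℝ} (hr : 0 < r) : 0 < ν S (Metric.ball (γ S) r) := by
  have hΛ := h.pos
  have hγc : ContinuousOn γ (Icc 0 S) := fun s hs => (hγ s hs).continuousWithinAt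
  obtain ⟨Γ, hΓ⟩ := isCompact_Icc.exists_bound_of_continuousOn hγc
  -- The trajectory and its velocity are extended continuously to all times, because the subsolution
  -- lemma asks for joint continuity everywhere.
  obtain ⟨γ', hγ'c, hγ'⟩ : ∃ γ' : ℝ → Euc k, Continuous γ' ∧ ∀ s ∈ Icc 0 S, γ' s = γ s :=
    ⟨IccExtend hS ((Icc 0 S).domRestrict γ), hγc.domRestrict.Icc_extend',
      fun s hs => IccExtend_of_mem _ _ hs⟩
  obtain ⟨B, hBc, hB⟩ : ∃ B : ℝ → Euc k, Continuous B ∧ ∀ s ∈ Icc 0 S, B s = V s (γ s) :=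
    ⟨IccExtend hS ((Icc 0 S).domRestrict fun s => V s (γ s)),
      (h.continuousOn_comp hγc).domRestrict.Icc_extend', fun s hs => IccExtend_of_mem _ _ hs⟩
  -- Chosen so that `w s θ < 2 * c` implies `‖θ - γ s‖ < r` for every `s ≤ S`.
  set c : ℝ := r ^ 2 * Real.exp (-2 * Λ * S) / 2 with hc
  have hc0 : 0 < c := by positivity
  -- The squared distance to the trajectory grows at most at rate `2 Λ` along the flow, so the
  -- weighted quantity `w` does not increase; a nonincreasing function of it is a subsolution.
  set w : ℝ → Euc k → ℝ := fun s θ => Real.exp (-2 * Λ * s) * ‖θ - γ' s‖ ^ 2 with hw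
  set w' : ℝ → Euc k → ℝ := fun s θ => Real.exp (-2 * Λ * s) * (-2 * Λ) * ‖θ - γ' s‖ ^ 2 +
    Real.exp (-2 * Λ * s) * (2 * inner ℝ (θ - γ' s) (B s)) with hw'
  set ψ : ℝ → Euc k → ℝ := fun s θ => Real.smoothTransition (2 - w s θ / c) with hψ
  set ψ' : ℝ → Euc k → ℝ := fun s θ =>
    deriv Real.smoothTransition (2 - w s θ / c) * -(w' s θ / c) with hψ'
  have hwc : Continuous (Function.uncurry w) := by
    simp only [hw, Function.uncurry_def]; fun_prop
  have hw'c : Continuous (Function.uncurry w') := by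
    simp only [hw', Function.uncurry_def]; fun_prop
  have hneg : ∀ s ∈ Icc 0 S, ∀ θ, r ≤ ‖θ - γ s‖ → 2 - w s θ / c ≤ 0 := by
    intro s hs θ hθ
    rw [sub_nonpos, le_div_iff₀ hc0]
    simp only [hw, hγ' s hs]
    calc 2 * c = Real.exp (-2 * Λ * S) * r ^ 2 := by rw [hc]; ring
      _ ≤ _ := by
        refine mul_le_mul (Real.exp_le_exp.2 ?_) (pow_le_pow_left₀ hr.le hθ 2) (by positivity)
          (by positivity)
        nlinarith [hs.2]
  have hfar : ∀ s ∈ Icc 0 S, ∀ θ, Γ + r < ‖θ‖ → 2 - w s θ / c ≤ 0 := by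
    intro s hs θ hθ
    refine hneg s hs θ ?_
    linarith [hΓ s hs, norm_le_norm_add_norm_sub' θ (γ s)]
  have hwsm : ∀ s, ContDiff ℝ (⊤ : ℕ∞) (fun θ => 2 - w s θ / c) := fun s =>
    contDiff_const.sub ((contDiff_const.mul ((contDiff_id.sub contDiff_const).norm_sq ℝ)).div_const
      _)
  have hw'sm : ∀ s, ContDiff ℝ 1 (w' s) := fun s =>
    (contDiff_const.mul ((contDiff_id.sub contDiff_const).norm_sq ℝ)).add
      (contDiff_const.mul (contDiff_const.mul
        ((contDiff_id.sub contDiff_const).inner ℝ contDiff_const)))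
  have hψsm : ∀ s, ContDiff ℝ (⊤ : ℕ∞) (ψ s) := fun s =>
    Real.smoothTransition.contDiff.comp (hwsm s)
  have hmono := h.integral_le_integral_of_subsolution (ψ := ψ) (ψ' := ψ') (R := Γ + r) le_rfl hS
    (Real.smoothTransition.continuous.comp (continuous_const.sub (hwc.div_const c)))
    ((contDiff_deriv_smoothTransition.continuous.comp
      (continuous_const.sub (hwc.div_const c))).mul (hw'c.div_const c).neg)
    (fun s hs θ hθ => Real.smoothTransition.zero_of_nonpos (hfar s hs θ hθ))
    (fun s hs θ hθ => by
      simp only [hψ', deriv_smoothTransition_of_nonpos (hfar s hs θ hθ), zero_mul])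
    (fun s _ => hψsm s)
    (fun s _ => (contDiff_deriv_smoothTransition.comp ((hwsm s).of_le (mod_cast le_top))).mul
      ((hw'sm s).div_const c).neg)
    (fun s hs θ => by
      have hsI := Ioo_subset_Icc_self hs
      have hnhds : Icc 0 S ∈ 𝓝 s := Icc_mem_nhds hs.1 hs.2
      have d1 : HasDerivAt γ' (-V s (γ s)) s :=
        ((hγ s hsI).hasDerivAt hnhds).congr_of_eventuallyEq
          (Filter.eventually_of_mem hnhds hγ')
      have d2 : HasDerivAt (fun s => ‖θ - γ' s‖ ^ 2) (2 * inner ℝ (θ - γ' s) (B s)) s := by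
        have := (d1.const_sub θ).norm_sq
        rw [neg_neg, ← hB s hsI] at this
        exact this
      have d3 : HasDerivAt (fun s => Real.exp (-2 * Λ * s))
          (Real.exp (-2 * Λ * s) * (-2 * Λ)) s := by
        simpa using ((hasDerivAt_id s).const_mul (-2 * Λ)).exp
      have d4 : HasDerivAt (fun s => w s θ) (w' s θ) s := d3.mul d2
      exact (hasDerivAt_smoothTransition _).comp s ((d4.div_const c).const_sub 2))
    (fun s hs θ => by
      have hsI := Ioo_subset_Icc_self hs
      have d1 := (hasFDerivAt_norm_sub_sq (γ' s) θ).const_mul (Real.exp (-2 * Λ * s))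
      have d2 : HasFDerivAt (ψ s) _ θ := (hasDerivAt_smoothTransition _).comp_hasFDerivAt θ
        ((d1.mul_const c⁻¹).const_sub 2)
      have e : fderiv ℝ (ψ s) θ (V s θ) = deriv Real.smoothTransition (2 - w s θ / c) *
          -(Real.exp (-2 * Λ * s) * (2 * inner ℝ (θ - γ' s) (V s θ)) / c) := by
        rw [d2.fderiv]
        change deriv Real.smoothTransition (2 - w s θ / c) *
          -(c⁻¹ * (Real.exp (-2 * Λ * s) * (2 * inner ℝ (θ - γ' s) (V s θ)))) = _
        ring
      rw [e]
      refine mul_le_mul_of_nonneg_left (neg_le_neg ?_) Real.smoothTransition.monotone.deriv_nonneg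
      refine div_le_div_of_nonneg_right ?_ hc0.le
      have hip : inner ℝ (θ - γ' s) (B s) - inner ℝ (θ - γ' s) (V s θ) ≤
          Λ * ‖θ - γ' s‖ ^ 2 := by
        rw [← inner_sub_right, hB s hsI, hγ' s hsI]
        calc _ ≤ ‖θ - γ s‖ * ‖V s (γ s) - V s θ‖ := real_inner_le_norm _ _
          _ ≤ ‖θ - γ s‖ * (Λ * ‖γ s - θ‖) := by
            gcongr
            exact h.lipschitz s hsI.1 _ _
          _ = _ := by rw [norm_sub_rev (γ s)]; ring
      have hE := Real.exp_pos (-2 * Λ * s)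
      simp only [hw']
      nlinarith [mul_le_mul_of_nonneg_left hip hE.le])
  have h0S : (0 : ℝ) ∈ Icc 0 S := left_mem_Icc.2 hS
  have hSS : S ∈ Icc 0 S := right_mem_Icc.2 hS
  have hint : ∀ s ∈ Icc 0 S, Integrable (ψ s) (ν s) := fun s hs =>
    (h.moment s hs.1).integrable_of_hasCompactSupport (hψsm s).continuous
      (hasCompactSupport_of_norm_gt fun θ hθ =>
        Real.smoothTransition.zero_of_nonpos (hfar s hs θ hθ))
  have hpos : 0 < ∫ θ, ψ 0 θ ∂(ν 0) := by
    rw [integral_pos_iff_support_of_nonneg (fun _ => Real.smoothTransition.nonneg _)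
      (hint 0 h0S)]
    refine Measure.mem_support_iff_forall _ |>.1 hγ0 _ ?_
    refine (hψsm 0).continuous.isOpen_support.mem_nhds ?_
    have : ψ 0 (γ 0) = 1 := by
      refine Real.smoothTransition.one_of_one_le ?_
      simp only [hw, hγ' 0 h0S]
      norm_num
    rw [Function.mem_support, this]
    exact one_ne_zero
  by_contra hcon
  have hzero : ν S (Metric.ball (γ S) r) = 0 := nonpos_iff_eq_zero.1 (not_lt.1 hcon)
  have : ∫ θ, ψ S θ ∂(ν S) = 0 := by
    refine integral_eq_zero_of_ae ?_
    have hae : ∀ᵐ θ ∂(ν S), θ ∉ Metric.ball (γ S) r := measure_eq_zero_iff_ae_notMem.1 hzero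
    filter_upwards [hae] with θ hθ
    refine Real.smoothTransition.zero_of_nonpos (hneg S hSS θ ?_)
    simpa [dist_eq_norm] using hθ
  linarith

/-- If the support of the initial measure separates two spheres, then on every ray there is a
point all of whose neighbourhoods are charged at time `S`. -/
lemma exists_pos_smul_measure_ball_pos (h : LinearFlow V ν M Λ) (hS : 0 ≤ S) {ra rb : ℝ}
    (hra : 0 < ra) (hrab : ra < rb)
    (hsep : Separates (ν 0).support (Metric.sphere 0 ra) (Metric.sphere 0 rb)) {θ : Euc k}
    (hθ : θ ≠ 0) : ∃ c : ℝ, 0 < c ∧ ∀ r > 0, 0 < ν S (Metric.ball (c • θ) r) := by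
  have hΛ := h.pos
  obtain ⟨γ, hγS, hγ⟩ := h.exists_trajectory hS θ
  -- The origin is an equilibrium, so a trajectory that starts there stays there and cannot end at
  -- `θ ≠ 0`.
  have hγ0 : γ 0 ≠ 0 := by
    intro h0
    have := norm_le_of_norm_deriv_le (K := Λ + 1) (ε := 0) (by linarith) le_rfl hγ
      (fun s hs => ?_) (left_mem_Icc.2 hS) (right_mem_Icc.2 hS)
    · rw [h0, norm_zero, add_zero, zero_mul, norm_le_zero_iff, hγS] at this
      exact hθ this
    · rw [norm_neg]
      linarith [h.norm_le hs.1 (γ s), norm_nonneg (γ s)]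
  have hn : 0 < ‖γ 0‖ := norm_pos_iff.2 hγ0
  have hrb : 0 < rb := hra.trans hrab
  -- The radial segment in the direction of `γ 0` joins the two spheres and so meets the support at
  -- some `c • γ 0`; by homogeneity `c • γ` is a trajectory too, and it ends at `c • θ`.
  obtain ⟨t, ht, hmem⟩ := hsep (fun t => ((ra + t * (rb - ra)) / ‖γ 0‖) • γ 0)
    (by fun_prop)
    (by simp [norm_smul, abs_of_pos hra, hn.ne'])
    (by simp [norm_smul, abs_of_pos hrb, hn.ne'])
  set c := (ra + t * (rb - ra)) / ‖γ 0‖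
  have hc : 0 < c := div_pos (by nlinarith [ht.1]) hn
  refine ⟨c, hc, fun r hr => ?_⟩
  have := h.measure_ball_pos hS (γ := fun s => c • γ s) (fun s hs => ?_) hmem hr
  · simpa only [hγS] using this
  · rw [h.homogeneous, ← smul_neg]
    exact (hγ s hs).const_smul c

end LinearFlow

end ResNet

/-! ### Sublevel cones at regular values, and the profile function. -/

namespace ResNet

variable {k : ℕ}

section Sublevel

variable {h : Euc k → ℝ} {W : Euc k → Euc k} {η : ℝ}

/-- Euler's identity: differentiate `h (c • θ) = c² h θ` at `c = 1`. -/
lemma two_mul_eq_inner_of_homogeneous (hW : ∀ θ, HasGradientAt h (W θ) θ)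
    (hhom : ∀ (c : ℝ) θ, h (c • θ) = c ^ 2 * h θ) (θ : Euc k) : inner ℝ (W θ) θ = 2 * h θ := by
  have h1 : HasDerivAt (fun c : ℝ => c • θ) ((1 : ℝ) • θ) 1 := (hasDerivAt_id 1).smul_const θ
  have h2 : HasFDerivAt h (InnerProductSpace.toDual ℝ (Euc k) (W θ)) ((1 : ℝ) • θ) := by
    rw [one_smul]; exact hW θ
  have h3 : HasDerivAt (fun c : ℝ => h (c • θ)) _ 1 := h2.comp_hasDerivAt 1 h1
  have h4 : HasDerivAt (fun c : ℝ => c ^ 2 * h θ) (2 * h θ) 1 := by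
    simpa using (hasDerivAt_pow 2 (1 : ℝ)).mul_const (h θ)
  have e : (fun c : ℝ => h (c • θ)) = fun c => c ^ 2 * h θ := funext fun c => hhom c θ
  rw [e] at h3
  have := h3.unique h4
  simpa using this

/-- A homogeneous function with a negative value has a regular negative value on the sphere that
lies above another value on the sphere. -/
lemma exists_regular_value (hsard : SardRegularOnSphere h)
    (hhom : ∀ (c : ℝ) θ, h (c • θ) = c ^ 2 * h θ) {θ : Euc k} (hθ : h θ < 0) :
    ∃ η > 0, IsSphereRegularValue h (-η) ∧ ∃ e : Euc k, ‖e‖ = 1 ∧ h e < -η := by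
  have hθ0 : θ ≠ 0 := by
    rintro rfl
    have := hhom 0 0
    simp only [smul_zero] at this
    norm_num at this
    linarith
  have hn : 0 < ‖θ‖ := norm_pos_iff.2 hθ0
  set e := ‖θ‖⁻¹ • θ with he
  have he1 : ‖e‖ = 1 := by
    rw [he, norm_smul, norm_inv, norm_norm, inv_mul_cancel₀ hn.ne']
  have heneg : h e < 0 := by
    rw [he, hhom]
    exact mul_neg_of_pos_of_neg (by positivity) hθ
  -- The target is `h e / 2`. If it is attained, Sard-type regularity gives a regular value closer
  -- to it than `|h e| / 4`, hence strictly between `h e` and `0`; if not, it is itself vacuously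
  -- regular.
  by_cases hex : ∃ θ' ∈ Metric.sphere (0 : Euc k) 1, h θ' = h e / 2
  · obtain ⟨θ', hθ', hv⟩ := hex
    have hcl := hsard ⟨θ', hθ', hv⟩
    obtain ⟨α, hα, hdist⟩ := Metric.mem_closure_iff.1 hcl (-(h e / 4)) (by linarith)
    rw [Real.dist_eq, abs_lt] at hdist
    exact ⟨-α, by linarith [hdist.1], by rwa [neg_neg], e, he1, by linarith [hdist.2]⟩
  · push Not at hex
    refine ⟨-(h e / 2), by linarith, ⟨∅, isOpen_empty, ?_, by simp⟩, e, he1, by linarith⟩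
    rintro θ' ⟨h1, h2⟩
    rw [neg_neg] at h2
    exact hex θ' h1 h2

/-- At a regular value, the sublevel cone of a homogeneous function is strictly attracting for
the gradient descent. -/
lemma exists_drift_lower_bound (hW : ∀ θ, HasGradientAt h (W θ) θ)
    (hhom : ∀ (c : ℝ) θ, h (c • θ) = c ^ 2 * h θ) (hWhom : ∀ (c : ℝ) θ, W (c • θ) = c • W θ)
    (hWc : Continuous W) (hη : 0 < η) (hreg : IsSphereRegularValue h (-η)) :
    ∃ κ > 0, ∀ θ, h θ ≤ -η * ‖θ‖ ^ 2 →
      κ * ‖θ‖ ^ 2 ≤ inner ℝ ((2 * η) • θ + W θ) (W θ) := by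
  have heuler := two_mul_eq_inner_of_homogeneous hW hhom
  have hc : Continuous h := continuous_iff_continuousAt.2 fun θ =>
    (hW θ).hasFDerivAt.continuousAt
  have hpos : ∀ θ ∈ Metric.sphere (0 : Euc k) 1 ∩ {θ | h θ ≤ -η},
      0 < inner ℝ ((2 * η) • θ + W θ) (W θ) := by
    rintro θ ⟨hθ, hle⟩
    have hle' : h θ ≤ -η := hle
    have hn : ‖θ‖ = 1 := by simpa using hθ
    have e1 : inner ℝ ((2 * η) • θ + W θ) (W θ) = 4 * η * h θ + ‖W θ‖ ^ 2 := by
      rw [inner_add_left, real_inner_smul_left, real_inner_comm, heuler,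
        real_inner_self_eq_norm_sq]
      ring
    -- By Euler's identity this is the tangential part of the gradient, so the inner product equals
    -- `4 h (η + h)` plus its squared norm. For `h < -η` the first term is positive; on the boundary
    -- `h = -η` it vanishes and regularity makes the tangential part nonzero.
    have e2 : ‖W θ - (2 * h θ) • θ‖ ^ 2 = ‖W θ‖ ^ 2 - 4 * h θ ^ 2 := by
      rw [norm_sub_sq_real, real_inner_smul_right, heuler, norm_smul, hn, mul_one,
        Real.norm_eq_abs, sq_abs]
      ring
    have e3 := sq_nonneg ‖W θ - (2 * h θ) • θ‖
    rw [e1]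
    rcases hle'.lt_or_eq with hlt | heq
    · nlinarith
    · obtain ⟨U, -, hU, hUd⟩ := hreg
      obtain ⟨-, v, hv, hd⟩ := hUd θ ⟨hU ⟨hθ, heq⟩, hθ⟩
      have hne : W θ - (2 * h θ) • θ ≠ 0 := by
        intro h0
        refine hd ?_
        rw [(hW θ).hasFDerivAt.fderiv, InnerProductSpace.toDual_apply_apply, sub_eq_zero.1 h0,
          real_inner_smul_left, real_inner_comm, hv, mul_zero]
      have : 0 < ‖W θ - (2 * h θ) • θ‖ ^ 2 := by positivity
      nlinarith
  have hcomp : IsCompact (Metric.sphere (0 : Euc k) 1 ∩ {θ | h θ ≤ -η}) :=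
    (isCompact_sphere _ _).inter_right (isClosed_le hc continuous_const)
  obtain ⟨κ, hκ, hκle⟩ := hcomp.exists_forall_le' (a := 0)
    (f := fun θ => (inner ℝ ((2 * η) • θ + W θ) (W θ) : ℝ)) (by fun_prop) hpos
  refine ⟨κ, hκ, fun θ hθ => ?_⟩
  rcases eq_or_ne θ 0 with rfl | hθ0
  · have : W 0 = 0 := by simpa using hWhom 0 0
    simp [this]
  have hn : 0 < ‖θ‖ := norm_pos_iff.2 hθ0
  have he1 : ‖‖θ‖⁻¹ • θ‖ = 1 := by
    rw [norm_smul, norm_inv, norm_norm, inv_mul_cancel₀ hn.ne']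
  have hmem := hκle (‖θ‖⁻¹ • θ) ⟨by simp [he1], by
    change h (‖θ‖⁻¹ • θ) ≤ -η
    rw [hhom]
    calc _ ≤ ‖θ‖⁻¹ ^ 2 * (-η * ‖θ‖ ^ 2) := by gcongr
      _ = -η := by field_simp⟩
  rw [hWhom, smul_comm, ← smul_add, real_inner_smul_left, real_inner_smul_right] at hmem
  calc κ * ‖θ‖ ^ 2 ≤ (‖θ‖⁻¹ * (‖θ‖⁻¹ * inner ℝ ((2 * η) • θ + W θ) (W θ))) * ‖θ‖ ^ 2 := by
        gcongr
    _ = _ := by field_simp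

end Sublevel

/-- The function `x ↦ x₊² / (1 + x₊²)`. -/
noncomputable def softStep (x : ℝ) : ℝ := max x 0 ^ 2 / (1 + max x 0 ^ 2)

/-- The derivative of `softStep`. -/
noncomputable def softStepDeriv (x : ℝ) : ℝ := 2 * max x 0 / (1 + max x 0 ^ 2) ^ 2

lemma softStep_nonneg (x : ℝ) : 0 ≤ softStep x := by unfold softStep; positivity

lemma softStep_le_one (x : ℝ) : softStep x ≤ 1 := by
  unfold softStep
  exact div_le_one_of_le₀ (by linarith) (by positivity)

lemma softStep_pos {x : ℝ} (hx : 0 < x) : 0 < softStep x := by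
  unfold softStep
  rw [max_eq_left hx.le]
  positivity

lemma softStepDeriv_nonneg (x : ℝ) : 0 ≤ softStepDeriv x := by
  unfold softStepDeriv
  positivity

lemma softStepDeriv_of_nonpos {x : ℝ} (hx : x ≤ 0) : softStepDeriv x = 0 := by
  simp [softStepDeriv, max_eq_right hx]

/-- This identity motivates the profile: where `x` is bounded, `x₊` times the derivative controls a
multiple of the profile itself, so growth of `u` becomes growth proportional to the measured mass.
-/
lemma softStepDeriv_mul_max (x : ℝ) :
    softStepDeriv x * max x 0 = 2 * softStep x / (1 + max x 0 ^ 2) := by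
  unfold softStepDeriv softStep
  field_simp

lemma hasDerivAt_max_sq (x : ℝ) : HasDerivAt (fun x : ℝ => max x 0 ^ 2) (2 * max x 0) x := by
  rcases lt_trichotomy x 0 with hx | rfl | hx
  · rw [max_eq_right hx.le, mul_zero]
    refine (hasDerivAt_const x (0 : ℝ)).congr_of_eventuallyEq ?_
    filter_upwards [Iio_mem_nhds hx] with z hz
    rw [max_eq_right (le_of_lt hz)]; norm_num
  · rw [max_self, mul_zero, hasDerivAt_iff_isLittleO_nhds_zero]
    have h1 : (fun z : ℝ => z ^ 2) =o[𝓝 0] fun z : ℝ => z := by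
      simpa using Asymptotics.isLittleO_pow_pow (𝕜 := ℝ) (m := 1) (n := 2) (by norm_num)
    refine Asymptotics.IsBigO.trans_isLittleO (Asymptotics.IsBigO.of_bound 1 ?_) h1
    refine Eventually.of_forall fun z => ?_
    simp only [zero_add, max_self, smul_zero, sub_zero, one_mul, norm_pow, Real.norm_eq_abs]
    norm_num
    rcases le_total z 0 with hz | hz
    · rw [max_eq_right hz]; nlinarith [sq_nonneg z]
    · rw [max_eq_left hz]
  · rw [max_eq_left hx.le]
    have := hasDerivAt_pow 2 x
    norm_num at this
    refine this.congr_of_eventuallyEq ?_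
    filter_upwards [Ioi_mem_nhds hx] with z hz
    rw [max_eq_left (le_of_lt hz)]

lemma hasDerivAt_softStep (x : ℝ) : HasDerivAt softStep (softStepDeriv x) x := by
  have h1 := hasDerivAt_max_sq x
  have h2 : HasDerivAt softStep _ x :=
    h1.div (h1.const_add 1) (show (1 + max x 0 ^ 2 : ℝ) ≠ 0 by positivity)
  refine h2.congr_deriv ?_
  unfold softStepDeriv
  ring

lemma contDiff_softStep : ContDiff ℝ 1 softStep := by
  rw [contDiff_one_iff_deriv]
  refine ⟨fun x => (hasDerivAt_softStep x).differentiableAt, ?_⟩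
  have : deriv softStep = softStepDeriv := funext fun x => (hasDerivAt_softStep x).deriv
  rw [this]
  unfold softStepDeriv
  refine Continuous.div (by fun_prop) (by fun_prop) fun x => ?_
  positivity

/-- Arguments of the cut-off have the form `2 - δ ‖θ‖²`, so only `x ≤ 2` matters. -/
lemma exists_deriv_smoothTransition_le :
    ∃ T > 0, ∀ x ≤ 2, deriv Real.smoothTransition x ≤ T := by
  obtain ⟨T, hT⟩ := isCompact_Icc.exists_bound_of_continuousOn (s := Icc (0 : ℝ) 2)
    contDiff_deriv_smoothTransition.continuous.continuousOn
  refine ⟨|T| + 1, by positivity, fun x hx => ?_⟩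
  rcases le_total x 0 with h | h
  · rw [deriv_smoothTransition_of_nonpos h]; positivity
  · have h1 := (le_abs_self _).trans (hT x ⟨h, hx⟩)
    linarith [le_abs_self T]

end ResNet

/-! ### Growth of mass in the cone and nonnegativity of the limit potential. -/

namespace ResNet

variable {k : ℕ}

/-- The test function `χ(u) ζ`, where `χ` is `softStep` and `ζ` is a cut-off at distance of order
`δ ^ (-1/2)` from the origin. -/
noncomputable def coneTest (u : Euc k → ℝ) (δ : ℝ) (θ : Euc k) : ℝ :=
  softStep (u θ) * Real.smoothTransition (2 - δ * ‖θ‖ ^ 2)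

section ConeTest

variable {u : Euc k → ℝ} {δ : ℝ}

lemma contDiff_coneTest (hu : ContDiff ℝ 1 u) : ContDiff ℝ 1 (coneTest u δ) :=
  (contDiff_softStep.comp hu).mul ((Real.smoothTransition.contDiff (n := 1)).comp
    (contDiff_const.sub (contDiff_const.mul (contDiff_id.norm_sq ℝ))))

lemma hasCompactSupport_coneTest (hδ : 0 < δ) : HasCompactSupport (coneTest u δ) := by
  refine hasCompactSupport_of_norm_gt (R := 2 / δ + 1) fun θ hθ => ?_
  rw [coneTest, Real.smoothTransition.zero_of_nonpos, mul_zero]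
  have h0 : 0 < 2 / δ := by positivity
  have h1 : 2 / δ ≤ ‖θ‖ ^ 2 := by nlinarith
  rw [div_le_iff₀ hδ] at h1
  linarith

lemma coneTest_nonneg (θ : Euc k) : 0 ≤ coneTest u δ θ :=
  mul_nonneg (softStep_nonneg _) (Real.smoothTransition.nonneg _)

lemma coneTest_le (θ : Euc k) : coneTest u δ θ ≤ softStep (u θ) :=
  mul_le_of_le_one_right (softStep_nonneg _) (Real.smoothTransition.le_one _)

/-- The cut-off is inactive where `δ ‖θ‖² ≤ 1`; elsewhere `δ ‖θ‖²` exceeds the profile, which is at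
most 1. With the moment bound, the truncation costs at most `δ M`. -/
lemma le_coneTest_add (hδ : 0 < δ) (θ : Euc k) :
    softStep (u θ) ≤ coneTest u δ θ + δ * ‖θ‖ ^ 2 := by
  rcases le_total (δ * ‖θ‖ ^ 2) 1 with h | h
  · rw [coneTest, Real.smoothTransition.one_of_one_le (by linarith), mul_one]
    have : 0 ≤ δ * ‖θ‖ ^ 2 := by positivity
    linarith
  · linarith [softStep_le_one (u θ), coneTest_nonneg (u := u) (δ := δ) θ]

lemma fderiv_coneTest_apply (hu : ContDiff ℝ 1 u) (θ v : Euc k) :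
    fderiv ℝ (coneTest u δ) θ v =
      softStepDeriv (u θ) * fderiv ℝ u θ v * Real.smoothTransition (2 - δ * ‖θ‖ ^ 2) -
      softStep (u θ) * (deriv Real.smoothTransition (2 - δ * ‖θ‖ ^ 2) *
        (δ * (2 * inner ℝ θ v))) := by
  have h1 := (hasDerivAt_softStep (u θ)).comp_hasFDerivAt θ
    (hu.differentiable one_ne_zero θ).hasFDerivAt
  have h2 := hasFDerivAt_norm_sub_sq 0 θ
  simp only [sub_zero] at h2
  have h3 := (hasDerivAt_smoothTransition (2 - δ * ‖θ‖ ^ 2)).comp_hasFDerivAt θ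
    ((h2.const_mul δ).const_sub 2)
  have h4 : HasFDerivAt (coneTest u δ) _ θ := h1.mul h3
  rw [h4.fderiv]
  change softStep (u θ) * (deriv Real.smoothTransition (2 - δ * ‖θ‖ ^ 2) *
    -(δ * (2 * inner ℝ θ v))) + Real.smoothTransition (2 - δ * ‖θ‖ ^ 2) *
    (softStepDeriv (u θ) * fderiv ℝ u θ v) = _
  ring

/-- Pointwise lower bound for the derivative of the test function along a field that increases
`u` at rate `κ ‖θ‖²` in the cone `{u > 0}`. -/
lemma le_neg_fderiv_coneTest (hu : ContDiff ℝ 1 u) (hδ : 0 < δ) {T Λ κ : ℝ}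
    (hT0 : 0 < T) (hT : ∀ x ≤ 2, deriv Real.smoothTransition x ≤ T) {θ v : Euc k}
    (hv : ‖v‖ ≤ Λ * ‖θ‖) (hκ : 0 < u θ → κ * ‖θ‖ ^ 2 ≤ -fderiv ℝ u θ v) :
    softStepDeriv (u θ) * Real.smoothTransition (2 - δ * ‖θ‖ ^ 2) * (κ * ‖θ‖ ^ 2) -
      2 * T * Λ * δ * ‖θ‖ ^ 2 ≤ -fderiv ℝ (coneTest u δ) θ v := by
  rw [fderiv_coneTest_apply hu]
  have h1 : softStepDeriv (u θ) * Real.smoothTransition (2 - δ * ‖θ‖ ^ 2) * (κ * ‖θ‖ ^ 2) ≤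
      softStepDeriv (u θ) * Real.smoothTransition (2 - δ * ‖θ‖ ^ 2) * -fderiv ℝ u θ v := by
    rcases le_or_gt (u θ) 0 with hle | hlt
    · simp [softStepDeriv_of_nonpos hle]
    · exact mul_le_mul_of_nonneg_left (hκ hlt)
        (mul_nonneg (softStepDeriv_nonneg _) (Real.smoothTransition.nonneg _))
  have h2 : -(2 * T * Λ * δ * ‖θ‖ ^ 2) ≤ softStep (u θ) *
      (deriv Real.smoothTransition (2 - δ * ‖θ‖ ^ 2) * (δ * (2 * inner ℝ θ v))) := by
    have a1 : |(inner ℝ θ v : ℝ)| ≤ Λ * ‖θ‖ ^ 2 := by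
      refine (abs_real_inner_le_norm θ v).trans ?_
      nlinarith [norm_nonneg θ]
    have a2 : 0 ≤ deriv Real.smoothTransition (2 - δ * ‖θ‖ ^ 2) :=
      Real.smoothTransition.monotone.deriv_nonneg
    have a3 := hT (2 - δ * ‖θ‖ ^ 2) (by
      have : 0 ≤ δ * ‖θ‖ ^ 2 := by positivity
      linarith)
    refine neg_le_of_abs_le ?_
    rw [abs_mul, abs_mul, abs_mul, abs_mul, abs_of_nonneg (softStep_nonneg _), abs_of_nonneg a2,
      abs_of_pos hδ, abs_two]
    calc _ ≤ 1 * (T * (δ * (2 * (Λ * ‖θ‖ ^ 2)))) := by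
          gcongr
          exact softStep_le_one _
      _ = _ := by ring
  linarith

end ConeTest

namespace LinearFlow

variable {V : ℝ → Euc k → Euc k} {ν : ℝ → Measure (Euc k)} {M Λ : ℝ}

/-- Mass cannot persist in a cone in which `u` grows at rate `κ ‖θ‖²` along the flow. -/
lemma false_of_cone (hF : LinearFlow V ν M Λ) {u : Euc k → ℝ} (hu : ContDiff ℝ 1 u)
    (hule : ∀ θ, u θ ≤ Λ * ‖θ‖ ^ 2) {S κ : ℝ} (hS : 0 ≤ S) (hκ : 0 < κ)
    (hgrow : ∀ s ≥ S, ∀ θ, 0 < u θ → κ * ‖θ‖ ^ 2 ≤ -fderiv ℝ u θ (V s θ))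
    (hpos : 0 < ν S {θ | 0 < u θ}) : False := by
  have hM := (hF.moment 0 le_rfl).nonneg
  have hΛ := hF.pos
  obtain ⟨T, hT0, hT⟩ := exists_deriv_smoothTransition_le
  have hχc : Continuous fun θ => softStep (u θ) := (contDiff_softStep.comp hu).continuous
  have hs0 : ∀ {s}, S ≤ s → 0 ≤ s := fun h => hS.trans h
  have iχ : ∀ s ≥ S, Integrable (fun θ => softStep (u θ)) (ν s) := fun s hs =>
    (hF.moment s (hs0 hs)).integrable_of_le (A := 0) (B := 1) hχc fun θ => by
      rw [Real.norm_of_nonneg (softStep_nonneg _)]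
      simpa using softStep_le_one _
  have iψ : ∀ s ≥ S, ∀ δ > 0, Integrable (coneTest u δ) (ν s) := fun s hs δ hδ =>
    (hF.moment s (hs0 hs)).integrable_of_hasCompactSupport (contDiff_coneTest hu).continuous
      (hasCompactSupport_coneTest hδ)
  have iq : ∀ s ≥ S, Integrable (fun θ => ‖θ‖ ^ 2) (ν s) := fun s hs =>
    (hF.moment s (hs0 hs)).integrable
  have hq : ∀ s ≥ S, ∫ θ, ‖θ‖ ^ 2 ∂(ν s) ≤ M := fun s hs => (hF.moment s (hs0 hs)).le
  have iD : ∀ s ≥ S, ∀ δ > 0, Integrable (fun θ => -fderiv ℝ (coneTest u δ) θ (V s θ)) (ν s) :=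
    fun s hs δ hδ => (hF.integrable_fderiv_apply (contDiff_coneTest hu)
      (hasCompactSupport_coneTest hδ) (hs0 hs)).neg
  have hpt : ∀ s ≥ S, ∀ δ > 0, ∀ θ, softStepDeriv (u θ) *
      Real.smoothTransition (2 - δ * ‖θ‖ ^ 2) * (κ * ‖θ‖ ^ 2) - 2 * T * Λ * δ * ‖θ‖ ^ 2 ≤
      -fderiv ℝ (coneTest u δ) θ (V s θ) := fun s hs δ hδ θ =>
    le_neg_fderiv_coneTest hu hδ hT0 hT (hF.norm_le (hs0 hs) θ) (hgrow s hs θ)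
  set m : ℝ → ℝ := fun s => ∫ θ, softStep (u θ) ∂(ν s) with hm
  have hm0 : 0 < m S := by
    rw [hm, integral_pos_iff_support_of_nonneg (fun _ => softStep_nonneg _) (iχ S le_rfl)]
    refine hpos.trans_le (measure_mono fun θ hθ => ?_)
    exact (softStep_pos hθ).ne'
  -- The growth term is dropped. The cut-off causes an error of order `δ` on a fixed time interval,
  -- and `δ` tends to zero.
  have hmono : ∀ s ≥ S, m S ≤ m s := by
    intro b hb
    have key : ∀ δ > 0, m S ≤ m b + δ * (M + 2 * T * Λ * M * (b - S)) := by
      intro δ hδ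
      have h1 := hF.mul_sub_le_integral_sub (contDiff_coneTest hu)
        (hasCompactSupport_coneTest hδ) hS hb (c := -(2 * T * Λ * δ * M)) fun s hs => by
        rw [← integral_neg]
        calc -(2 * T * Λ * δ * M) ≤ ∫ θ, -(2 * T * Λ * δ) * ‖θ‖ ^ 2 ∂(ν s) := by
              rw [integral_const_mul]
              have := mul_le_mul_of_nonneg_left (hq s hs.1.le)
                (show 0 ≤ 2 * T * Λ * δ by positivity)
              linarith
          _ ≤ _ := by
            refine integral_mono ((iq s hs.1.le).const_mul _) (iD s hs.1.le δ hδ) fun θ => ?_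
            refine le_trans ?_ (hpt s hs.1.le δ hδ θ)
            have : 0 ≤ softStepDeriv (u θ) * Real.smoothTransition (2 - δ * ‖θ‖ ^ 2) *
                (κ * ‖θ‖ ^ 2) := mul_nonneg (mul_nonneg (softStepDeriv_nonneg _)
              (Real.smoothTransition.nonneg _)) (by positivity)
            simp only
            linarith
      have h2 : ∫ θ, coneTest u δ θ ∂(ν b) ≤ m b :=
        integral_mono (iψ b hb δ hδ) (iχ b hb) coneTest_le
      have h3 : m S ≤ ∫ θ, coneTest u δ θ ∂(ν S) + δ * M := by
        calc m S ≤ ∫ θ, (coneTest u δ θ + δ * ‖θ‖ ^ 2) ∂(ν S) :=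
              integral_mono (iχ S le_rfl) ((iψ S le_rfl δ hδ).add ((iq S le_rfl).const_mul δ))
                (le_coneTest_add hδ)
          _ = ∫ θ, coneTest u δ θ ∂(ν S) + δ * ∫ θ, ‖θ‖ ^ 2 ∂(ν S) := by
            rw [integral_add (iψ S le_rfl δ hδ) ((iq S le_rfl).const_mul δ), integral_const_mul]
          _ ≤ _ := by
            gcongr
            exact hq S le_rfl
      linarith
    have hlim : Tendsto (fun δ : ℝ => m b + δ * (M + 2 * T * Λ * M * (b - S))) (𝓝[>] 0)
        (𝓝 (m b)) := by
      have : Continuous fun δ : ℝ => m b + δ * (M + 2 * T * Λ * M * (b - S)) := by fun_prop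
      simpa using (this.tendsto 0).mono_left nhdsWithin_le_nhds
    exact ge_of_tendsto hlim (eventually_nhdsWithin_of_forall key)
  -- Parameters with `δ₀ ‖θ‖² ≥ 1` account for at most half of `m S`; on the remaining ones `u` is
  -- at most `Q = Λ / δ₀`.
  set δ₀ := m S / (2 * (M + 1)) with hδ₀
  have hδ₀pos : 0 < δ₀ := by positivity
  have hδ₀M : δ₀ * M ≤ m S / 2 := by
    rw [hδ₀, div_mul_eq_mul_div, div_le_iff₀ (by positivity)]
    nlinarith
  set Q := Λ / δ₀ with hQ
  have hQ0 : 0 < Q := by positivity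
  set c₁ := 2 / ((1 + Q ^ 2) * Λ) with hc₁
  have hc₁pos : 0 < c₁ := by positivity
  -- Where `δ₀ ‖θ‖² ≤ 1` the cut-off equals 1, and `u ≤ Λ ‖θ‖²` with `u ≤ Q` gives the factor `c₁`;
  -- elsewhere the left-hand side is nonpositive.
  have hlow : ∀ δ > 0, δ ≤ δ₀ → ∀ θ, c₁ * (softStep (u θ) - δ₀ * ‖θ‖ ^ 2) ≤
      softStepDeriv (u θ) * Real.smoothTransition (2 - δ * ‖θ‖ ^ 2) * ‖θ‖ ^ 2 := by
    intro δ hδ hle θ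
    have hr : 0 ≤ softStepDeriv (u θ) * Real.smoothTransition (2 - δ * ‖θ‖ ^ 2) * ‖θ‖ ^ 2 :=
      mul_nonneg (mul_nonneg (softStepDeriv_nonneg _) (Real.smoothTransition.nonneg _))
        (by positivity)
    rcases le_total (δ₀ * ‖θ‖ ^ 2) 1 with h1 | h1
    · have h2 : δ * ‖θ‖ ^ 2 ≤ 1 := le_trans (by gcongr) h1
      rw [Real.smoothTransition.one_of_one_le (by linarith), mul_one]
      have h3 : max (u θ) 0 ≤ Λ * ‖θ‖ ^ 2 := max_le (hule θ) (by positivity)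
      have h4 : max (u θ) 0 ≤ Q := by
        refine h3.trans ?_
        rw [hQ, le_div_iff₀ hδ₀pos]
        nlinarith
      have h5 : softStepDeriv (u θ) * max (u θ) 0 ≤ softStepDeriv (u θ) * (Λ * ‖θ‖ ^ 2) :=
        mul_le_mul_of_nonneg_left h3 (softStepDeriv_nonneg _)
      rw [softStepDeriv_mul_max] at h5
      have h6 : 2 * softStep (u θ) / (1 + Q ^ 2) ≤ 2 * softStep (u θ) / (1 + max (u θ) 0 ^ 2) := by
        have := softStep_nonneg (u θ)
        gcongr
      have h7 : c₁ * softStep (u θ) = 2 * softStep (u θ) / (1 + Q ^ 2) / Λ := by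
        rw [hc₁]; field_simp
      have h8 : 2 * softStep (u θ) / (1 + Q ^ 2) / Λ ≤ softStepDeriv (u θ) * ‖θ‖ ^ 2 := by
        rw [div_le_iff₀ hΛ]
        linarith
      have h9 : 0 ≤ c₁ * (δ₀ * ‖θ‖ ^ 2) := by positivity
      rw [mul_sub]
      linarith
    · refine le_trans ?_ hr
      exact mul_nonpos_of_nonneg_of_nonpos hc₁pos.le (by linarith [softStep_le_one (u θ)])
  -- The net growth rate is at least `κ c₁ (m S - m S / 2) = 2 c₂`, minus a cut-off error that the
  -- choice of `δ` keeps below `c₂`.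
  set c₂ := κ * c₁ * m S / 4 with hc₂
  have hc₂pos : 0 < c₂ := by positivity
  set δ := min δ₀ (c₂ / (2 * T * Λ * M + 1)) with hδ
  have hδpos : 0 < δ := lt_min hδ₀pos (by positivity)
  have hδM : 2 * T * Λ * M * δ ≤ c₂ := by
    have : δ ≤ c₂ / (2 * T * Λ * M + 1) := min_le_right _ _
    rw [le_div_iff₀ (by positivity)] at this
    linarith
  -- In time `2 / c₂` the integral grows by at least 2, although it always lies between 0 and 1.
  have hb : S ≤ S + 2 / c₂ := by
    have : 0 < 2 / c₂ := by positivity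
    linarith
  have hfinal := hF.mul_sub_le_integral_sub (contDiff_coneTest hu)
    (hasCompactSupport_coneTest hδpos) hS hb (c := c₂) fun s hs => by
    rw [← integral_neg]
    have hsS := hs.1.le
    have iA : Integrable (fun θ => κ * c₁ * softStep (u θ)) (ν s) := (iχ s hsS).const_mul _
    have iB : Integrable (fun θ => (κ * c₁ * δ₀ + 2 * T * Λ * δ) * ‖θ‖ ^ 2) (ν s) :=
      (iq s hsS).const_mul _
    calc c₂ ≤ ∫ θ, (κ * c₁ * softStep (u θ) -
          (κ * c₁ * δ₀ + 2 * T * Λ * δ) * ‖θ‖ ^ 2) ∂(ν s) := by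
          rw [integral_sub iA iB, integral_const_mul, integral_const_mul]
          have a1 := mul_le_mul_of_nonneg_left (hmono s hsS) (show 0 ≤ κ * c₁ by positivity)
          have a2 := mul_le_mul_of_nonneg_left (hq s hsS)
            (show 0 ≤ κ * c₁ * δ₀ + 2 * T * Λ * δ by positivity)
          have a3 := mul_le_mul_of_nonneg_left hδ₀M (show 0 ≤ κ * c₁ by positivity)
          simp only [hm] at a1 a3 hc₂
          linarith
      _ ≤ _ := by
        refine integral_mono (iA.sub iB) (iD s hsS δ hδpos) fun θ => ?_
        refine le_trans ?_ (hpt s hsS δ hδpos θ)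
        have := mul_le_mul_of_nonneg_left (hlow δ hδpos (min_le_left _ _) θ) hκ.le
        simp only
        linarith
  have hbS : S ≤ S + 2 / c₂ := hb
  have := (hF.moment _ (hs0 hbS)).prob
  have h1 : ∫ θ, coneTest u δ θ ∂(ν (S + 2 / c₂)) ≤ 1 := by
    have h2 := integral_mono (iψ _ hbS δ hδpos) (integrable_const (1 : ℝ)) fun θ =>
      (coneTest_le (u := u) (δ := δ) θ).trans (softStep_le_one _)
    simpa using h2
  have h3 : 0 ≤ ∫ θ, coneTest u δ θ ∂(ν S) := integral_nonneg coneTest_nonneg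
  have h4 : c₂ * (S + 2 / c₂ - S) = 2 := by field_simp; ring
  rw [h4] at hfinal
  linarith

/-- If the drift converges to the gradient of a homogeneous function `h` with Sard-type regularity
on the sphere and the support of the initial measure separates two spheres, then `h` is
nonnegative. -/
lemma nonneg_of_tendsto (hF : LinearFlow V ν M Λ) {h : Euc k → ℝ} {W : Euc k → Euc k}
    (hW : ∀ θ, HasGradientAt h (W θ) θ) (hhom : ∀ (c : ℝ) θ, h (c • θ) = c ^ 2 * h θ)
    (hWhom : ∀ (c : ℝ) θ, W (c • θ) = c • W θ) (hWlip : ∀ θ θ', ‖W θ - W θ'‖ ≤ Λ * ‖θ - θ'‖)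
    (hlim : ∀ ε > 0, ∀ᶠ s in atTop, ∀ θ, ‖V s θ - W θ‖ ≤ ε * ‖θ‖) {ra rb : ℝ} (hra : 0 < ra)
    (hrab : ra < rb)
    (hsep : Separates (ν 0).support (Metric.sphere 0 ra) (Metric.sphere 0 rb))
    (hsard : SardRegularOnSphere h) (θ : Euc k) : 0 ≤ h θ := by
  by_contra! hθ
  have hΛ := hF.pos
  have hW0 : W 0 = 0 := by simpa using hWhom 0 0
  have hWle : ∀ θ, ‖W θ‖ ≤ Λ * ‖θ‖ := fun θ => by simpa [hW0] using hWlip θ 0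
  have hWc : Continuous W := (LipschitzWith.of_dist_le_mul (K := Λ.toNNReal) fun θ θ' => by
    rw [dist_eq_norm, dist_eq_norm, Real.coe_toNNReal _ hΛ.le]
    exact hWlip θ θ').continuous
  obtain ⟨η, hη, hreg, e, he1, he⟩ := exists_regular_value hsard hhom hθ
  obtain ⟨κ, hκ, hκle⟩ := exists_drift_lower_bound hW hhom hWhom hWc hη hreg
  -- The open cone where `h < -η ‖θ‖²`; minus the gradient of `u` is `2 η θ + W`, the vector in the
  -- drift lower bound.
  set u : Euc k → ℝ := fun θ => -(η * ‖θ‖ ^ 2) - h θ with hu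
  have hh1 : ContDiff ℝ 1 h := by
    rw [contDiff_one_iff_fderiv]
    refine ⟨fun θ => (hW θ).hasFDerivAt.differentiableAt, ?_⟩
    have : fderiv ℝ h = fun θ => InnerProductSpace.toDual ℝ (Euc k) (W θ) :=
      funext fun θ => (hW θ).hasFDerivAt.fderiv
    rw [this]
    exact (InnerProductSpace.toDual ℝ (Euc k)).continuous.comp hWc
  have hu1 : ContDiff ℝ 1 u :=
    (contDiff_const.mul (contDiff_id.norm_sq ℝ)).neg.sub hh1
  have hud : ∀ θ v, -fderiv ℝ u θ v = inner ℝ ((2 * η) • θ + W θ) v := by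
    intro θ v
    have h2 := hasFDerivAt_norm_sub_sq 0 θ
    simp only [sub_zero] at h2
    have h3 : HasFDerivAt u _ θ := ((h2.const_mul η).neg).sub (hW θ).hasFDerivAt
    rw [h3.fderiv]
    change -(-(η * (2 * inner ℝ θ v)) - inner ℝ (W θ) v) = _
    rw [inner_add_left, real_inner_smul_left]
    ring
  have hule : ∀ θ, u θ ≤ Λ * ‖θ‖ ^ 2 := by
    intro θ
    have h1 := two_mul_eq_inner_of_homogeneous hW hhom θ
    have h2 := abs_le.1 (abs_real_inner_le_norm (W θ) θ)
    have h3 := mul_le_mul_of_nonneg_right (hWle θ) (norm_nonneg θ)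
    have h4 : 0 ≤ η * ‖θ‖ ^ 2 := by positivity
    have h5 : 0 ≤ Λ * ‖θ‖ ^ 2 := by positivity
    simp only [hu]
    linarith [h2.1]
  -- As `‖2 η θ + W θ‖ ≤ (2 η + Λ) ‖θ‖`, an error `ε ‖θ‖` in the drift consumes at most half of the
  -- rate `κ`.
  set ε := κ / 2 / (2 * η + Λ) with hε
  have hε0 : 0 < ε := by positivity
  obtain ⟨S₀, hS₀⟩ := eventually_atTop.1 (hlim ε hε0)
  have hS : 0 ≤ max S₀ 0 := le_max_right _ _
  refine hF.false_of_cone hu1 hule hS (half_pos hκ) (fun s hs θ hθ => ?_) ?_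
  · rw [hud]
    have h1 := hκle θ (by simp only [hu] at hθ; linarith)
    have h2 := hS₀ s ((le_max_left _ _).trans hs) θ
    have h3 : ‖(2 * η) • θ + W θ‖ ≤ (2 * η + Λ) * ‖θ‖ := by
      refine (norm_add_le _ _).trans ?_
      rw [norm_smul, Real.norm_of_nonneg (by positivity), add_mul]
      linarith [hWle θ]
    have h4 := abs_le.1 (abs_real_inner_le_norm ((2 * η) • θ + W θ) (V s θ - W θ))
    have h5 : ‖(2 * η) • θ + W θ‖ * ‖V s θ - W θ‖ ≤ κ / 2 * ‖θ‖ ^ 2 := by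
      calc _ ≤ ((2 * η + Λ) * ‖θ‖) * (ε * ‖θ‖) :=
            mul_le_mul h3 h2 (norm_nonneg _) (by positivity)
        _ = κ / 2 * ‖θ‖ ^ 2 := by rw [hε]; field_simp
    have h6 : inner ℝ ((2 * η) • θ + W θ) (V s θ) = inner ℝ ((2 * η) • θ + W θ) (W θ) +
        inner ℝ ((2 * η) • θ + W θ) (V s θ - W θ) := by
      rw [← inner_add_right, add_sub_cancel]
    rw [h6]
    linarith [h4.1]
  · have he0 : e ≠ 0 := by
      rintro rfl
      simp at he1
    -- The ray through `e` lies in the cone, and some point of it has charged neighbourhoods at the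
    -- time from which the drift is close to its limit.
    obtain ⟨c, hc, hball⟩ := hF.exists_pos_smul_measure_ball_pos hS hra hrab hsep he0
    have hopen : IsOpen {θ | 0 < u θ} := isOpen_lt continuous_const hu1.continuous
    have hmem : c • e ∈ {θ | 0 < u θ} := by
      have : u (c • e) = c ^ 2 * (-η - h e) := by
        simp only [hu]
        rw [hhom, norm_smul, he1, mul_one, Real.norm_eq_abs, sq_abs]
        ring
      change 0 < u (c • e)
      rw [this]
      exact mul_pos (by positivity) (by linarith)
    obtain ⟨r, hr, hsub⟩ := Metric.isOpen_iff.1 hopen _ hmem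
    exact (hball r hr).trans_le (measure_mono hsub)

end LinearFlow

end ResNet

/-! ### The theorem. -/

open ResNet

theorem theorem3 {d k : ℕ}
    (f : Euc d → Euc k → Euc d) (g y : Euc d → ℝ) (μ : Measure (Euc d))
    (hf : ActivationAssumption f) (hhom : TwoHomogeneous f) (hdata : DataAssumption g y μ)
    (ρini : ℝ → Measure (Euc k)) (hini : LimitAdmissible ρini)
    (hsupp : ∃ R > 0, ∀ t ∈ Icc (0 : ℝ) 1, (ρini t).support ⊆ Metric.closedBall 0 R)
    (ρ : ℝ → ℝ → Measure (Euc k)) (hflow : IsWassersteinFlow f g y μ ρini ρ)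
    (ρinf : ℝ → Measure (Euc k)) (hpath : IsPath ρinf)
    (hlim : Tendsto (fun s => d1 (ρ s) ρinf) atTop (𝓝 0))
    (t₀ : ℝ) (ht₀ : t₀ ∈ Icc (0 : ℝ) 1)
    (hsep : ∃ ra rb : ℝ, 0 < ra ∧ ra < rb ∧
      Separates (ρini t₀).support (Metric.sphere 0 ra) (Metric.sphere 0 rb))
    (hsard : SardRegularOnSphere (firstVariation f g y μ ρinf t₀)) :
    loss f g y μ ρinf = 0 := by
  by_contra hloss
  obtain ⟨M, hM, hMinf⟩ := exists_uniform_momentLE hflow.isPath hflow.continuous hpath hlim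
  have hMρ : ∀ s ≥ 0, PathLE (ρ s) M := fun s hs => ⟨hflow.isPath s hs, hM s hs⟩
  have hMρinf : PathLE ρinf M := ⟨hpath, hMinf⟩
  obtain ⟨Λ, hΛ, hgrad, hstab⟩ := exists_driftGradient_bounds hf hhom hdata hMρinf.nonneg
  have hstab' : ∀ ρ₁ ρ₂, PathLE ρ₁ M → PathLE ρ₂ M → ∀ ε > 0,
      d1 ρ₁ ρ₂ < ENNReal.ofReal (ε / Λ) → ∀ θ : Euc k,
      ‖driftGradient f g y μ ρ₁ t₀ θ - driftGradient f g y μ ρ₂ t₀ θ‖ ≤ ε * ‖θ‖ := by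
    intro ρ₁ ρ₂ h₁ h₂ ε hε hd θ
    have := hstab ρ₁ ρ₂ h₁ h₂ (ε / Λ) (by positivity) (fun t ht => near_of_d1_lt hd ht) t₀ ht₀ θ
    rwa [mul_div_cancel₀ _ hΛ.ne'] at this
  -- At the fixed time `t₀` the equation is a linear transport equation; the remaining times enter
  -- only through the field, which `d1` controls.
  have hF : LinearFlow (fun s => driftGradient f g y μ (ρ s) t₀) (fun s => ρ s t₀) M Λ := by
    refine ⟨fun s hs => hM s hs t₀ ht₀, fun s₀ hs₀ D hD => ?_, hΛ,
      fun s hs => (hgrad _ (hMρ s hs) t₀ ht₀).2, fun s => driftGradient_smul hhom,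
      fun s₀ hs₀ D hD => ?_, fun s hs φ hφ hφs => ?_⟩
    · filter_upwards [(hflow.continuous s₀ hs₀).eventually
        (gt_mem_nhds (ENNReal.ofReal_pos.2 hD))] with s hs using near_of_d1_lt hs ht₀
    · filter_upwards [(hflow.continuous s₀ hs₀).eventually
        (gt_mem_nhds (ENNReal.ofReal_pos.2 (div_pos hD hΛ))), self_mem_nhdsWithin] with s hs hs0
      exact hstab' _ _ (hMρ s hs0) (hMρ s₀ hs₀) D hD hs
    · have := hflow.equation t₀ ht₀ s hs φ hφ hφs
      simpa only [inner_gradient_left,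
        ((hgrad _ (hMρ s hs.le) t₀ ht₀).1 _).gradient] using this
  obtain ⟨ra, rb, hra, hrab, hsep⟩ := hsep
  obtain ⟨θ, hθ⟩ := exists_firstVariation_neg hf hhom hdata hpath ht₀ hloss
  have hW := hgrad _ hMρinf t₀ ht₀
  refine absurd (hF.nonneg_of_tendsto hW.1 (firstVariation_smul hhom) (driftGradient_smul hhom)
    hW.2 (fun ε hε => ?_) hra hrab (by rwa [hflow.initial t₀ ht₀]) hsard θ) (not_le.2 hθ)
  filter_upwards [hlim.eventually (gt_mem_nhds (ENNReal.ofReal_pos.2 (div_pos hε hΛ))),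
    eventually_ge_atTop 0] with s hs hs0
  exact hstab' _ _ (hMρ s hs0) hMρinf ε hε hs
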